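/- Let $n\ge 0$. For a homogeneous real quadratic Hamiltonian $H(x,p)$ on $T^*\mathbb{R}^n$ let $\widehat H$ be its Weyl quantization (with $\hat x_j=x_j$, $\hat p_j=-i\,\partial/\partial x_j$), acting on $L^2(\mathbb{R}^n)$. Let $\mathrm{Mp}(n)$ be the group generated by the unitary operators $\exp(-i\widehat H)$ for all such $H$, and $\mathrm{Mp}^c(n)$ the group generated by the unitary operators $\exp(-i(\widehat H+c))$ for all such $H$ and all $c\in\mathbb{R}$. Then there is a (necessarily unique) group homomorphism $\pi:\mathrm{Mp}(n)\to\mathrm{Sp}(n)$ that sends $\exp(-i\widehat H)$ to the time-one flow of the Hamiltonian system $\dot x=H_p$, $\dot p=-H_x$. Regard $U(n)$ as a subgroup of $\mathrm{Sp}(n)$ through $T^*\mathbb{R}^n\simeq\mathbb{C}^n$, $(x,p)\mapsto z=p+ix$. Near $I\in U(n)$ there is a section $\pi^{-1}$ of $\pi$, continuous in the strong operator topology, with $\pi^{-1}(I)=I$, and any two such sections agree near $I$. The mapping $$ s\longmapsto \pi^{-1}(s)\sqrt{\det s}, $$ defined in a neighborhood of $I$ in $U(n)$, with the branch of the square root such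 that $\sqrt 1=1$, extends from a neighborhood of $I$ to an injective group homomorphism $R:U(n)\to\mathrm{Mp}^c(n)$, and $R$ is a strongly continuous unitary representation of $U(n)$ on $L^2(\mathbb{R}^n)$. Explicitly, for all real $n\times n$ matrices $A$ (symmetric) and $B$ (skew-symmetric), $$ R(\exp(B+iA))=\exp(-i\widehat H)\sqrt{\det(\exp(B+iA))}=\exp(-i\widehat H)\exp(i\,\mathrm{tr}A/2), $$ where $\widehat H$ is the Weyl quantization of $$ H(x,p)=\frac12\,(x,p)\begin{pmatrix}A&-B\\B&A\end{pmatrix}\begin{pmatrix}x\\p\end{pmatrix}, $$ and $\exp(i\,\mathrm{tr}A/2)$ is the square root of $\det(\exp(B+iA))$ meant in the middle term. -/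

import Mathlib

open scoped SchwartzMap Topology Matrix

noncomputable section

namespace Metaplectic

/-- Configuration space `ℝⁿ` with its Euclidean norm. -/
abbrev E (n : ℕ) := EuclideanSpace ℝ (Fin n)

/-- The Hilbert space `L²(ℝⁿ)` of complex valued functions, with Lebesgue measure. -/
abbrev L2 (n : ℕ) := MeasureTheory.Lp ℂ 2 (MeasureTheory.volume : MeasureTheory.Measure (E n))

/-- The group of unitary operators on `L²(ℝⁿ)`. -/
abbrev UnitaryOps (n : ℕ) := ↥(unitary (L2 n →L[ℂ] L2 n))

/-- The bounded operator on `L²(ℝⁿ)` underlying a unitary operator. -/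
abbrev op {n : ℕ} (V : UnitaryOps n) : L2 n →L[ℂ] L2 n := V

/-- The position operator `f ↦ x_j f` on the Schwartz space. -/
def position {n : ℕ} (j : Fin n) : 𝓢(E n, ℂ) →L[ℂ] 𝓢(E n, ℂ) :=
  SchwartzMap.smulLeftCLM ℂ (fun x : E n => ((x j : ℝ) : ℂ))

/-- The momentum operator `f ↦ -i ∂f/∂x_j` on the Schwartz space. -/
def momentum {n : ℕ} (j : Fin n) : 𝓢(E n, ℂ) →L[ℂ] 𝓢(E n, ℂ) :=
  (-Complex.I) •
    LineDeriv.lineDerivOpCLM ℂ 𝓢(E n, ℂ) (EuclideanSpace.single j (1 : ℝ))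

theorem position_apply {n : ℕ} (j : Fin n) (f : 𝓢(E n, ℂ)) (x : E n) :
    position j f x = ((x j : ℝ) : ℂ) * f x := by
  have h : Function.HasTemperateGrowth (fun x : E n => ((x j : ℝ) : ℂ)) :=
    (Complex.ofRealCLM ∘L (EuclideanSpace.proj j : E n →L[ℝ] ℝ)).hasTemperateGrowth
  simp [position, SchwartzMap.smulLeftCLM_apply_apply h]

theorem momentum_apply {n : ℕ} (j : Fin n) (f : 𝓢(E n, ℂ)) (x : E n) :
    momentum j f x =
      -Complex.I * lineDeriv ℝ (f : E n → ℂ) x (EuclideanSpace.single j (1 : ℝ)) := by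
  simp [momentum, SchwartzMap.lineDerivOp_apply]

/-- The operators quantizing the phase space coordinates `(x₁, …, x_n, p₁, …, p_n)`. -/
def coordinate {n : ℕ} : Fin n ⊕ Fin n → (𝓢(E n, ℂ) →L[ℂ] 𝓢(E n, ℂ)) :=
  Sum.elim position momentum

/-- The Weyl quantization, acting on Schwartz functions, of the homogeneous quadratic Hamiltonian
`H(z) = 1/2 zᵀ M z`, `z = (x, p)`: each monomial `z_a z_b` is quantized as the symmetrized product
`(Z_a Z_b + Z_b Z_a) / 2` of the coordinate operators. -/
def weylQuantization {n : ℕ} (M : Matrix (Fin n ⊕ Fin n) (Fin n ⊕ Fin n) ℝ) :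
    𝓢(E n, ℂ) →L[ℂ] 𝓢(E n, ℂ) :=
  (1 / 2 : ℂ) • ∑ a, ∑ b, ((M a b : ℝ) : ℂ) •
    ((1 / 2 : ℂ) •
      ((coordinate a).comp (coordinate b) + (coordinate b).comp (coordinate a)))

/-- `V = exp(-iT)`: there is a strongly continuous one-parameter group `U` of unitary operators
with `U 1 = V` whose infinitesimal generator extends `-iT`, where the symmetric operator `T` is
given on Schwartz functions. If `T` is essentially self-adjoint (as for Weyl quantizations of real
quadratic Hamiltonians plus constants), this is the exponential of the closure of `-iT`. -/
def IsExpNegI {n : ℕ} (T : 𝓢(E n, ℂ) →L[ℂ] 𝓢(E n, ℂ)) (V : UnitaryOps n) : Prop :=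
  ∃ U : ℝ → UnitaryOps n,
    (∀ s t : ℝ, U (s + t) = U s * U t) ∧
    (∀ f : L2 n, Continuous fun t : ℝ => op (U t) f) ∧
    (∀ f : 𝓢(E n, ℂ), HasDerivAt (fun t : ℝ => op (U t) (f.toLp 2 MeasureTheory.volume))
      ((-Complex.I) • (T f).toLp 2 MeasureTheory.volume) 0) ∧
    U 1 = V

/-- The metaplectic group `Mp(n)`, generated by the unitary operators `exp(-iĤ)` with `Ĥ` the
Weyl quantization of a homogeneous real quadratic Hamiltonian `H`. -/
def Mp (n : ℕ) : Subgroup (UnitaryOps n) :=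
  Subgroup.closure {V | ∃ M : Matrix (Fin n ⊕ Fin n) (Fin n ⊕ Fin n) ℝ,
    M.IsSymm ∧ IsExpNegI (weylQuantization M) V}

/-- The complex metaplectic group `Mpᶜ(n)`, generated by the unitary operators `exp(-i(Ĥ + c))`
with `H` as above and `c` a real constant. -/
def Mpc (n : ℕ) : Subgroup (UnitaryOps n) :=
  Subgroup.closure {V | ∃ (M : Matrix (Fin n ⊕ Fin n) (Fin n ⊕ Fin n) ℝ) (c : ℝ),
    M.IsSymm ∧
      IsExpNegI (weylQuantization M + (c : ℂ) • ContinuousLinearMap.id ℂ 𝓢(E n, ℂ)) V}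

/-- The matrix of the time one flow of the Hamiltonian system `ẋ = H_p`, `ṗ = -H_x` of
`H(z) = 1/2 zᵀ M z`, that is, of `ż = !![0, 1; -1, 0] M z`. -/
def hamiltonianFlow {n : ℕ} (M : Matrix (Fin n ⊕ Fin n) (Fin n ⊕ Fin n) ℝ) :
    Matrix (Fin n ⊕ Fin n) (Fin n ⊕ Fin n) ℝ :=
  NormedSpace.exp (Matrix.fromBlocks 0 1 (-1) 0 * M)

/-- `π` is the projection from the metaplectic to the symplectic group: the group homomorphism
sending `exp(-iĤ)` to the time one flow of `H`. As the operators `exp(-iĤ)` generate `Mp(n)`, at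
most one homomorphism has this property. -/
def IsProjection {n : ℕ} (π : Mp n →* Matrix.symplecticGroup (Fin n) ℝ) : Prop :=
  ∀ (M : Matrix (Fin n ⊕ Fin n) (Fin n ⊕ Fin n) ℝ), M.IsSymm →
    ∀ V : Mp n, IsExpNegI (weylQuantization M) (V : UnitaryOps n) →
      (π V : Matrix (Fin n ⊕ Fin n) (Fin n ⊕ Fin n) ℝ) = hamiltonianFlow M

/-- The real `2n × 2n` matrix of the map `z ↦ s z` of `ℂⁿ`, in the real coordinates `(x, p)` with
`z = p + i x`. -/
def realification {n : ℕ} (s : Matrix (Fin n) (Fin n) ℂ) :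
    Matrix (Fin n ⊕ Fin n) (Fin n ⊕ Fin n) ℝ :=
  Matrix.fromBlocks (s.map Complex.re) (s.map Complex.im)
    (-(s.map Complex.im)) (s.map Complex.re)

theorem realification_mulVec {n : ℕ} (s : Matrix (Fin n) (Fin n) ℂ) (x p : Fin n → ℝ) :
    (fun j => (((realification s *ᵥ Sum.elim x p) (Sum.inr j) : ℝ) : ℂ) +
      Complex.I * (((realification s *ᵥ Sum.elim x p) (Sum.inl j) : ℝ) : ℂ)) =
      s *ᵥ fun j => ((p j : ℝ) : ℂ) + Complex.I * ((x j : ℝ) : ℂ) := by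
  funext j
  apply Complex.ext <;>
  simp [realification, Matrix.mulVec, dotProduct, Finset.sum_add_distrib,
    Complex.re_sum, Complex.im_sum, sub_eq_neg_add]

/-- `σ` is, near the identity of `U(n)`, a section of `π` over `U(n) ⊂ Sp(n)` with `σ(I) = I`,
continuous for the strong operator topology. -/
def IsLocalSection {n : ℕ} (π : Mp n →* Matrix.symplecticGroup (Fin n) ℝ)
    (σ : Matrix.unitaryGroup (Fin n) ℂ → Mp n) : Prop :=
  σ 1 = 1 ∧
  ∃ N ∈ 𝓝 (1 : Matrix.unitaryGroup (Fin n) ℂ),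
    (∀ s ∈ N, (π (σ s) : Matrix (Fin n ⊕ Fin n) (Fin n ⊕ Fin n) ℝ) =
      realification (s : Matrix (Fin n) (Fin n) ℂ)) ∧
    ∀ f : L2 n, ContinuousOn (fun s => op (σ s : UnitaryOps n) f) N

/-- The skew-Hermitian matrix `B + iA`. -/
def skew {n : ℕ} (A B : Matrix (Fin n) (Fin n) ℝ) : Matrix (Fin n) (Fin n) ℂ :=
  B.map (fun r : ℝ => (r : ℂ)) + Complex.I • A.map (fun r : ℝ => (r : ℂ))

theorem skew_conjTranspose {n : ℕ} {A B : Matrix (Fin n) (Fin n) ℝ}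
    (hA : Aᵀ = A) (hB : Bᵀ = -B) : (skew A B)ᴴ = -skew A B := by
  ext i j
  have h1 : A j i = A i j := congrFun (congrFun hA i) j
  have h2 : B j i = -B i j := congrFun (congrFun hB i) j
  simp [skew, h1, h2]
  ring

/-- The element `exp(B + iA)` of `U(n)`, for `A` symmetric and `B` skew-symmetric. -/
def expSkew {n : ℕ} (A B : Matrix (Fin n) (Fin n) ℝ) (hA : Aᵀ = A) (hB : Bᵀ = -B) :
    Matrix.unitaryGroup (Fin n) ℂ :=
  ⟨NormedSpace.exp (skew A B), by
    rw [Matrix.mem_unitaryGroup_iff', Matrix.star_eq_conjTranspose, ← Matrix.exp_conjTranspose,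
      skew_conjTranspose hA hB, ← Matrix.exp_add_of_commute _ _ (Commute.neg_left (Commute.refl (skew A B))),
      neg_add_cancel, NormedSpace.exp_zero]⟩

end Metaplectic

end

/-! Everything is computed on the coherent states φ_z(x) = exp(-|x|²/2 + √2 z·x - z·z/2) with z ∈
ℂⁿ. They are eigenvectors of the annihilation operators x_j + i p_j, their z-derivatives come from
the creation operators x_j - i p_j, they are total in L² (`eq_zero_of_inner_coherent`), and ⟨φ_w,
φ_z⟩ = π^{n/2} exp(w̄·z) (`inner_coherent`).

The representation is defined by R(s) φ_z = φ_{s̄z} (`rho`). The Gram kernel depends only on w̄·z,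
so this is isometric; multiplicativity, injectivity and strong continuity are read off from the
parameters. The Hamiltonian of B + iA has no pair creation or annihilation terms, so it
differentiates φ_z along a linear vector field in z and adds tr A/2 from reordering
(`weylQuantization_hamMatrix_coherent`). Hence R(exp(B+iA)) = exp(-i(Ĥ - tr A/2)), which is the
explicit formula. Every unitary matrix is such an exponential, so R takes values in Mpᶜ(n).

For the projection, one needs uniqueness of the Schrödinger evolution. Coherent states are analytic
vectors of every quadratic Hamiltonian (`exists_graphNorm_iterate_le`), so weak solutions are unique
for short times (`exists_weak_uniqueness`). This determines exp(-iĤ) and shows that it transports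
linear observables by the Hamiltonian flow (`IsUnitaryGroup.implements`). The operator determines
the transporting matrix (`Implements.unique`), which makes π a homomorphism.

Local sections agree because ker π ⊂ {±1}. Schur's lemma (`Implements.eq_smul`) makes an element of
the kernel a scalar c, and the invariance of ⟨φ_0, Vφ_0⟩² det(`vacMatrix` S)
(`Implements.vacuum_mul`) forces c² = 1. Near I the map s ↦ (det s)^{-1/2} R(s) is a section, and
continuity excludes the other sign. -/

noncomputable section

namespace Metaplectic

open MeasureTheory LineDeriv

variable {n : ℕ}

/-! ### The Schwartz space inside L² -/

/-- The inclusion of the Schwartz space into `L²(ℝⁿ)`. -/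
def toL2 : 𝓢(E n, ℂ) →L[ℂ] L2 n := SchwartzMap.toLpCLM ℂ ℂ 2 volume

theorem toL2_apply (f : 𝓢(E n, ℂ)) : toL2 f = f.toLp 2 volume := rfl

theorem inner_toL2_toL2 (f g : 𝓢(E n, ℂ)) :
    inner ℂ (toL2 f) (toL2 g) = ∫ x, inner ℂ (f x) (g x) := by
  simp [toL2_apply]

theorem inner_toL2_left (f : 𝓢(E n, ℂ)) (g : L2 n) :
    inner ℂ (toL2 f) g = ∫ x, inner ℂ (f x) (g x) := by
  apply integral_congr_ae
  filter_upwards [f.coeFn_toLp 2 volume] with x hx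
  rw [toL2_apply, hx]

/-! ### Canonical commutation relations -/

theorem position_apply_eq (j : Fin n) (f : 𝓢(E n, ℂ)) (x : E n) :
    position j f x = (x j : ℂ) * f x := position_apply j f x

theorem momentum_apply_eq (j : Fin n) (f : 𝓢(E n, ℂ)) (x : E n) :
    momentum j f x = -Complex.I * fderiv ℝ f x (EuclideanSpace.single j 1) := by
  simp [momentum, SchwartzMap.lineDerivOp_apply_eq_fderiv]

theorem position_comm (j k : Fin n) (f : 𝓢(E n, ℂ)) :
    position j (position k f) = position k (position j f) := by
  ext x
  simp only [position_apply]
  ring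

theorem lineDerivOp_comm (v w : E n) (f : 𝓢(E n, ℂ)) : ∂_{v} (∂_{w} f) = ∂_{w} (∂_{v} f) := by
  have key : ∀ (v w : E n) (x : E n), ∂_{v} (∂_{w} f) x = fderiv ℝ (fderiv ℝ f) x v w := by
    intro v w x
    rw [SchwartzMap.lineDerivOp_apply_eq_fderiv]
    have h : ⇑(∂_{w} f : 𝓢(E n, ℂ)) = fun y => fderiv ℝ f y w := by
      ext y; exact SchwartzMap.lineDerivOp_apply_eq_fderiv w f y
    have hd : DifferentiableAt ℝ (fderiv ℝ f) x :=
      ((f.smooth 2).fderiv_right (m := 1) (by norm_num)).differentiable (by norm_num) x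
    rw [h, fderiv_clm_apply hd (by fun_prop)]
    simp
  ext x
  rw [key, key]
  exact (f.smooth 2).contDiffAt.isSymmSndFDerivAt (by simp) v w

theorem momentum_comm (j k : Fin n) (f : 𝓢(E n, ℂ)) :
    momentum j (momentum k f) = momentum k (momentum j f) := by
  simp only [momentum, _root_.smul_apply, lineDerivOpCLM_apply, map_smul]
  rw [lineDerivOp_comm]

theorem momentum_position (j k : Fin n) (f : 𝓢(E n, ℂ)) :
    momentum j (position k f) =
      position k (momentum j f) + (if j = k then -Complex.I else 0) • f := by
  ext x
  have h1 : HasFDerivAt (fun y : E n => ((y k : ℝ) : ℂ))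
      (Complex.ofRealCLM ∘L (EuclideanSpace.proj k : E n →L[ℝ] ℝ)) x :=
    (Complex.ofRealCLM ∘L (EuclideanSpace.proj k : E n →L[ℝ] ℝ)).hasFDerivAt
  have h2 : HasFDerivAt (fun y : E n => ((y k : ℝ) : ℂ) * f y) _ x := h1.mul (f.hasFDerivAt x)
  have h3 : (position k f : E n → ℂ) = fun y => ((y k : ℝ) : ℂ) * f y := by
    ext y; exact position_apply k f y
  rw [momentum_apply_eq, h3, h2.fderiv]
  simp only [_root_.add_apply, _root_.smul_apply, position_apply, momentum_apply_eq]
  by_cases h : j = k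
  · subst h; simp; ring
  · simp [h, Ne.symm h]; ring

/-- The matrix of the standard symplectic form in the coordinates `(x, p)`. -/
abbrev symp (n : ℕ) : Matrix (Fin n ⊕ Fin n) (Fin n ⊕ Fin n) ℝ := Matrix.fromBlocks 0 1 (-1) 0

/-- With all the relations collected in the symplectic matrix, the Heisenberg equations below come
out directly in terms of `symp n * M`. -/
theorem coordinate_comm (a b : Fin n ⊕ Fin n) (f : 𝓢(E n, ℂ)) :
    coordinate a (coordinate b f) =
      coordinate b (coordinate a f) + (Complex.I * ((symp n a b : ℝ) : ℂ)) • f := by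
  rcases a with j | j <;> rcases b with k | k
  · simp [coordinate, position_comm j k]
  · simp only [coordinate, Sum.elim_inl, Sum.elim_inr, momentum_position, symp,
      Matrix.fromBlocks_apply₁₂, Matrix.one_apply]
    by_cases h : j = k
    · subst h; simp
    · simp [h, Ne.symm h]
  · simp only [coordinate, Sum.elim_inl, Sum.elim_inr, momentum_position, symp,
      Matrix.fromBlocks_apply₂₁, Matrix.neg_apply, Matrix.one_apply]
    by_cases h : j = k
    · subst h; simp
    · simp [h]
  · simp [coordinate, momentum_comm j k]

/-! ### Symmetry on the Schwartz space -/

theorem inner_position (j : Fin n) (f g : 𝓢(E n, ℂ)) :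
    inner ℂ (toL2 (position j f)) (toL2 g) = inner ℂ (toL2 f) (toL2 (position j g)) := by
  rw [inner_toL2_toL2, inner_toL2_toL2]
  congr 1 with x
  simp only [position_apply, RCLike.inner_apply, map_mul, Complex.conj_ofReal]
  ring

/-- Integration by parts; its minus sign is absorbed by the conjugation of the factor -i. -/
theorem inner_momentum (j : Fin n) (f g : 𝓢(E n, ℂ)) :
    inner ℂ (toL2 (momentum j f)) (toL2 g) = inner ℂ (toL2 f) (toL2 (momentum j g)) := by
  have h := SchwartzMap.integral_bilinear_lineDerivOp_right_eq_neg_left (μ := volume) f g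
    (ContinuousLinearMap.bilinearComp (ContinuousLinearMap.mul ℝ ℂ)
      (Complex.conjCLE : ℂ →L[ℝ] ℂ) (ContinuousLinearMap.id ℝ ℂ)) (EuclideanSpace.single j 1)
  have e : ∀ (a b : 𝓢(E n, ℂ)), inner ℂ (toL2 a) (toL2 b) = ∫ x, (starRingEnd ℂ) (a x) * b x := by
    intro a b
    rw [inner_toL2_toL2]
    congr 1 with x
    rw [RCLike.inner_apply, mul_comm]
  simp only [ContinuousLinearMap.bilinearComp_apply, ContinuousLinearMap.mul_apply',
    ContinuousLinearMap.id_apply, ContinuousLinearEquiv.coe_coe, Complex.conjCLE_apply] at h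
  simp only [momentum, _root_.smul_apply, lineDerivOpCLM_apply, map_smul,
    inner_smul_left, inner_smul_right, e, h]
  simp

theorem inner_coordinate (a : Fin n ⊕ Fin n) (f g : 𝓢(E n, ℂ)) :
    inner ℂ (toL2 (coordinate a f)) (toL2 g) = inner ℂ (toL2 f) (toL2 (coordinate a g)) := by
  rcases a with j | j
  · exact inner_position j f g
  · exact inner_momentum j f g

/-! ### Quadratic Hamiltonians -/

theorem weylQuantization_apply (M : Matrix (Fin n ⊕ Fin n) (Fin n ⊕ Fin n) ℝ) (f : 𝓢(E n, ℂ)) :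
    weylQuantization M f = (1 / 2 : ℂ) • ∑ a, ∑ b, ((M a b : ℝ) : ℂ) •
      ((1 / 2 : ℂ) • (coordinate a (coordinate b f) + coordinate b (coordinate a f))) := by
  simp [weylQuantization]

/-- Exchanging the summation indices carries one ordering into the other, so later computations need
a single ordering. -/
theorem weylQuantization_apply_of_isSymm {M : Matrix (Fin n ⊕ Fin n) (Fin n ⊕ Fin n) ℝ}
    (hM : M.IsSymm) (f : 𝓢(E n, ℂ)) :
    weylQuantization M f =
      (1 / 2 : ℂ) • ∑ a, ∑ b, ((M a b : ℝ) : ℂ) • coordinate a (coordinate b f) := by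
  have h : ∑ a, ∑ b, ((M a b : ℝ) : ℂ) • coordinate b (coordinate a f) =
      ∑ a, ∑ b, ((M a b : ℝ) : ℂ) • coordinate a (coordinate b f) := by
    rw [Finset.sum_comm]
    refine Finset.sum_congr rfl fun a _ => Finset.sum_congr rfl fun b _ => ?_
    rw [hM.apply]
  rw [weylQuantization_apply]
  congr 1
  simp only [smul_add, Finset.sum_add_distrib, smul_comm _ (1 / 2 : ℂ), ← Finset.smul_sum]
  rw [h, ← add_smul]
  norm_num

theorem inner_weylQuantization (M : Matrix (Fin n ⊕ Fin n) (Fin n ⊕ Fin n) ℝ)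
    (f g : 𝓢(E n, ℂ)) :
    inner ℂ (toL2 (weylQuantization M f)) (toL2 g) =
      inner ℂ (toL2 f) (toL2 (weylQuantization M g)) := by
  simp only [weylQuantization_apply, map_smul, map_sum, inner_smul_left, inner_smul_right,
    sum_inner, inner_sum, map_add, inner_add_left, inner_add_right, inner_coordinate,
    Complex.conj_ofReal, map_div₀, map_one, map_ofNat]
  refine congrArg _ (Finset.sum_congr rfl fun a _ => Finset.sum_congr rfl fun b _ => ?_)
  rw [add_comm]

theorem weylQuantization_neg (M : Matrix (Fin n ⊕ Fin n) (Fin n ⊕ Fin n) ℝ) :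
    weylQuantization (-M) = -weylQuantization M := by
  simp only [weylQuantization, Matrix.neg_apply, Complex.ofReal_neg, neg_smul,
    Finset.sum_neg_distrib, smul_neg]

/-- Heisenberg's equations for a quadratic Hamiltonian are Hamilton's equations. -/
theorem weylQuantization_coordinate {M : Matrix (Fin n ⊕ Fin n) (Fin n ⊕ Fin n) ℝ}
    (hM : M.IsSymm) (c : Fin n ⊕ Fin n) (f : 𝓢(E n, ℂ)) :
    Complex.I • weylQuantization M (coordinate c f) =
      Complex.I • coordinate c (weylQuantization M f) +
        ∑ a, (((symp n * M) c a : ℝ) : ℂ) • coordinate a f := by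
  -- Moving Z_c to the front past Z_b and then Z_a leaves two commutators, both linear in the
  -- coordinates.
  have key : ∀ a b, coordinate a (coordinate b (coordinate c f)) =
      coordinate c (coordinate a (coordinate b f)) +
        ((Complex.I * ((symp n b c : ℝ) : ℂ)) • coordinate a f +
        (Complex.I * ((symp n a c : ℝ) : ℂ)) • coordinate b f) := by
    intro a b
    rw [coordinate_comm b c f, map_add, coordinate_comm a c, map_smul]
    abel
  have hsymp : ∀ a b, symp n a b = - symp n b a := by
    rintro (a | a) (b | b) <;> simp [symp, Matrix.one_apply, eq_comm]
  rw [weylQuantization_apply_of_isSymm hM, weylQuantization_apply_of_isSymm hM]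
  simp only [key, smul_add, Finset.sum_add_distrib, map_smul, map_sum]
  -- By symmetry of M the two commutator sums are equal, which cancels the factor 1/2 in front of
  -- the Hamiltonian.
  have h2 : ∑ a, ∑ b, ((M a b : ℝ) : ℂ) • (Complex.I * ((symp n a c : ℝ) : ℂ)) • coordinate b f =
      ∑ a, ∑ b, ((M a b : ℝ) : ℂ) • (Complex.I * ((symp n b c : ℝ) : ℂ)) • coordinate a f := by
    rw [Finset.sum_comm]
    refine Finset.sum_congr rfl fun a _ => Finset.sum_congr rfl fun b _ => ?_
    rw [hM.apply]
  rw [h2]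
  congr 1
  rw [← smul_add, ← two_smul ℂ, smul_smul, smul_smul, Finset.smul_sum]
  refine Finset.sum_congr rfl fun a _ => ?_
  simp only [smul_smul, ← Finset.sum_smul]
  congr 1
  rw [Matrix.mul_apply, Complex.ofReal_sum, Finset.mul_sum]
  refine Finset.sum_congr rfl fun b _ => ?_
  rw [hsymp b c, hM.apply a b]
  push_cast
  linear_combination (-(M a b : ℂ) * (symp n c b : ℂ)) * Complex.I_sq

/-! ### Gaussians as Schwartz functions -/

/-- The real derivative of exp is exp followed by the multiplication map ℂ → (ℂ →L[ℝ] ℂ), whose norm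
is at most 1; so each further derivative leaves the bound unchanged. -/
theorem norm_iteratedFDeriv_cexp_le (m : ℕ) (z : ℂ) :
    ‖iteratedFDeriv ℝ m Complex.exp z‖ ≤ ‖Complex.exp z‖ := by
  induction m with
  | zero => simp
  | succ m ih =>
    have h : fderiv ℝ Complex.exp = fun z => (ContinuousLinearMap.mul ℝ ℂ) (Complex.exp z) := by
      ext z : 1
      rw [(Complex.hasStrictFDerivAt_exp_real z).hasFDerivAt.fderiv]
      ext; simp
    rw [← norm_iteratedFDeriv_fderiv, h]
    have hc : ContDiff ℝ (m : ℕ∞) Complex.exp := Complex.contDiff_exp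
    refine ((ContinuousLinearMap.mul ℝ ℂ).norm_iteratedFDeriv_comp_left hc.contDiffAt
      le_rfl).trans ?_
    calc _ ≤ 1 * ‖Complex.exp z‖ := by
          gcongr
          exact ContinuousLinearMap.opNorm_mul_le ℝ ℂ
      _ = _ := one_mul _

/-- Bound (1 + r)^N by N! exp(1 + r) and complete the square in r - c r². -/
theorem one_add_pow_mul_exp_le {c : ℝ} (hc : 0 < c) (N : ℕ) {r : ℝ} (hr : 0 ≤ r) :
    (1 + r) ^ N * Real.exp (-c * r ^ 2) ≤ N.factorial * Real.exp (1 + 1 / (4 * c)) := by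
  have h1 := Real.pow_div_factorial_le_exp (x := 1 + r) (by positivity) N
  rw [div_le_iff₀ (by positivity)] at h1
  calc _ ≤ Real.exp (1 + r) * N.factorial * Real.exp (-c * r ^ 2) := by gcongr
    _ = N.factorial * Real.exp (1 + r + -c * r ^ 2) := by rw [Real.exp_add (1 + r)]; ring
    _ ≤ _ := by
      gcongr 2
      have : 0 ≤ c * (r - 1 / (2 * c)) ^ 2 := by positivity
      have e : c * (r - 1 / (2 * c)) ^ 2 = c * r ^ 2 - r + 1 / (4 * c) := by field_simp; ring
      linarith

/-- The exponential of a function of temperate growth whose real part is bounded above by a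
negative definite quadratic function is a Schwartz function. -/
def expSchwartz (g : E n → ℂ) (hg : g.HasTemperateGrowth) (c C : ℝ) (hc : 0 < c)
    (hre : ∀ x, (g x).re ≤ -c * ‖x‖ ^ 2 + C) : 𝓢(E n, ℂ) where
  toFun x := Complex.exp (g x)
  smooth' := Complex.contDiff_exp.comp hg.1
  decay' k m := by
    obtain ⟨p, D, hD0, hD⟩ := hg.norm_iteratedFDeriv_le_uniform m
    refine ⟨m.factorial * (D + 1) ^ m * ((k + p * m).factorial * Real.exp (1 + 1 / (4 * c))
      * Real.exp C), fun x => ?_⟩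
    have h1 : ‖iteratedFDeriv ℝ m (Complex.exp ∘ g) x‖ ≤
        m.factorial * ‖Complex.exp (g x)‖ * ((D + 1) * (1 + ‖x‖) ^ p) ^ m := by
      refine norm_iteratedFDeriv_comp_le (N := m) Complex.contDiff_exp
        (hg.1.of_le (by exact_mod_cast le_top)) le_rfl x
        (fun i _ => norm_iteratedFDeriv_cexp_le i _) fun i hi1 him => ?_
      -- The composition estimate wants the i-th derivative bounded by the i-th power of one number;
      -- taking D + 1 makes that number at least 1, so it is below its own powers.
      have hb : (1 : ℝ) ≤ (D + 1) * (1 + ‖x‖) ^ p := by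
        have : (1 : ℝ) ≤ (1 + ‖x‖) ^ p := one_le_pow₀ (by linarith [norm_nonneg x])
        nlinarith
      calc _ ≤ D * (1 + ‖x‖) ^ p := hD i him x
        _ ≤ (D + 1) * (1 + ‖x‖) ^ p := by gcongr; linarith
        _ ≤ _ := le_self_pow₀ hb (by omega)
    have h2 : ‖Complex.exp (g x)‖ ≤ Real.exp (-c * ‖x‖ ^ 2) * Real.exp C := by
      rw [Complex.norm_exp, ← Real.exp_add]
      exact Real.exp_le_exp.2 (hre x)
    have h3 : ‖x‖ ^ k ≤ (1 + ‖x‖) ^ k := by gcongr; linarith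
    have h4 := one_add_pow_mul_exp_le hc (k + p * m) (norm_nonneg x)
    calc ‖x‖ ^ k * ‖iteratedFDeriv ℝ m (fun x => Complex.exp (g x)) x‖
        ≤ (1 + ‖x‖) ^ k * (m.factorial * (Real.exp (-c * ‖x‖ ^ 2) * Real.exp C) *
          ((D + 1) * (1 + ‖x‖) ^ p) ^ m) := by
          gcongr
          exact h1.trans (by gcongr)
      _ = m.factorial * (D + 1) ^ m * (((1 + ‖x‖) ^ (k + p * m) * Real.exp (-c * ‖x‖ ^ 2)) *
          Real.exp C) := by rw [mul_pow, ← pow_mul, pow_add]; ring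
      _ ≤ _ := by gcongr

theorem expSchwartz_apply (g : E n → ℂ) (hg : g.HasTemperateGrowth) (c C : ℝ) (hc : 0 < c)
    (hre : ∀ x, (g x).re ≤ -c * ‖x‖ ^ 2 + C) (x : E n) :
    expSchwartz g hg c C hc hre x = Complex.exp (g x) := rfl

/-- The real Gaussian `exp(-‖x‖² / 4)`. -/
def gaussian (n : ℕ) : 𝓢(E n, ℂ) :=
  expSchwartz (fun x => ((-(1 / 4) * ‖x‖ ^ 2 : ℝ) : ℂ)) (by fun_prop) (1 / 4) 0 (by norm_num)
    (fun x => by rw [Complex.ofReal_re]; linarith)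

theorem norm_gaussian_apply (x : E n) :
    ‖gaussian n x‖ = Real.exp (-(1 / 4) * ‖x‖ ^ 2) := by
  rw [gaussian, expSchwartz_apply, Complex.norm_exp, Complex.ofReal_re]

/-! ### Coherent states -/

/-- The exponent of the coherent state with parameter `z`. -/
def cohExp (z : Fin n → ℂ) (x : E n) : ℂ :=
  ∑ j, (-((x j : ℝ) : ℂ) ^ 2 / 2 + ((√2 : ℝ) : ℂ) * z j * ((x j : ℝ) : ℂ) - z j ^ 2 / 2)

theorem cohExp_hasTemperateGrowth (z : Fin n → ℂ) : (cohExp z).HasTemperateGrowth := by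
  have h : ∀ j : Fin n, Function.HasTemperateGrowth (fun x : E n => ((x j : ℝ) : ℂ)) := fun j =>
    (Complex.ofRealCLM ∘L (EuclideanSpace.proj j : E n →L[ℝ] ℝ)).hasTemperateGrowth
  unfold cohExp
  have e : ∀ x : E n, ∀ j, (-((x j : ℝ) : ℂ) ^ 2 / 2 + ((√2 : ℝ) : ℂ) * z j * ((x j : ℝ) : ℂ)
      - z j ^ 2 / 2) = (-(1 / 2) * ((x j : ℝ) : ℂ) ^ 2 + ((√2 : ℝ) : ℂ) * z j * ((x j : ℝ) : ℂ)
      - z j ^ 2 / 2) := by intros; ring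
  simp only [e]
  refine Function.HasTemperateGrowth.sum fun j _ => ?_
  exact ((((Function.HasTemperateGrowth.const _).mul ((h j).pow 2)).add
    ((Function.HasTemperateGrowth.const _).mul (h j))).sub (Function.HasTemperateGrowth.const _))

theorem cohExp_re_le {R : ℝ} (hR : 0 ≤ R) {z : Fin n → ℂ} (hz : ‖z‖ ≤ R) (x : E n) :
    (cohExp z x).re ≤ -(1 / 2) * ‖x‖ ^ 2 + (2 * n * R) * ‖x‖ + n * R ^ 2 / 2 := by
  have hx : ∑ j, (x j) ^ 2 = ‖x‖ ^ 2 := (EuclideanSpace.real_norm_sq_eq x).symm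
  have hj : ∀ j ∈ Finset.univ, (-((x j : ℝ) : ℂ) ^ 2 / 2 + ((√2 : ℝ) : ℂ) * z j * ((x j : ℝ) : ℂ)
      - z j ^ 2 / 2).re ≤ -(x j) ^ 2 / 2 + (2 * R * ‖x‖ + R ^ 2 / 2) := by
    intro j _
    have hzj : ‖z j‖ ≤ R := (norm_le_pi_norm z j).trans hz
    have h1 : (-((x j : ℝ) : ℂ) ^ 2 / 2).re = -(x j) ^ 2 / 2 := by
      rw [← Complex.ofReal_pow, ← Complex.ofReal_neg, ← Complex.ofReal_ofNat, ← Complex.ofReal_div,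
        Complex.ofReal_re]
    have h2 : (((√2 : ℝ) : ℂ) * z j * ((x j : ℝ) : ℂ)).re ≤ 2 * R * ‖x‖ := by
      refine (Complex.re_le_norm _).trans ?_
      rw [norm_mul, norm_mul, Complex.norm_real, Complex.norm_real]
      have : ‖x j‖ ≤ ‖x‖ := PiLp.norm_apply_le x j
      have h2' : ‖√2‖ ≤ 2 := by
        rw [Real.norm_of_nonneg (Real.sqrt_nonneg _)]
        exact Real.sqrt_le_iff.2 ⟨by norm_num, by norm_num⟩
      gcongr
    have h3 : -(z j ^ 2 / 2).re ≤ R ^ 2 / 2 := by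
      rw [← Complex.neg_re]
      refine (Complex.re_le_norm _).trans ?_
      rw [norm_neg, norm_div, norm_pow]
      simp only [Complex.norm_ofNat]
      gcongr
    rw [Complex.sub_re, Complex.add_re, h1]
    linarith
  rw [cohExp, Complex.re_sum]
  refine (Finset.sum_le_sum hj).trans (le_of_eq ?_)
  rw [Finset.sum_add_distrib, ← Finset.sum_div, Finset.sum_neg_distrib, hx]
  simp
  ring

/-- The coherent state `exp(-|x|²/2 + √2 z·x - z·z/2)`. -/
def coherent (z : Fin n → ℂ) : 𝓢(E n, ℂ) :=
  expSchwartz (cohExp z) (cohExp_hasTemperateGrowth z) (1 / 4)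
    ((2 * n * ‖z‖) ^ 2 + n * ‖z‖ ^ 2 / 2) (by norm_num) fun x => by
      have := cohExp_re_le (norm_nonneg z) le_rfl x
      -- Half of the Gaussian exponent 1/2 is spent on absorbing the term linear in ‖x‖.
      nlinarith [sq_nonneg (‖x‖ / 2 - 2 * n * ‖z‖)]

theorem coherent_apply (z : Fin n → ℂ) (x : E n) : coherent z x = Complex.exp (cohExp z x) := rfl

/-- The domination needed for differentiating under the integral: uniform on a ball of parameters,
with the factor 1 + ‖x‖ that a z-derivative produces. The weaker exponent 1/4 of `gaussian` leaves
room for the linear terms. -/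
theorem exists_norm_coherent_le (n : ℕ) (R : ℝ) (hR : 0 ≤ R) : ∃ K : ℝ, 0 ≤ K ∧
    ∀ z : Fin n → ℂ, ‖z‖ ≤ R → ∀ x, (1 + ‖x‖) * ‖coherent z x‖ ≤ K * ‖gaussian n x‖ := by
  refine ⟨Real.exp ((2 * n * R + 1) ^ 2 + n * R ^ 2 / 2), (Real.exp_pos _).le, fun z hz x => ?_⟩
  rw [coherent_apply, norm_gaussian_apply, Complex.norm_exp]
  have h1 : 1 + ‖x‖ ≤ Real.exp ‖x‖ := by linarith [Real.add_one_le_exp ‖x‖]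
  calc _ ≤ Real.exp ‖x‖ * Real.exp (cohExp z x).re := by gcongr
    _ ≤ _ := by
      rw [← Real.exp_add, ← Real.exp_add]
      refine Real.exp_le_exp.2 ?_
      have := cohExp_re_le hR hz x
      nlinarith [sq_nonneg (‖x‖ / 2 - (2 * n * R + 1))]

theorem coherent_zero_apply (x : E n) : coherent (0 : Fin n → ℂ) x ≠ 0 := by
  rw [coherent_apply]; exact Complex.exp_ne_zero _

/-- Coherent states are joint eigenvectors of the annihilation operators. -/
theorem momentum_coherent (z : Fin n → ℂ) (j : Fin n) :
    momentum j (coherent z) = Complex.I • position j (coherent z) -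
      (Complex.I * ((√2 : ℝ) : ℂ) * z j) • coherent z := by
  ext x
  have h1 : ∀ k : Fin n, HasFDerivAt (fun y : E n => ((y k : ℝ) : ℂ))
      (Complex.ofRealCLM ∘L (EuclideanSpace.proj k : E n →L[ℝ] ℝ)) x := fun k =>
    (Complex.ofRealCLM ∘L (EuclideanSpace.proj k : E n →L[ℝ] ℝ)).hasFDerivAt
  have h2 : HasFDerivAt (cohExp z) (∑ k, ((-((x k : ℝ) : ℂ) + ((√2 : ℝ) : ℂ) * z k) •
      (Complex.ofRealCLM ∘L (EuclideanSpace.proj k : E n →L[ℝ] ℝ)))) x := by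
    unfold cohExp
    refine HasFDerivAt.fun_sum fun k _ => ?_
    have := ((((h1 k).pow 2).const_mul (-1 / 2 : ℂ)).add
      ((h1 k).const_mul (((√2 : ℝ) : ℂ) * z k))).sub_const (z k ^ 2 / 2)
    refine (this.congr_fderiv ?_).congr_of_eventuallyEq (Filter.Eventually.of_forall fun y => ?_)
    · ext v
      simp
      ring
    · simp
      ring
  have h3 : HasFDerivAt (coherent z) _ x := h2.cexp
  rw [momentum_apply_eq, h3.fderiv]
  have hs : ∑ k, (-((x k : ℝ) : ℂ) + ((√2 : ℝ) : ℂ) * z k) *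
      (((EuclideanSpace.single j (1 : ℝ) : E n) k : ℝ) : ℂ) =
      -((x j : ℝ) : ℂ) + ((√2 : ℝ) : ℂ) * z j := by
    rw [Finset.sum_eq_single j]
    · simp
    · intro k _ hk; simp [hk]
    · simp
  have hp : ∀ (k : Fin n) (v : E n), (EuclideanSpace.proj k : E n →L[ℝ] ℝ) v = v k :=
    fun _ _ => rfl
  simp only [_root_.smul_apply, _root_.sum_apply, ContinuousLinearMap.comp_apply, hp,
    Complex.ofRealCLM_apply, smul_eq_mul, hs,
    _root_.sub_apply, position_apply_eq, coherent_apply]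
  ring

/-- The derivative of the coherent state with parameter `z` in the direction `h`. -/
def cohDeriv (z h : Fin n → ℂ) : 𝓢(E n, ℂ) :=
  ∑ j, h j • (((√2 : ℝ) : ℂ) • position j (coherent z) - z j • coherent z)

theorem cohDeriv_apply (z h : Fin n → ℂ) (x : E n) :
    cohDeriv z h x = (∑ j, h j * (((√2 : ℝ) : ℂ) * ((x j : ℝ) : ℂ) - z j)) * coherent z x := by
  simp only [cohDeriv, _root_.sum_apply, _root_.smul_apply, _root_.sub_apply,
    position_apply_eq, smul_eq_mul, Finset.sum_mul]
  exact Finset.sum_congr rfl fun j _ => by ring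

theorem norm_coherent_mul_le (z h : Fin n → ℂ) {R : ℝ} (hR : 0 ≤ R) (hz : ‖z‖ ≤ R) (x : E n) :
    ‖∑ j, h j * (((√2 : ℝ) : ℂ) * ((x j : ℝ) : ℂ) - z j)‖ ≤
      n * ((2 + R) * (1 + ‖x‖)) * ‖h‖ := by
  have hj : ∀ j ∈ Finset.univ, ‖h j * (((√2 : ℝ) : ℂ) * ((x j : ℝ) : ℂ) - z j)‖ ≤
      ((2 + R) * (1 + ‖x‖)) * ‖h‖ := by
    intro j _
    have h1 : ‖h j‖ ≤ ‖h‖ := norm_le_pi_norm h j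
    have h2 : ‖z j‖ ≤ R := (norm_le_pi_norm z j).trans hz
    have h3 : ‖((√2 : ℝ) : ℂ) * ((x j : ℝ) : ℂ)‖ ≤ 2 * ‖x‖ := by
      rw [norm_mul, Complex.norm_real, Complex.norm_real]
      have : ‖x j‖ ≤ ‖x‖ := PiLp.norm_apply_le x j
      have h2' : ‖√2‖ ≤ 2 := by
        rw [Real.norm_of_nonneg (Real.sqrt_nonneg _)]
        exact Real.sqrt_le_iff.2 ⟨by norm_num, by norm_num⟩
      gcongr
    have h4 : ‖((√2 : ℝ) : ℂ) * ((x j : ℝ) : ℂ) - z j‖ ≤ (2 + R) * (1 + ‖x‖) := by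
      refine (norm_sub_le _ _).trans ?_
      nlinarith [norm_nonneg x]
    rw [norm_mul, mul_comm]
    gcongr
  refine (norm_sum_le_of_le _ hj).trans (le_of_eq ?_)
  simp
  ring

theorem inner_toL2_right (f : L2 n) (g : 𝓢(E n, ℂ)) :
    inner ℂ f (toL2 g) = ∫ x, (starRingEnd ℂ) (f x) * g x := by
  apply integral_congr_ae
  filter_upwards [g.coeFn_toLp 2 volume] with x hx
  rw [toL2_apply, hx, RCLike.inner_apply, mul_comm]

theorem integrable_conj_mul (f : L2 n) (g : 𝓢(E n, ℂ)) :
    Integrable (fun x => (starRingEnd ℂ) (f x) * g x) := by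
  refine (MeasureTheory.L2.integrable_inner (𝕜 := ℂ) f (toL2 g)).congr ?_
  filter_upwards [g.coeFn_toLp 2 volume] with x hx
  rw [toL2_apply, hx, RCLike.inner_apply, mul_comm]

/-- Coherent states depend, weakly in `L²`, holomorphically on the parameter. -/
theorem hasFDerivAt_inner_coherent (f : L2 n) (z : Fin n → ℂ) :
    ∃ L : (Fin n → ℂ) →L[ℂ] ℂ, (∀ h, L h = inner ℂ f (toL2 (cohDeriv z h))) ∧
      HasFDerivAt (fun z => inner ℂ f (toL2 (coherent z))) L z := by
  let Q : (Fin n → ℂ) → E n → ((Fin n → ℂ) →L[ℂ] ℂ) := fun w x =>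
    ∑ j, (((√2 : ℝ) : ℂ) * ((x j : ℝ) : ℂ) - w j) • (ContinuousLinearMap.proj j)
  have hQ : ∀ w x h, Q w x h = ∑ j, h j * (((√2 : ℝ) : ℂ) * ((x j : ℝ) : ℂ) - w j) := by
    intro w x h
    simp [Q, mul_comm]
  let F' : (Fin n → ℂ) → E n → ((Fin n → ℂ) →L[ℂ] ℂ) := fun w x =>
    ((starRingEnd ℂ) (f x) * coherent w x) • Q w x
  have hR : (0 : ℝ) ≤ ‖z‖ + 1 := by positivity
  obtain ⟨K, hK0, hK⟩ := exists_norm_coherent_le n (‖z‖ + 1) hR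
  have hmeas : AEStronglyMeasurable (fun x => (starRingEnd ℂ) (f x)) (volume : Measure (E n)) :=
    Complex.continuous_conj.comp_aestronglyMeasurable (Lp.aestronglyMeasurable f)
  have hQc : ∀ w, Continuous (Q w) := fun w => by
    refine continuous_finsetSum _ fun j _ => ?_
    have : Continuous fun x : E n => ((√2 : ℝ) : ℂ) * ((x j : ℝ) : ℂ) - w j := by fun_prop
    exact this.smul continuous_const
  have hF'm : ∀ w, AEStronglyMeasurable (F' w) (volume : Measure (E n)) := fun w =>
    (hmeas.mul (coherent w).continuous.aestronglyMeasurable).smul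
      (hQc w).aestronglyMeasurable
  -- On the unit ball around z the derivative is dominated by a multiple of |f| times one fixed
  -- Gaussian, and this product of two L² functions is integrable.
  have hbound : ∀ x, ∀ w ∈ Metric.ball z 1, ‖F' w x‖ ≤
      (n * (2 + (‖z‖ + 1)) * K) * ‖(starRingEnd ℂ) (f x) * gaussian n x‖ := by
    intro x w hw
    have hw' : ‖w‖ ≤ ‖z‖ + 1 := by
      have : ‖w - z‖ < 1 := by simpa [dist_eq_norm] using hw
      have := norm_add_le (w - z) z
      simp only [sub_add_cancel] at this
      linarith
    have hq : ‖Q w x‖ ≤ n * ((2 + (‖z‖ + 1)) * (1 + ‖x‖)) := by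
      refine ContinuousLinearMap.opNorm_le_bound _ (by positivity) fun h => ?_
      rw [hQ]
      exact norm_coherent_mul_le w h hR hw' x
    calc ‖F' w x‖ = ‖(starRingEnd ℂ) (f x)‖ * ‖coherent w x‖ * ‖Q w x‖ := by
          rw [norm_smul, norm_mul]
      _ ≤ ‖(starRingEnd ℂ) (f x)‖ * ‖coherent w x‖ * (n * ((2 + (‖z‖ + 1)) * (1 + ‖x‖))) := by
          gcongr
      _ = (n * (2 + (‖z‖ + 1))) * ‖(starRingEnd ℂ) (f x)‖ *
          ((1 + ‖x‖) * ‖coherent w x‖) := by ring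
      _ ≤ (n * (2 + (‖z‖ + 1))) * ‖(starRingEnd ℂ) (f x)‖ * (K * ‖gaussian n x‖) := by
          exact mul_le_mul_of_nonneg_left (hK w hw' x) (by positivity)
      _ = _ := by rw [norm_mul]; ring
  have hdom : Integrable (fun x => (n * (2 + (‖z‖ + 1)) * K) *
      ‖(starRingEnd ℂ) (f x) * gaussian n x‖) := (integrable_conj_mul f (gaussian n)).norm.const_mul _
  have hint : Integrable (F' z) := by
    refine hdom.mono' (hF'm z) (Filter.Eventually.of_forall fun x => ?_)
    exact hbound x z (Metric.mem_ball_self one_pos)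
  refine ⟨∫ x, F' z x, fun h => ?_, ?_⟩
  · rw [ContinuousLinearMap.integral_apply hint, inner_toL2_right]
    congr 1 with x
    simp only [F', _root_.smul_apply, hQ, cohDeriv_apply, smul_eq_mul]
    ring
  · simp only [inner_toL2_right]
    refine hasFDerivAt_integral_of_dominated_of_fderiv_le (Metric.ball_mem_nhds z one_pos)
      (Filter.Eventually.of_forall fun w =>
        hmeas.mul (coherent w).continuous.aestronglyMeasurable)
      (integrable_conj_mul f _) (hF'm z)
      (Filter.Eventually.of_forall hbound) hdom (Filter.Eventually.of_forall fun x w _ => ?_)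
    have h0 : ∀ j : Fin n, HasFDerivAt (fun w : Fin n → ℂ => w j)
      (ContinuousLinearMap.proj (R := ℂ) (φ := fun _ : Fin n => ℂ) j) w := fun j =>
      (ContinuousLinearMap.proj (R := ℂ) (φ := fun _ : Fin n => ℂ) j).hasFDerivAt
    have h1 : HasFDerivAt (fun w => cohExp w x) (Q w x) w := by
      unfold cohExp
      refine HasFDerivAt.fun_sum fun j _ => ?_
      have := (((h0 j).const_mul (((√2 : ℝ) : ℂ) * ((x j : ℝ) : ℂ))).const_add
        (-((x j : ℝ) : ℂ) ^ 2 / 2)).sub (((h0 j).pow 2).const_mul (1 / 2 : ℂ))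
      refine (this.congr_fderiv ?_).congr_of_eventuallyEq
        (Filter.Eventually.of_forall fun y => ?_)
      · ext v
        simp
        ring
      · simp
        ring
    have h2 := (h1.cexp).const_mul ((starRingEnd ℂ) (f x))
    refine h2.congr_fderiv ?_
    simp only [F', coherent_apply, smul_smul]

/-- Chain rule for coherent states along a curve of parameters. -/
theorem hasDerivAt_inner_coherent (f : L2 n) {z : ℝ → Fin n → ℂ} {z' : Fin n → ℂ} {t : ℝ}
    (hz : HasDerivAt z z' t) :
    HasDerivAt (fun t => inner ℂ f (toL2 (coherent (z t))))
      (inner ℂ f (toL2 (cohDeriv (z t) z'))) t := by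
  obtain ⟨L, hL, hd⟩ := hasFDerivAt_inner_coherent f (z t)
  rw [← hL]
  exact (hd.restrictScalars ℝ).comp_hasDerivAt t hz

/-- The inner product of two coherent states. -/
theorem inner_coherent (w z : Fin n → ℂ) :
    inner ℂ (toL2 (coherent w)) (toL2 (coherent z)) =
      (Real.pi : ℂ) ^ (n / 2 : ℂ) * Complex.exp (∑ j, (starRingEnd ℂ) (w j) * z j) := by
  rw [inner_toL2_toL2, ← (PiLp.volume_preserving_toLp (Fin n)).integral_comp
    (MeasurableEquiv.toLp 2 _).measurableEmbedding]
  have h := GaussianFourier.integral_cexp_neg_mul_sum_add (b := 1) (by simp)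
    (fun j => ((√2 : ℝ) : ℂ) * ((starRingEnd ℂ) (w j) + z j))
  have e : ∀ v : Fin n → ℝ, inner ℂ (coherent w (WithLp.toLp 2 v)) (coherent z (WithLp.toLp 2 v)) =
      Complex.exp (-1 * ∑ i, ((v i : ℝ) : ℂ) ^ 2 +
        ∑ i, ((√2 : ℝ) : ℂ) * ((starRingEnd ℂ) (w i) + z i) * ((v i : ℝ) : ℂ)) *
      Complex.exp (∑ j, (-((starRingEnd ℂ) (w j) ^ 2 + z j ^ 2) / 2)) := by
    intro v
    rw [RCLike.inner_apply, coherent_apply, coherent_apply, ← Complex.exp_conj, ← Complex.exp_add,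
      ← Complex.exp_add]
    congr 1
    simp only [cohExp, map_sum, Finset.mul_sum, ← Finset.sum_add_distrib]
    refine Finset.sum_congr rfl fun j _ => ?_
    simp only [map_sub, map_add, map_mul, map_div₀, map_neg, map_pow, Complex.conj_ofReal,
      map_ofNat]
    ring
  simp only [e]
  rw [integral_mul_const, h, mul_assoc, ← Complex.exp_add]
  congr 2
  · simp
  · simp
  -- The Gaussian integral contributes (w̄ + z)²/2 in each coordinate; subtracting (w̄² + z²)/2
  -- leaves w̄ z.
  · rw [Finset.sum_div, ← Finset.sum_add_distrib]
    refine Finset.sum_congr rfl fun j _ => ?_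
    have h2 : ((√2 : ℝ) : ℂ) ^ 2 = 2 := by
      rw [← Complex.ofReal_pow, Real.sq_sqrt (by norm_num)]; simp
    rw [mul_pow, h2]
    ring

/-- The coherent states are total in `L²(ℝⁿ)`. -/
theorem eq_zero_of_inner_coherent {f : L2 n}
    (hf : ∀ z, inner ℂ (toL2 (coherent z)) f = 0) : f = 0 := by
  set G : E n → ℂ := fun x => (starRingEnd ℂ) (coherent 0 x) * f x with hG
  have hGint : Integrable G := by
    refine (MeasureTheory.L2.integrable_inner (𝕜 := ℂ) (toL2 (coherent 0)) f).congr ?_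
    filter_upwards [(coherent (0 : Fin n → ℂ)).coeFn_toLp 2 volume] with x hx
    rw [toL2_apply, hx, RCLike.inner_apply, mul_comm]
  have hF : ∀ ξ : E n, FourierTransform.fourier G ξ = 0 := by
    intro ξ
    -- For this purely imaginary parameter φ_z is, up to a nonzero constant, φ_0 times a plane wave,
    -- so the hypothesis says that the Fourier transform of φ̄_0 f vanishes at ξ.
    set z : Fin n → ℂ := fun j => ((√2 : ℝ) : ℂ) * Real.pi * Complex.I * ((ξ j : ℝ) : ℂ) with hz
    have h2 : ((√2 : ℝ) : ℂ) ^ 2 = 2 := by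
      rw [← Complex.ofReal_pow, Real.sq_sqrt (by norm_num)]; simp
    have e : ∀ x : E n, inner ℂ (coherent z x) (f x) =
        Complex.exp (∑ j, -(starRingEnd ℂ) (z j ^ 2) / 2) *
        (Complex.exp (((-2 * Real.pi * inner ℝ x ξ : ℝ) : ℂ) * Complex.I) • G x) := by
      intro x
      rw [RCLike.inner_apply, coherent_apply, hG]
      simp only [coherent_apply, ← Complex.exp_conj, smul_eq_mul]
      rw [← mul_assoc, ← mul_assoc, ← Complex.exp_add, ← Complex.exp_add, mul_comm]
      congr 2
      have hi : inner ℝ x ξ = ∑ j, ξ j * x j := by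
        simp [PiLp.inner_apply]
      rw [hi]
      push_cast
      simp only [cohExp, map_sum, Finset.mul_sum, Finset.sum_mul, ← Finset.sum_add_distrib]
      refine Finset.sum_congr rfl fun j _ => ?_
      simp only [hz, map_sub, map_add, map_mul, map_div₀, map_neg, map_pow, Complex.conj_ofReal,
        map_ofNat, Complex.conj_I, Pi.zero_apply, map_zero]
      linear_combination (-(Real.pi : ℂ) * Complex.I * ξ j * x j) * h2
    have h := hf z
    rw [inner_toL2_left] at h
    simp only [e] at h
    rw [integral_const_mul] at h
    rw [Real.fourier_eq']
    exact (mul_eq_zero.1 h).resolve_left (Complex.exp_ne_zero _)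
  -- Every Schwartz function is a Fourier transform, and the transform can be moved across the
  -- integral onto G.
  have hzero : ∀ g : 𝓢(E n, ℂ), ∫ x, g x • G x = 0 := by
    intro g
    obtain ⟨h, rfl⟩ : ∃ h : 𝓢(E n, ℂ), FourierTransform.fourier h = g :=
      ⟨FourierTransformInv.fourierInv g, FourierTransform.fourier_fourierInv_eq g⟩
    have := VectorFourier.integral_fourierIntegral_smul_eq_flip (L := innerₗ (E n))
      (μ := volume) (ν := volume) (f := h) (g := G)
      Real.continuous_fourierChar continuous_inner h.integrable hGint
    rw [flip_innerₗ] at this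
    refine this.trans ?_
    have h0 : ∀ ξ, VectorFourier.fourierIntegral Real.fourierChar volume (innerₗ (E n)) G ξ = 0 :=
      hF
    simp [h0]
  have hae : ∀ᵐ x, G x = 0 := by
    refine ae_eq_zero_of_integral_contDiff_smul_eq_zero hGint.locallyIntegrable fun g hg hs => ?_
    have hgc : ContDiff ℝ ((⊤ : ℕ∞) : WithTop ℕ∞) (fun x => ((g x : ℝ) : ℂ)) :=
      Complex.ofRealCLM.contDiff.comp hg
    have hsc : HasCompactSupport (fun x => ((g x : ℝ) : ℂ)) := hs.comp_left (g := Complex.ofReal) Complex.ofReal_zero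
    have h1 : ∀ x, hsc.toSchwartzMap hgc x = ((g x : ℝ) : ℂ) := fun x => rfl
    have h2 := hzero (hsc.toSchwartzMap hgc)
    simp only [h1] at h2
    exact h2
  rw [Lp.eq_zero_iff_ae_eq_zero]
  filter_upwards [hae] with x hx
  exact (mul_eq_zero.1 hx).resolve_left
    fun h0 => coherent_zero_apply x ((map_eq_zero _).1 h0)

/-- The coherent states depend continuously in `L²` on the parameter. -/
theorem continuous_toL2_coherent : Continuous fun z : Fin n → ℂ => toL2 (coherent z) := by
  rw [continuous_iff_continuousAt]
  intro z
  rw [ContinuousAt, tendsto_iff_norm_sub_tendsto_zero]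
  -- Expanding the square reduces strong continuity to continuity of the explicit kernel
  -- `inner_coherent`.
  have h : ∀ w, ‖toL2 (coherent w) - toL2 (coherent z)‖ ^ 2 =
      (inner ℂ (toL2 (coherent w)) (toL2 (coherent w)) -
        inner ℂ (toL2 (coherent w)) (toL2 (coherent z)) -
        inner ℂ (toL2 (coherent z)) (toL2 (coherent w)) +
        inner ℂ (toL2 (coherent z)) (toL2 (coherent z)) : ℂ).re := by
    intro w
    rw [← @inner_self_eq_norm_sq ℂ, inner_sub_left, inner_sub_right, inner_sub_right]
    rw [← RCLike.re_eq_complex_re]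
    congr 1
    ring
  have hc : Continuous fun w : Fin n → ℂ => ‖toL2 (coherent w) - toL2 (coherent z)‖ ^ 2 := by
    simp only [h, inner_coherent]
    fun_prop
  have h2 := (hc.sqrt).tendsto z
  simp only [Real.sqrt_sq (norm_nonneg _)] at h2
  simpa using h2

/-! ### Analytic vectors of quadratic Hamiltonians -/

/-- The complex point with the coordinates of a real one. -/
def cplx (x : E n) : Fin n → ℂ := fun j => ((x j : ℝ) : ℂ)

theorem norm_cplx_le (x : E n) : ‖cplx x‖ ≤ ‖x‖ := by
  refine (pi_norm_le_iff_of_nonneg (norm_nonneg x)).2 fun j => ?_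
  rw [cplx, Complex.norm_real]
  exact PiLp.norm_apply_le x j

/-- `h` is the product of a Gaussian and an entire function with growth at most
`K exp(θ ‖z‖²)`. -/
def GaussBound (θ K : ℝ) (h : 𝓢(E n, ℂ)) : Prop :=
  ∃ Q : (Fin n → ℂ) → ℂ, ContDiff ℂ ((⊤ : ℕ∞) : WithTop ℕ∞) Q ∧
    (∀ x : E n, h x = coherent 0 x * Q (cplx x)) ∧
    ∀ z, ‖Q z‖ ≤ K * Real.exp (θ * ‖z‖ ^ 2)

/-! ### Stability of Gaussian bounds under the coordinate operators -/

namespace GaussBound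

variable {θ K : ℝ} {h : 𝓢(E n, ℂ)}

theorem nonneg (H : GaussBound θ K h) : 0 ≤ K := by
  obtain ⟨Q, -, -, hQ⟩ := H
  have := (norm_nonneg _).trans (hQ 0)
  simpa using this

theorem mono (H : GaussBound θ K h) {θ' K' : ℝ} (hθ : θ ≤ θ') (hK : K ≤ K') :
    GaussBound θ' K' h := by
  have h0 := H.nonneg
  have h0' := h0.trans hK
  obtain ⟨Q, h1, h2, h3⟩ := H
  refine ⟨Q, h1, h2, fun z => (h3 z).trans ?_⟩
  gcongr

theorem const_smul (H : GaussBound θ K h) (c : ℂ) : GaussBound θ (‖c‖ * K) (c • h) := by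
  obtain ⟨Q, h1, h2, h3⟩ := H
  refine ⟨fun z => c * Q z, contDiff_const.mul h1, fun x => ?_, fun z => ?_⟩
  · rw [_root_.smul_apply, h2, smul_eq_mul]; ring
  · rw [norm_mul, mul_assoc]
    gcongr
    exact h3 z

theorem add (H : GaussBound θ K h) {K' : ℝ} {g : 𝓢(E n, ℂ)} (H' : GaussBound θ K' g) :
    GaussBound θ (K + K') (h + g) := by
  obtain ⟨Q, h1, h2, h3⟩ := H
  obtain ⟨Q', h1', h2', h3'⟩ := H'
  refine ⟨fun z => Q z + Q' z, h1.add h1', fun x => ?_, fun z => ?_⟩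
  · rw [_root_.add_apply, h2, h2']; ring
  · rw [add_mul]
    exact (norm_add_le _ _).trans (add_le_add (h3 z) (h3' z))

theorem zero (θ : ℝ) : GaussBound θ 0 (0 : 𝓢(E n, ℂ)) :=
  ⟨fun _ => 0, contDiff_const, by simp, by simp⟩

theorem sum {ι : Type*} (s : Finset ι) {κ : ι → ℝ} {g : ι → 𝓢(E n, ℂ)}
    (H : ∀ i ∈ s, GaussBound θ (κ i) (g i)) : GaussBound θ (∑ i ∈ s, κ i) (∑ i ∈ s, g i) := by
  classical
  induction s using Finset.induction_on with
  | empty => simpa using zero θ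
  | insert a s ha ih =>
    rw [Finset.sum_insert ha, Finset.sum_insert ha]
    exact (H a (Finset.mem_insert_self a s)).add
      (ih fun i hi => H i (Finset.mem_insert_of_mem hi))

/-- One power of r is paid for by δ in the exponent at cost δ^{-1/2}, since √δ r ≤ 1 + δ r² ≤ exp(δ
r²). Two powers then cost δ^{-1}, the rate on which the factorial estimate rests. -/
theorem norm_mul_exp_le {δ : ℝ} (hδ : 0 < δ) (θ r : ℝ) :
    r * Real.exp (θ * r ^ 2) ≤ (√δ)⁻¹ * Real.exp ((θ + δ) * r ^ 2) := by
  have h1 : √δ * r ≤ Real.exp (δ * r ^ 2) := by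
    have h2 : (√δ * r) ^ 2 = δ * r ^ 2 := by rw [mul_pow, Real.sq_sqrt hδ.le]
    rw [← h2]
    have := Real.add_one_le_exp ((√δ * r) ^ 2)
    nlinarith [sq_nonneg (√δ * r - 1)]
  have hs : 0 < √δ := Real.sqrt_pos.2 hδ
  rw [add_mul, Real.exp_add, ← mul_assoc, mul_comm (_ * _) (Real.exp (δ * r ^ 2)),
    ← mul_assoc, mul_comm _ (√δ)⁻¹]
  refine mul_le_mul_of_nonneg_right ?_ (Real.exp_pos _).le
  rw [← div_eq_inv_mul, le_div_iff₀ hs]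
  linarith

theorem position (H : GaussBound θ K h) {δ : ℝ} (hδ : 0 < δ) (j : Fin n) :
    GaussBound (θ + δ) (K / √δ) (position j h) := by
  have h0 := H.nonneg
  obtain ⟨Q, h1, h2, h3⟩ := H
  refine ⟨fun z => z j * Q z, (contDiff_apply _ _ j).mul h1, fun x => ?_, fun z => ?_⟩
  · rw [position_apply, h2]
    change _ = coherent 0 x * (((x j : ℝ) : ℂ) * Q (cplx x))
    ring
  · rw [norm_mul]
    calc ‖z j‖ * ‖Q z‖ ≤ ‖z‖ * (K * Real.exp (θ * ‖z‖ ^ 2)) := by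
          gcongr
          · exact norm_le_pi_norm z j
          · exact h3 z
      _ = K * (‖z‖ * Real.exp (θ * ‖z‖ ^ 2)) := by ring
      _ ≤ K * ((√δ)⁻¹ * Real.exp ((θ + δ) * ‖z‖ ^ 2)) := by
          exact mul_le_mul_of_nonneg_left (norm_mul_exp_le hδ θ _) h0
      _ = _ := by rw [div_eq_mul_inv]; ring

/-- Cauchy's estimate on a circle of radius √δ in the j-th coordinate, so that a derivative costs
the same δ^{-1/2} as a multiplication. Since 2θ√δ‖z‖ ≤ θ² + δ‖z‖² and θ + δ ≤ 1/4, the shifted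
argument adds at most δ‖z‖² + 1/2 to the exponent, and exp(1/2) ≤ 2. -/
theorem norm_fderiv_le {Q : (Fin n → ℂ) → ℂ} (hQ : Differentiable ℂ Q)
    (hb : ∀ z, ‖Q z‖ ≤ K * Real.exp (θ * ‖z‖ ^ 2)) (hK : 0 ≤ K) (hθ : 0 ≤ θ) {δ : ℝ}
    (hδ : 0 < δ) (hθδ : θ + δ ≤ 1 / 4) (j : Fin n) (z : Fin n → ℂ) :
    ‖fderiv ℂ Q z (Pi.single j 1)‖ ≤ 2 * K / √δ * Real.exp ((θ + δ) * ‖z‖ ^ 2) := by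
  have hs : 0 < √δ := Real.sqrt_pos.2 hδ
  set f : ℂ → ℂ := fun ζ => Q (z + ζ • Pi.single j 1) with hf
  have hline : ∀ ζ : ℂ, HasDerivAt (fun ζ : ℂ => z + ζ • (Pi.single j 1 : Fin n → ℂ))
      (Pi.single j 1) ζ := fun ζ => by
    simpa using ((hasDerivAt_id ζ).smul_const (Pi.single j 1 : Fin n → ℂ)).const_add z
  have hd : ∀ ζ, HasDerivAt f (fderiv ℂ Q (z + ζ • Pi.single j 1) (Pi.single j 1)) ζ := fun ζ =>
    (hQ _).hasFDerivAt.comp_hasDerivAt ζ (hline ζ)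
  have h := Complex.norm_deriv_le_of_forall_mem_sphere_norm_le (f := f) (c := 0) hs
    (C := 2 * K * Real.exp ((θ + δ) * ‖z‖ ^ 2))
    (Differentiable.diffContOnCl fun ζ => (hd ζ).differentiableAt) fun ζ hζ => ?_
  · rw [(hd 0).deriv] at h
    simp only [zero_smul, add_zero] at h
    refine h.trans (le_of_eq ?_)
    ring
  · have hζ' : ‖ζ‖ = √δ := by simpa using hζ
    have hn : ‖z + ζ • (Pi.single j 1 : Fin n → ℂ)‖ ≤ ‖z‖ + √δ := by
      refine (norm_add_le _ _).trans ?_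
      rw [norm_smul, hζ', Pi.norm_single, norm_one, mul_one]
    have hsq : √δ ^ 2 = δ := Real.sq_sqrt hδ.le
    calc ‖f ζ‖ ≤ K * Real.exp (θ * ‖z + ζ • (Pi.single j 1 : Fin n → ℂ)‖ ^ 2) := hb _
      _ ≤ K * Real.exp (θ * (‖z‖ + √δ) ^ 2) := by gcongr
      _ ≤ K * Real.exp (1 / 2 + (θ + δ) * ‖z‖ ^ 2) := by
          gcongr
          nlinarith [sq_nonneg (θ - √δ * ‖z‖), mul_pow (√δ) ‖z‖ 2]
      _ = K * Real.exp (1 / 2) * Real.exp ((θ + δ) * ‖z‖ ^ 2) := by rw [Real.exp_add]; ring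
      _ ≤ K * 2 * Real.exp ((θ + δ) * ‖z‖ ^ 2) := by
          gcongr
          have h1 : Real.exp (1 / 2) ^ 2 = Real.exp 1 := by rw [← Real.exp_nat_mul]; norm_num
          nlinarith [Real.exp_one_lt_d9, Real.exp_pos (1 / 2)]
      _ = _ := by ring

/-- On the entire factor Q the momentum acts as -i(∂_j - z_j), because h = φ_0 Q. The 3 is the 2 of
Cauchy's estimate plus 1 for the multiplication. -/
theorem momentum (H : GaussBound θ K h) (hθ : 0 ≤ θ) {δ : ℝ} (hδ : 0 < δ) (hθδ : θ + δ ≤ 1 / 4)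
    (j : Fin n) : GaussBound (θ + δ) (3 * K / √δ) (momentum j h) := by
  have h0 := H.nonneg
  obtain ⟨R, h1', h2', h3'⟩ := H.position hδ j
  obtain ⟨Q, h1, h2, h3⟩ := H
  have hQd : Differentiable ℂ Q := h1.differentiable (by simp)
  refine ⟨fun z => -Complex.I * (fderiv ℂ Q z (Pi.single j 1) - z j * Q z), ?_, fun x => ?_,
    fun z => ?_⟩
  · exact contDiff_const.mul ((((h1.fderiv_right (m := ((⊤ : ℕ∞) : WithTop ℕ∞)) (by simp))).clm_apply
      contDiff_const).sub ((contDiff_apply _ _ j).mul h1))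
  · have hc : HasFDerivAt (cplx : E n → Fin n → ℂ) (ContinuousLinearMap.pi fun k =>
        (Complex.ofRealCLM ∘L (EuclideanSpace.proj k : E n →L[ℝ] ℝ))) x :=
      (ContinuousLinearMap.pi fun k =>
        (Complex.ofRealCLM ∘L (EuclideanSpace.proj k : E n →L[ℝ] ℝ))).hasFDerivAt
    have hq := ((hQd (cplx x)).hasFDerivAt.restrictScalars ℝ).comp x hc
    have hm : HasFDerivAt (fun y => coherent 0 y * Q (cplx y)) _ x :=
      ((coherent (0 : Fin n → ℂ)).hasFDerivAt x).mul hq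
    have hfun : (h : E n → ℂ) = fun y => coherent 0 y * Q (cplx y) := funext h2
    have h4 := DFunLike.congr_fun (momentum_coherent (0 : Fin n → ℂ) j) x
    rw [momentum_apply_eq] at h4
    rw [momentum_apply_eq, hfun, hm.fderiv]
    have hp : (ContinuousLinearMap.pi fun k => (Complex.ofRealCLM ∘L
        (EuclideanSpace.proj k : E n →L[ℝ] ℝ))) (EuclideanSpace.single j (1 : ℝ)) =
        (Pi.single j 1 : Fin n → ℂ) := by
      ext k
      have : (EuclideanSpace.proj k : E n →L[ℝ] ℝ) (EuclideanSpace.single j (1 : ℝ)) =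
        (EuclideanSpace.single j (1 : ℝ) : E n) k := rfl
      simp only [ContinuousLinearMap.pi_apply, ContinuousLinearMap.comp_apply, this,
        Complex.ofRealCLM_apply]
      by_cases hk : k = j
      · subst hk; simp
      · simp [hk]
    simp only [_root_.add_apply, _root_.smul_apply, ContinuousLinearMap.comp_apply, hp,
      ContinuousLinearMap.coe_restrictScalars', smul_eq_mul, _root_.sub_apply, position_apply_eq,
      Pi.zero_apply, mul_zero, zero_mul, sub_zero] at h4 ⊢
    rw [cplx]
    linear_combination Q (cplx x) * h4
  · have hp : ‖z j * Q z‖ ≤ K / √δ * Real.exp ((θ + δ) * ‖z‖ ^ 2) := by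
      rw [norm_mul]
      calc ‖z j‖ * ‖Q z‖ ≤ ‖z‖ * (K * Real.exp (θ * ‖z‖ ^ 2)) := by
            gcongr
            · exact norm_le_pi_norm z j
            · exact h3 z
        _ = K * (‖z‖ * Real.exp (θ * ‖z‖ ^ 2)) := by ring
        _ ≤ K * ((√δ)⁻¹ * Real.exp ((θ + δ) * ‖z‖ ^ 2)) := by
            exact mul_le_mul_of_nonneg_left (norm_mul_exp_le hδ θ _) h0
        _ = _ := by rw [div_eq_mul_inv]; ring
    rw [norm_mul, norm_neg, Complex.norm_I, one_mul]
    refine (norm_sub_le _ _).trans ?_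
    have := norm_fderiv_le hQd h3 h0 hθ hδ hθδ j z
    refine (add_le_add this hp).trans (le_of_eq ?_)
    ring

theorem coordinate (H : GaussBound θ K h) (hθ : 0 ≤ θ) {δ : ℝ} (hδ : 0 < δ)
    (hθδ : θ + δ ≤ 1 / 4) (a : Fin n ⊕ Fin n) :
    GaussBound (θ + δ) (3 * K / √δ) (coordinate a h) := by
  rcases a with j | j
  · refine (H.position hδ j).mono le_rfl ?_
    have := H.nonneg
    gcongr
    linarith
  · exact H.momentum hθ hδ hθδ j

/-- Each of the two coordinate factors gets δ/2, so a product costs 3 · 3/(δ/2) = 18/δ; two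
orderings and two factors 1/2 turn 18 into 9. -/
theorem weylQuantization (H : GaussBound θ K h) (hθ : 0 ≤ θ) {δ : ℝ} (hδ : 0 < δ)
    (hθδ : θ + δ ≤ 1 / 4) (M : Matrix (Fin n ⊕ Fin n) (Fin n ⊕ Fin n) ℝ) :
    GaussBound (θ + δ) ((9 * ∑ a, ∑ b, |M a b|) / δ * K)
      (weylQuantization M h) := by
  have hδ2 : 0 < δ / 2 := by positivity
  have hs : √(δ / 2) * √(δ / 2) = δ / 2 := Real.mul_self_sqrt hδ2.le
  have hs0 : 0 < √(δ / 2) := Real.sqrt_pos.2 hδ2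
  have h2 : ∀ a b, GaussBound (θ + δ) (18 * K / δ)
      (Metaplectic.coordinate a (Metaplectic.coordinate b h)) := by
    intro a b
    have := (H.coordinate hθ hδ2 (by linarith) b).coordinate (by linarith) hδ2 (by linarith) a
    refine this.mono (by linarith) (le_of_eq ?_)
    have : 3 * (3 * K / √(δ / 2)) / √(δ / 2) = 9 * K / (√(δ / 2) * √(δ / 2)) := by
      field_simp; ring
    rw [this, hs]
    field_simp
    ring
  rw [weylQuantization_apply]
  have := ((GaussBound.sum Finset.univ fun a _ => GaussBound.sum Finset.univ fun b _ =>
    (((h2 a b).add (h2 b a)).const_smul (1 / 2)).const_smul ((M a b : ℝ) : ℂ)).const_smul (1 / 2))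
  refine this.mono le_rfl (le_of_eq ?_)
  simp only [Complex.norm_real, Real.norm_eq_abs, ← Finset.sum_mul]
  norm_num
  field_simp
  ring

/-- The decay exponent 1/2 of φ_0 beats the growth exponent θ and leaves at least the exponent 1/4
of `gaussian`. -/
theorem norm_toL2_le (H : GaussBound θ K h) (hθ : θ ≤ 1 / 4) :
    ‖toL2 h‖ ≤ K * ‖toL2 (gaussian n)‖ := by
  have h0 := H.nonneg
  obtain ⟨Q, h1, h2, h3⟩ := H
  refine Lp.norm_le_mul_norm_of_ae_le_mul ?_
  filter_upwards [h.coeFn_toLp 2 volume, (gaussian n).coeFn_toLp 2 volume] with x hx hx'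
  rw [toL2_apply, toL2_apply, hx, hx', norm_gaussian_apply, h2, norm_mul, coherent_apply,
    Complex.norm_exp]
  have he := cohExp_re_le le_rfl (z := (0 : Fin n → ℂ)) (by simp) x
  have hc := norm_cplx_le x
  calc _ ≤ Real.exp (-(1 / 2) * ‖x‖ ^ 2) * (K * Real.exp ((1 / 4) * ‖x‖ ^ 2)) := by
        gcongr
        · linarith
        · refine (h3 _).trans ?_
          gcongr
    _ = K * Real.exp (-(1 / 2) * ‖x‖ ^ 2 + (1 / 4) * ‖x‖ ^ 2) := by rw [Real.exp_add]; ring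
    _ ≤ _ := by
        gcongr
        linarith

end GaussBound

/-! ### Analytic vectors and uniqueness of weak solutions -/

/-- Schwartz functions that are analytic vectors for all quadratic Hamiltonians. -/
def IsAnalyticVector (h : 𝓢(E n, ℂ)) : Prop := ∃ θ K : ℝ, 0 ≤ θ ∧ θ < 1 / 8 ∧ GaussBound θ K h

/-- The quotient φ_z/φ_0 is the exponential of an affine function, so any positive θ is possible;
1/16 is a choice below 1/8. -/
theorem isAnalyticVector_coherent (z : Fin n → ℂ) : IsAnalyticVector (coherent z) := by
  have hs : 0 ≤ √2 := Real.sqrt_nonneg 2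
  refine ⟨1 / 16, Real.exp (4 * (n * √2 * ‖z‖) ^ 2 + n * ‖z‖ ^ 2 / 2), by norm_num, by norm_num,
    fun w => Complex.exp (∑ j, (((√2 : ℝ) : ℂ) * z j * w j - z j ^ 2 / 2)), ?_, fun x => ?_,
    fun w => ?_⟩
  · refine Complex.contDiff_exp.comp (ContDiff.sum fun j _ => ?_)
    exact (contDiff_const.mul (contDiff_apply _ _ j)).sub contDiff_const
  · rw [coherent_apply, coherent_apply, ← Complex.exp_add]
    congr 1
    simp only [cohExp, ← Finset.sum_add_distrib, cplx, Pi.zero_apply]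
    refine Finset.sum_congr rfl fun j _ => ?_
    ring
  · rw [Complex.norm_exp, ← Real.exp_add]
    refine Real.exp_le_exp.2 ((Complex.re_le_norm _).trans ?_)
    have hj : ∀ j ∈ Finset.univ, ‖((√2 : ℝ) : ℂ) * z j * w j - z j ^ 2 / 2‖ ≤
        √2 * ‖z‖ * ‖w‖ + ‖z‖ ^ 2 / 2 := by
      intro j _
      have h1 : ‖z j‖ ≤ ‖z‖ := norm_le_pi_norm z j
      have h2 : ‖w j‖ ≤ ‖w‖ := norm_le_pi_norm w j
      refine (norm_sub_le _ _).trans ?_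
      rw [norm_mul, norm_mul, norm_div, norm_pow, Complex.norm_real, Real.norm_of_nonneg hs]
      simp only [Complex.norm_ofNat]
      gcongr
    refine (norm_sum_le_of_le _ hj).trans ?_
    rw [Finset.sum_const, Finset.card_univ, Fintype.card_fin, nsmul_eq_mul]
    nlinarith [sq_nonneg (‖w‖ / 4 - 2 * (n * √2 * ‖z‖))]

/-- The strict inequality θ < 1/8 makes the class invariant: half of the remaining gap pays for one
application. -/
theorem IsAnalyticVector.weylQuantization {h : 𝓢(E n, ℂ)} (H : IsAnalyticVector h)
    (M : Matrix (Fin n ⊕ Fin n) (Fin n ⊕ Fin n) ℝ) (c : ℂ) :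
    IsAnalyticVector (c • weylQuantization M h) := by
  obtain ⟨θ, K, h0, h1, H⟩ := H
  have hδ : 0 < (1 / 8 - θ) / 2 := by linarith
  exact ⟨θ + (1 / 8 - θ) / 2, _, by linarith, by linarith,
    (H.weylQuantization h0 hδ (by linarith) M).const_smul c⟩

/-- The graph norm of the position and momentum operators. -/
def graphNorm (h : 𝓢(E n, ℂ)) : ℝ := ‖toL2 h‖ + ∑ a, ‖toL2 (coordinate a h)‖

theorem GaussBound.graphNorm_le {θ K : ℝ} {h : 𝓢(E n, ℂ)} (H : GaussBound θ K h) (hθ : 0 ≤ θ)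
    (hθ' : θ ≤ 3 / 16) : graphNorm h ≤ K * ((1 + 2 * n * 12) * ‖toL2 (gaussian n)‖) := by
  have h1 := H.norm_toL2_le (by linarith)
  -- One coordinate operator may use 1/16, the gap from 3/16 to the limit 1/4; its cost is 3/√(1/16)
  -- = 12.
  have hs : √(1 / 16 : ℝ) = 1 / 4 := by
    rw [Real.sqrt_eq_iff_mul_self_eq (by norm_num) (by norm_num)]; norm_num
  have h2 : ∀ a ∈ Finset.univ, ‖toL2 (Metaplectic.coordinate a h)‖ ≤
      12 * K * ‖toL2 (gaussian n)‖ := by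
    intro a _
    refine ((H.coordinate hθ (δ := 1 / 16) (by norm_num) (by linarith) a).norm_toL2_le
      (by linarith)).trans (le_of_eq ?_)
    rw [hs]
    ring
  have h3 := Finset.sum_le_sum h2
  rw [Finset.sum_const, Finset.card_univ, Fintype.card_sum, Fintype.card_fin, nsmul_eq_mul] at h3
  rw [graphNorm]
  refine (add_le_add h1 h3).trans (le_of_eq ?_)
  push_cast
  ring

/-- The factorial estimate for iterates of a quadratic Hamiltonian on an analytic vector. -/
theorem exists_graphNorm_iterate_le (M : Matrix (Fin n ⊕ Fin n) (Fin n ⊕ Fin n) ℝ) :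
    ∃ C : ℝ, 0 ≤ C ∧ ∀ h : 𝓢(E n, ℂ), IsAnalyticVector h → ∃ B : ℝ, ∀ k : ℕ,
      graphNorm ((fun g => Complex.I • weylQuantization M g)^[k] h) ≤
        B * C ^ k * k.factorial := by
  set C₀ : ℝ := 9 * ∑ a, ∑ b, |M a b| with hC₀
  have hC₀0 : 0 ≤ C₀ := by
    rw [hC₀]
    exact mul_nonneg (by norm_num) (Finset.sum_nonneg fun a _ => Finset.sum_nonneg fun b _ =>
      abs_nonneg _)
  refine ⟨16 * C₀ * Real.exp 1, by positivity, fun h ⟨θ, K, h0, h1, H⟩ =>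
    ⟨K * ((1 + 2 * n * 12) * ‖toL2 (gaussian n)‖), fun k => ?_⟩⟩
  have hK := H.nonneg
  have key : GaussBound (3 / 16) (K * (16 * k * C₀) ^ k)
      ((fun g => Complex.I • weylQuantization M g)^[k] h) := by
    rcases Nat.eq_zero_or_pos k with rfl | hk
    · simpa using H.mono (by linarith) le_rfl
    have hk' : (0 : ℝ) < k := by exact_mod_cast hk
    -- The room between 1/8 and 3/16 is divided into k equal shares, one for each application; each
    -- costs a factor 16 k C₀.
    have step : ∀ i : ℕ, i ≤ k → GaussBound (1 / 8 + i * (1 / (16 * k)))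
        (K * (16 * k * C₀) ^ i) ((fun g => Complex.I • weylQuantization M g)^[i] h) := by
      intro i
      induction i with
      | zero => intro _; simpa using H.mono h1.le le_rfl
      | succ i ih =>
        intro hi
        have hik : ((i : ℝ) + 1) ≤ k := by exact_mod_cast hi
        have hle : ((i : ℝ) + 1) * (1 / (16 * k)) ≤ 1 / 16 := by
          rw [mul_one_div, div_le_div_iff₀ (by positivity) (by norm_num)]
          linarith
        have := ((ih (by omega)).weylQuantization (by positivity) (δ := 1 / (16 * k))
          (by positivity) (by linarith) M).const_smul Complex.I
        rw [Function.iterate_succ_apply']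
        refine this.mono (by push_cast; linarith) (le_of_eq ?_)
        rw [Complex.norm_I, one_mul, ← hC₀, pow_succ]
        field_simp
    refine (step k le_rfl).mono ?_ le_rfl
    have : (k : ℝ) * (1 / (16 * k)) = 1 / 16 := by field_simp
    linarith
  refine (key.graphNorm_le (by norm_num) le_rfl).trans ?_
  -- The resulting k^k is of factorial size because k^k/k! is one term of the series of e^k.
  have hkk : (k : ℝ) ^ k ≤ Real.exp 1 ^ k * k.factorial := by
    have := Real.pow_div_factorial_le_exp (x := k) (by positivity) k
    rw [div_le_iff₀ (by positivity)] at this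
    rwa [← Real.exp_nat_mul, mul_one]
  calc K * (16 * k * C₀) ^ k * ((1 + 2 * n * 12) * ‖toL2 (gaussian n)‖)
      = K * ((1 + 2 * n * 12) * ‖toL2 (gaussian n)‖) * (16 * C₀) ^ k * (k : ℝ) ^ k := by
        rw [mul_right_comm 16, mul_pow]; ring
    _ ≤ K * ((1 + 2 * n * 12) * ‖toL2 (gaussian n)‖) * (16 * C₀) ^ k *
        (Real.exp 1 ^ k * k.factorial) := by gcongr
    _ = _ := by rw [mul_pow (16 * C₀)]; ring

/-- A sequence of functions, each the derivative of the preceding one, that vanish at `0` and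
satisfy analytic bounds, vanishes near `0`. -/
theorem eq_zero_of_hasDerivAt_succ {D : ℕ → ℝ → ℂ}
    (hD : ∀ k t, HasDerivAt (D k) (D (k + 1) t) t) (h0 : ∀ k, D k 0 = 0) {B C : ℝ} (hC : 0 ≤ C)
    (hb : ∀ k, ∀ t ∈ Set.Icc (0 : ℝ) 1, ‖D k t‖ ≤ B * C ^ k * k.factorial) {t : ℝ}
    (ht : t ∈ Set.Icc (0 : ℝ) 1) (hCt : C * t < 1) : D 0 t = 0 := by
  -- Integrating m times from 0 gains t^m/m!, against the growth C^(k+m) (k+m)! of the derivatives.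
  -- For k = 0 the factorials cancel and B (Ct)^m remains.
  have key : ∀ m k : ℕ, ∀ t ∈ Set.Icc (0 : ℝ) 1,
      ‖D k t‖ ≤ B * C ^ (k + m) * (k + m).factorial * (t ^ m / m.factorial) := by
    intro m
    induction m with
    | zero => intro k t ht; simpa using hb k t ht
    | succ m ih =>
      intro k
      refine image_norm_le_of_norm_deriv_right_le_deriv_boundary (f' := D (k + 1))
        (B' := fun t => B * C ^ (k + (m + 1)) * (k + (m + 1)).factorial * (t ^ m / m.factorial))
        (fun s _ => (hD k s).continuousAt.continuousWithinAt)
        (fun s _ => (hD k s).hasDerivWithinAt) (by simp [h0]) (fun s => ?_) fun s hs => ?_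
      · have h1 := ((hasDerivAt_pow (m + 1) s).div_const ((m + 1).factorial : ℝ)).const_mul
          (B * C ^ (k + (m + 1)) * (k + (m + 1)).factorial)
        refine h1.congr_deriv ?_
        rw [Nat.factorial_succ m]
        push_cast
        have : (m : ℝ) + 1 ≠ 0 := by positivity
        have : (m.factorial : ℝ) ≠ 0 := by positivity
        field_simp
      · have h2 := ih (k + 1) s ⟨hs.1, hs.2.le⟩
        rwa [show k + 1 + m = k + (m + 1) by ring] at h2
  have hlim : Filter.Tendsto (fun m : ℕ => B * (C * t) ^ m) Filter.atTop (𝓝 0) := by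
    simpa using (tendsto_pow_atTop_nhds_zero_of_lt_one (mul_nonneg hC ht.1) hCt).const_mul B
  have hle : ‖D 0 t‖ ≤ 0 := by
    refine ge_of_tendsto' hlim fun m => ?_
    refine (key m 0 t ht).trans (le_of_eq ?_)
    have : (m.factorial : ℝ) ≠ 0 := by positivity
    rw [zero_add, mul_pow]
    field_simp
  exact norm_le_zero_iff.1 hle

/-- Uniqueness of weak solutions of the Schrödinger equation of a quadratic Hamiltonian, for
small times, in a form adapted to several applications. -/
theorem exists_weak_uniqueness (M : Matrix (Fin n ⊕ Fin n) (Fin n ⊕ Fin n) ℝ) :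
    ∃ δ : ℝ, 0 < δ ∧ ∀ (D : 𝓢(E n, ℂ) → ℝ → ℂ) (B : ℝ),
      (∀ h t, HasDerivAt (D h) (D (Complex.I • weylQuantization M h) t) t) →
      (∀ h, IsAnalyticVector h → D h 0 = 0) →
      (∀ h, ∀ t ∈ Set.Icc (0 : ℝ) 1, ‖D h t‖ ≤ B * graphNorm h) →
      ∀ h, IsAnalyticVector h → ∀ t, 0 ≤ t → t ≤ δ → D h t = 0 := by
  obtain ⟨C, hC, hCb⟩ := exists_graphNorm_iterate_le M
  -- This time span depends on M alone, not on the vector; hence the group law can later extend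
  -- short-time results. The + 1 gives C t < 1 and keeps t within [0, 1].
  refine ⟨1 / (C + 1), by positivity, fun D B hD h0 hb h hh t ht0 htδ => ?_⟩
  obtain ⟨B', hB'⟩ := hCb h hh
  have han : ∀ k : ℕ, IsAnalyticVector ((fun g => Complex.I • weylQuantization M g)^[k] h) := by
    intro k
    induction k with
    | zero => simpa using hh
    | succ k ih =>
      rw [Function.iterate_succ_apply']
      exact ih.weylQuantization M _
  have hCt : (C + 1) * t ≤ 1 := by
    rw [le_div_iff₀ (by positivity)] at htδ
    linarith
  rcases ht0.eq_or_lt with rfl | ht0'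
  · exact h0 h hh
  refine eq_zero_of_hasDerivAt_succ
    (D := fun k => D ((fun g => Complex.I • weylQuantization M g)^[k] h)) (fun k s => ?_)
    (fun k => h0 _ (han k)) (B := |B| * B') hC (fun k s hs => ?_)
    ⟨ht0, by nlinarith⟩ (by nlinarith)
  · rw [Function.iterate_succ_apply']
    exact hD _ s
  · have hg : 0 ≤ graphNorm ((fun g => Complex.I • weylQuantization M g)^[k] h) := by
      unfold graphNorm; positivity
    calc _ ≤ B * graphNorm ((fun g => Complex.I • weylQuantization M g)^[k] h) := hb _ s hs
      _ ≤ |B| * graphNorm ((fun g => Complex.I • weylQuantization M g)^[k] h) := by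
          gcongr; exact le_abs_self B
      _ ≤ |B| * (B' * C ^ k * k.factorial) := by gcongr; exact hB' k
      _ = _ := by ring

/-! ### Unitary groups -/

theorem op_mul (V W : UnitaryOps n) (f : L2 n) : op (V * W) f = op V (op W f) := rfl

theorem op_one (f : L2 n) : op (1 : UnitaryOps n) f = f := rfl

theorem inner_op_op (V : UnitaryOps n) (f g : L2 n) :
    inner ℂ (op V f) (op V g) = inner ℂ f g := by
  rw [← ContinuousLinearMap.adjoint_inner_right]
  have h : (ContinuousLinearMap.adjoint (op V)) (op V g) = g := by
    have := Unitary.coe_star_mul_self V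
    rw [ContinuousLinearMap.star_eq_adjoint] at this
    exact DFunLike.congr_fun this g
  rw [h]

theorem norm_op (V : UnitaryOps n) (f : L2 n) : ‖op V f‖ = ‖f‖ := by
  rw [@norm_eq_sqrt_re_inner ℂ, inner_op_op, ← @norm_eq_sqrt_re_inner ℂ]

theorem op_inv_op (V : UnitaryOps n) (f : L2 n) : op V⁻¹ (op V f) = f := by
  rw [← op_mul, inv_mul_cancel, op_one]

theorem op_op_inv (V : UnitaryOps n) (f : L2 n) : op V (op V⁻¹ f) = f := by
  rw [← op_mul, mul_inv_cancel, op_one]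

theorem inner_op_right (V : UnitaryOps n) (f g : L2 n) :
    inner ℂ f (op V g) = inner ℂ (op V⁻¹ f) g := by
  rw [← inner_op_op V (op V⁻¹ f), op_op_inv]

theorem unitaryOps_ext {V W : UnitaryOps n} (h : ∀ f, op V f = op W f) : V = W :=
  Subtype.ext (ContinuousLinearMap.ext h)

/-- Two unitary operators that agree on coherent states are equal. -/
theorem eq_of_inner_coherent {f g : L2 n}
    (h : ∀ z, inner ℂ (toL2 (coherent z)) f = inner ℂ (toL2 (coherent z)) g) : f = g :=
  sub_eq_zero.1 (eq_zero_of_inner_coherent fun z => by rw [inner_sub_right, h, sub_self])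

/-- `U` is a strongly continuous unitary group whose generator extends `-iT`. -/
structure IsUnitaryGroup (T : 𝓢(E n, ℂ) →L[ℂ] 𝓢(E n, ℂ)) (U : ℝ → UnitaryOps n) : Prop where
  add : ∀ s t : ℝ, U (s + t) = U s * U t
  cont : ∀ f : L2 n, Continuous fun t : ℝ => op (U t) f
  deriv : ∀ f : 𝓢(E n, ℂ), HasDerivAt (fun t : ℝ => op (U t) (toL2 f))
    ((-Complex.I) • toL2 (T f)) 0

theorem isExpNegI_iff {T : 𝓢(E n, ℂ) →L[ℂ] 𝓢(E n, ℂ)} {V : UnitaryOps n} :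
    IsExpNegI T V ↔ ∃ U, IsUnitaryGroup T U ∧ U 1 = V :=
  ⟨fun ⟨U, h1, h2, h3, h4⟩ => ⟨U, ⟨h1, h2, h3⟩, h4⟩,
    fun ⟨U, h, h4⟩ => ⟨U, h.add, h.cont, h.deriv, h4⟩⟩

namespace IsUnitaryGroup

variable {T : 𝓢(E n, ℂ) →L[ℂ] 𝓢(E n, ℂ)} {U : ℝ → UnitaryOps n}

theorem map_zero (hU : IsUnitaryGroup T U) : U 0 = 1 := by
  have := hU.add 0 0
  rw [add_zero] at this
  exact (left_eq_mul.1 this)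

theorem map_neg (hU : IsUnitaryGroup T U) (t : ℝ) : U (-t) = (U t)⁻¹ := by
  rw [eq_inv_iff_mul_eq_one, ← hU.add, neg_add_cancel, hU.map_zero]

theorem map_nat_mul (hU : IsUnitaryGroup T U) (k : ℕ) (t : ℝ) : U (k * t) = U t ^ k := by
  induction k with
  | zero => simp [hU.map_zero]
  | succ k ih => rw [pow_succ, ← ih, ← hU.add]; congr 1; push_cast; ring

theorem map_one (hU : IsUnitaryGroup T U) {k : ℕ} (hk : k ≠ 0) : U (1 / k) ^ k = U 1 := by
  rw [← hU.map_nat_mul]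
  congr 1
  have : (k : ℝ) ≠ 0 := by exact_mod_cast hk
  field_simp

theorem neg (hU : IsUnitaryGroup T U) : IsUnitaryGroup (-T) fun t => U (-t) where
  add s t := by rw [neg_add, hU.add]
  cont f := (hU.cont f).comp continuous_neg
  deriv f := by
    have h := hU.deriv f
    rw [← neg_zero] at h
    have := h.scomp (0 : ℝ) (hasDerivAt_neg 0)
    refine this.congr_deriv ?_
    rw [_root_.neg_apply, _root_.map_neg, smul_neg, neg_smul, one_smul]

theorem hasDerivAt (hU : IsUnitaryGroup T U) (f : 𝓢(E n, ℂ)) (t : ℝ) :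
    HasDerivAt (fun t => op (U t) (toL2 f)) (op (U t) ((-Complex.I) • toL2 (T f))) t := by
  have h := hU.deriv f
  rw [← sub_self t] at h
  have h1 := h.comp_sub_const t t
  have h2 := ((op (U t)).restrictScalars ℝ).hasFDerivAt.comp_hasDerivAt t h1
  refine h2.congr_of_eventuallyEq (Filter.Eventually.of_forall fun s => ?_)
  change op (U s) (toL2 f) = op (U t) (op (U (s - t)) (toL2 f))
  rw [← op_mul, ← hU.add, add_sub_cancel]

/-- Moving U(t) to the left as U(-t) puts the derivative on the Schwartz vector h, so f may be
arbitrary in L². This is the weak equation to which the uniqueness theorem applies. -/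
theorem hasDerivAt_inner (hU : IsUnitaryGroup T U) (h : 𝓢(E n, ℂ)) (f : L2 n) (t : ℝ) :
    HasDerivAt (fun t => inner ℂ (toL2 h) (op (U t) f))
      (inner ℂ (toL2 (Complex.I • T h)) (op (U t) f)) t := by
  have h1 := (hU.hasDerivAt h (-t)).scomp t (hasDerivAt_neg t)
  have h2 := h1.inner ℂ (hasDerivAt_const t f)
  have e : ∀ s (g : L2 n), inner ℂ g (op (U s) f) = inner ℂ (op (U (-s)) g) f := by
    intro s g
    rw [inner_op_right, hU.map_neg]
  refine (h2.congr_deriv ?_).congr_of_eventuallyEq (Filter.Eventually.of_forall fun s => ?_)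
  · rw [inner_zero_right, zero_add, e, _root_.map_smul toL2, neg_smul, one_smul, neg_smul,
      _root_.map_neg, neg_neg]
  · exact e s _

end IsUnitaryGroup

/-- Uniqueness of the exponential of a quadratic Hamiltonian. -/
theorem isExpNegI_unique {M : Matrix (Fin n ⊕ Fin n) (Fin n ⊕ Fin n) ℝ} {V V' : UnitaryOps n}
    (hV : IsExpNegI (weylQuantization M) V) (hV' : IsExpNegI (weylQuantization M) V') :
    V = V' := by
  obtain ⟨U, hU, rfl⟩ := isExpNegI_iff.1 hV
  obtain ⟨U', hU', rfl⟩ := isExpNegI_iff.1 hV'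
  obtain ⟨δ, hδ, hu⟩ := exists_weak_uniqueness M
  have key : ∀ t, 0 ≤ t → t ≤ δ → U t = U' t := by
    intro t ht0 htδ
    refine unitaryOps_ext fun f => eq_of_inner_coherent fun z => sub_eq_zero.1 ?_
    refine hu (fun h t => inner ℂ (toL2 h) (op (U t) f) - inner ℂ (toL2 h) (op (U' t) f))
      (2 * ‖f‖) (fun h t => (hU.hasDerivAt_inner h f t).sub (hU'.hasDerivAt_inner h f t))
      (fun h _ => ?_) (fun h t _ => ?_) _ (isAnalyticVector_coherent z) t ht0 htδ
    · rw [hU.map_zero, hU'.map_zero, sub_self]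
    · have h1 : ‖toL2 h‖ ≤ graphNorm h := by
        unfold graphNorm
        have : 0 ≤ ∑ a, ‖toL2 (coordinate a h)‖ := by positivity
        linarith
      refine (norm_sub_le _ _).trans ?_
      have h2 := norm_inner_le_norm (𝕜 := ℂ) (toL2 h) (op (U t) f)
      have h3 := norm_inner_le_norm (𝕜 := ℂ) (toL2 h) (op (U' t) f)
      rw [norm_op] at h2 h3
      nlinarith [norm_nonneg f]
  -- Time one is reached as a power of a short time step.
  obtain ⟨k, hk⟩ := exists_nat_one_div_lt hδ
  have hk' := key (1 / ((k + 1 : ℕ) : ℝ)) (by positivity) (by push_cast; exact hk.le)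
  rw [← hU.map_one (Nat.succ_ne_zero k), ← hU'.map_one (Nat.succ_ne_zero k), hk']

/-! ### Exponentials of matrices -/

section Exp

variable {m 𝕂 : Type*} [Fintype m] [DecidableEq m] [RCLike 𝕂]

theorem hasDerivAt_matrix_exp (X : Matrix m m 𝕂) (t : ℝ) (i j : m) :
    HasDerivAt (fun t : ℝ => (NormedSpace.exp (t • X) : Matrix m m 𝕂) i j)
      ((X * NormedSpace.exp (t • X) : Matrix m m 𝕂) i j) t := by
  let _ : NormedRing (Matrix m m 𝕂) := Matrix.linftyOpNormedRing
  let _ : NormedAlgebra 𝕂 (Matrix m m 𝕂) := Matrix.linftyOpNormedAlgebra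
  let _ : NormedAlgebra ℝ (Matrix m m 𝕂) := Matrix.linftyOpNormedAlgebra
  have h := hasDerivAt_exp_smul_const' (𝕂 := ℝ) X t
  have h2 := hasDerivAt_pi.1 (hasDerivAt_pi.1 h i) j
  exact h2

theorem matrix_exp_add_smul (X : Matrix m m 𝕂) (s t : ℝ) :
    (NormedSpace.exp ((s + t) • X) : Matrix m m 𝕂) =
      NormedSpace.exp (s • X) * NormedSpace.exp (t • X) := by
  rw [add_smul]
  exact Matrix.exp_add_of_commute _ _ (((Commute.refl X).smul_left s).smul_right t)

end Exp

/-! ### The projection to the symplectic group -/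

/-- The quantization of the linear function with coefficient vector `ξ`. -/
def linQuant (ξ : Fin n ⊕ Fin n → ℝ) : 𝓢(E n, ℂ) →L[ℂ] 𝓢(E n, ℂ) :=
  ∑ a, ((ξ a : ℝ) : ℂ) • coordinate a

theorem linQuant_apply (ξ : Fin n ⊕ Fin n → ℝ) (h : 𝓢(E n, ℂ)) :
    linQuant ξ h = ∑ a, ((ξ a : ℝ) : ℂ) • coordinate a h := by
  simp [linQuant]

theorem linQuant_sub (ξ η : Fin n ⊕ Fin n → ℝ) :
    linQuant (ξ - η) = linQuant ξ - linQuant η := by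
  simp only [linQuant, Pi.sub_apply, Complex.ofReal_sub, sub_smul, Finset.sum_sub_distrib]

theorem inner_linQuant_left (ξ : Fin n ⊕ Fin n → ℝ) (h : 𝓢(E n, ℂ)) (f : L2 n) :
    inner ℂ (toL2 (linQuant ξ h)) f =
      ∑ a, ((ξ a : ℝ) : ℂ) * inner ℂ (toL2 (coordinate a h)) f := by
  rw [linQuant_apply, map_sum, sum_inner]
  refine Finset.sum_congr rfl fun a _ => ?_
  rw [map_smul, inner_smul_left, Complex.conj_ofReal]

theorem inner_linQuant (ξ : Fin n ⊕ Fin n → ℝ) (h f : 𝓢(E n, ℂ)) :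
    inner ℂ (toL2 (linQuant ξ h)) (toL2 f) = inner ℂ (toL2 h) (toL2 (linQuant ξ f)) := by
  rw [inner_linQuant_left, linQuant_apply, map_sum, inner_sum]
  refine Finset.sum_congr rfl fun a _ => ?_
  rw [map_smul, inner_smul_right, inner_coordinate]

/-- `(f, g)` is in the graph of the closed operator defined by `linQuant ξ`. -/
def InGraph (ξ : Fin n ⊕ Fin n → ℝ) (f g : L2 n) : Prop :=
  ∀ h, IsAnalyticVector h → inner ℂ (toL2 (linQuant ξ h)) f = inner ℂ (toL2 h) g

theorem inGraph_toL2 (ξ : Fin n ⊕ Fin n → ℝ) (f : 𝓢(E n, ℂ)) :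
    InGraph ξ (toL2 f) (toL2 (linQuant ξ f)) := fun h _ => inner_linQuant ξ h f

/-- The unitary operator `V` implements the linear map `S` of phase space. -/
def Implements (V : UnitaryOps n) (S : Matrix (Fin n ⊕ Fin n) (Fin n ⊕ Fin n) ℝ) : Prop :=
  -- This reads V Z_{Sᵀξ} ⊂ Z_ξ V; the transpose pulls the covector ξ back and lets products keep
  -- their order. Graphs are used so that V need not preserve the Schwartz space.
  ∀ ξ f g, InGraph (Sᵀ *ᵥ ξ) f g → InGraph ξ (op V f) (op V g)

theorem implements_one : Implements (1 : UnitaryOps n) 1 := by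
  intro ξ f g h
  simpa using h

theorem Implements.mul {V V' : UnitaryOps n} {S S' : Matrix (Fin n ⊕ Fin n) (Fin n ⊕ Fin n) ℝ}
    (h : Implements V S) (h' : Implements V' S') : Implements (V * V') (S * S') := by
  intro ξ f g hfg
  rw [Matrix.transpose_mul, ← Matrix.mulVec_mulVec] at hfg
  exact h _ _ _ (h' _ _ _ hfg)

theorem Implements.pow {V : UnitaryOps n} {S : Matrix (Fin n ⊕ Fin n) (Fin n ⊕ Fin n) ℝ}
    (h : Implements V S) (k : ℕ) : Implements (V ^ k) (S ^ k) := by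
  induction k with
  | zero => simpa using implements_one
  | succ k ih => rw [pow_succ, pow_succ]; exact ih.mul h

theorem Implements.inner_eq {V : UnitaryOps n} {S : Matrix (Fin n ⊕ Fin n) (Fin n ⊕ Fin n) ℝ}
    (hV : Implements V S) (ξ : Fin n ⊕ Fin n → ℝ) {h : 𝓢(E n, ℂ)} (hh : IsAnalyticVector h)
    (f : 𝓢(E n, ℂ)) :
    inner ℂ (toL2 (linQuant ξ h)) (op V (toL2 f)) =
      inner ℂ (toL2 h) (op V (toL2 (linQuant (Sᵀ *ᵥ ξ) f))) :=
  hV _ _ _ (inGraph_toL2 _ f) h hh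

theorem linQuant_coherent_zero (ξ : Fin n ⊕ Fin n → ℝ) :
    linQuant ξ (coherent 0) = ∑ j, (((ξ (Sum.inl j) : ℝ) : ℂ) +
      Complex.I * ((ξ (Sum.inr j) : ℝ) : ℂ)) • position j (coherent 0) := by
  rw [linQuant_apply, Fintype.sum_sum_type, ← Finset.sum_add_distrib]
  refine Finset.sum_congr rfl fun j _ => ?_
  simp only [coordinate, Sum.elim_inl, Sum.elim_inr, momentum_coherent, Pi.zero_apply, mul_zero,
    zero_smul, sub_zero, smul_smul, add_smul]
  rw [mul_comm Complex.I]

/-- On φ_0 momentum acts as i times position, so Z_ξ multiplies φ_0 by a complex linear form whose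
real and imaginary parts are the two halves of ξ; its values on the standard basis recover ξ. -/
theorem linQuant_coherent_zero_injective {ξ : Fin n ⊕ Fin n → ℝ}
    (h : linQuant ξ (coherent 0) = 0) : ξ = 0 := by
  have key : ∀ j, ((ξ (Sum.inl j) : ℝ) : ℂ) + Complex.I * ((ξ (Sum.inr j) : ℝ) : ℂ) = 0 := by
    intro j
    have h1 := DFunLike.congr_fun h (EuclideanSpace.single j (1 : ℝ))
    rw [linQuant_coherent_zero] at h1
    simp only [_root_.sum_apply, _root_.smul_apply, position_apply_eq, smul_eq_mul,
      _root_.zero_apply] at h1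
    rw [Finset.sum_eq_single j] at h1
    · simpa [coherent_zero_apply] using h1
    · intro k _ hk; simp [hk]
    · simp
  have key2 : ∀ j, ξ (Sum.inl j) = 0 ∧ ξ (Sum.inr j) = 0 := by
    intro j
    have h1 := congrArg Complex.re (key j)
    have h2 := congrArg Complex.im (key j)
    simp at h1 h2
    exact ⟨h1, h2⟩
  ext (j | j)
  · exact (key2 j).1
  · exact (key2 j).2

theorem toL2_injective : Function.Injective (toL2 : 𝓢(E n, ℂ) → L2 n) :=
  SchwartzMap.injective_toLp 2 volume

/-- V is injective and Z_ξ φ_0 determines ξ. This is what makes the projection well defined and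
multiplicative. -/
theorem Implements.unique {V : UnitaryOps n} {S S' : Matrix (Fin n ⊕ Fin n) (Fin n ⊕ Fin n) ℝ}
    (h : Implements V S) (h' : Implements V S') : S = S' := by
  have key : ∀ ξ, Sᵀ *ᵥ ξ = S'ᵀ *ᵥ ξ := by
    intro ξ
    have h1 : op V (toL2 (linQuant (Sᵀ *ᵥ ξ) (coherent 0))) =
        op V (toL2 (linQuant (S'ᵀ *ᵥ ξ) (coherent 0))) := eq_of_inner_coherent fun z => by
      rw [← h.inner_eq ξ (isAnalyticVector_coherent z), ← h'.inner_eq ξ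
        (isAnalyticVector_coherent z)]
    have h2 := congrArg (op V⁻¹) h1
    rw [op_inv_op, op_inv_op] at h2
    have h3 := toL2_injective h2
    refine sub_eq_zero.1 (linQuant_coherent_zero_injective ?_)
    rw [linQuant_sub, _root_.sub_apply, h3, sub_self]
  have h1 : Sᵀ = S'ᵀ := Matrix.mulVec_injective (funext key)
  simpa using congrArg Matrix.transpose h1

/-- Conjugation by the unitary group of a quadratic Hamiltonian is the Hamiltonian flow. -/
theorem IsUnitaryGroup.exists_implements {M : Matrix (Fin n ⊕ Fin n) (Fin n ⊕ Fin n) ℝ}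
    (hM : M.IsSymm) {U : ℝ → UnitaryOps n} (hU : IsUnitaryGroup (weylQuantization M) U) :
    ∃ δ : ℝ, 0 < δ ∧ ∀ t, 0 ≤ t → t ≤ δ → Implements (U t) (NormedSpace.exp (t • (symp n * M))) := by
  obtain ⟨δ, hδ, hu⟩ := exists_weak_uniqueness M
  refine ⟨δ, hδ, fun t ht0 htδ ξ₀ f g hfg h hh => ?_⟩
  set X := symp n * M with hX
  set η := (NormedSpace.exp (t • X) : Matrix _ _ ℝ)ᵀ *ᵥ ξ₀ with hη
  -- The covector moves so that its derivative cancels the commutator term of the Heisenberg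
  -- equation; it starts at η = Sᵀ ξ₀ and reaches ξ₀ at time t.
  let ξ : ℝ → Fin n ⊕ Fin n → ℝ := fun s => (NormedSpace.exp (s • (-X)) : Matrix _ _ ℝ)ᵀ *ᵥ η
  have hξt : ξ t = ξ₀ := by
    simp only [ξ, hη]
    rw [Matrix.mulVec_mulVec, ← Matrix.transpose_mul, smul_neg, ← neg_smul,
      ← matrix_exp_add_smul, add_neg_cancel, zero_smul, NormedSpace.exp_zero,
      Matrix.transpose_one, Matrix.one_mulVec]
  have hξ0 : ξ 0 = η := by
    simp only [ξ]
    rw [zero_smul, NormedSpace.exp_zero, Matrix.transpose_one, Matrix.one_mulVec]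
  have hξ' : ∀ s a, HasDerivAt (fun s => ξ s a) (-∑ b, X b a * ξ s b) s := by
    intro s a
    have h1 : HasDerivAt (fun s => ξ s a)
        (∑ b, (-X * NormedSpace.exp (s • (-X)) : Matrix _ _ ℝ) b a * η b) s := by
      simp only [ξ, Matrix.mulVec, dotProduct, Matrix.transpose_apply]
      exact HasDerivAt.fun_sum fun b _ => (hasDerivAt_matrix_exp (-X) s b a).mul_const _
    refine h1.congr_deriv ?_
    have hcomm : (-X * NormedSpace.exp (s • (-X)) : Matrix _ _ ℝ) =
        NormedSpace.exp (s • (-X)) * (-X) := by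
      exact (((Commute.refl (-X)).smul_right s).exp_right).eq
    have h2 : ∑ b, (-X * NormedSpace.exp (s • (-X)) : Matrix _ _ ℝ) b a * η b =
        ((-X)ᵀ *ᵥ ξ s) a := by
      simp only [ξ]
      rw [Matrix.mulVec_mulVec, ← Matrix.transpose_mul, ← hcomm]
      rfl
    rw [h2]
    simp [Matrix.mulVec, dotProduct]
  have hcont : ∀ a, Continuous fun s => ξ s a := fun a =>
    continuous_iff_continuousAt.2 fun s => (hξ' s a).continuousAt
  obtain ⟨B, hB⟩ : ∃ B : ℝ, ∀ s ∈ Set.Icc (0 : ℝ) 1, ∀ a, |ξ s a| ≤ B := by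
    have hc : Continuous fun s => ξ s := continuous_pi hcont
    obtain ⟨B, hB⟩ := isCompact_Icc.exists_bound_of_continuousOn (hc.continuousOn (s := Set.Icc 0 1))
    exact ⟨B, fun s hs a => (norm_le_pi_norm (ξ s) a).trans (hB s hs)⟩
  -- The quantity ⟨Z_{ξ(s)} h, U_s f⟩ - ⟨h, U_s g⟩ vanishes at s = 0 by hypothesis. It involves
  -- coordinates of h, whence the graph norm in the uniqueness theorem.
  have := hu (fun h s => ∑ a, ((ξ s a : ℝ) : ℂ) * inner ℂ (toL2 (coordinate a h)) (op (U s) f) -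
      inner ℂ (toL2 h) (op (U s) g)) (|B| * ‖f‖ + ‖g‖) (fun h s => ?_) (fun h hh => ?_)
      (fun h s hs => ?_) h hh t ht0 htδ
  · simp only [hξt] at this
    rw [inner_linQuant_left]
    exact sub_eq_zero.1 this
  · have h1 := (HasDerivAt.fun_sum (u := Finset.univ) fun a _ =>
      ((hξ' s a).ofReal_comp.mul (hU.hasDerivAt_inner (coordinate a h) f s))).sub
      (hU.hasDerivAt_inner h g s)
    refine h1.congr_deriv ?_
    congr 1
    simp only [weylQuantization_coordinate hM, map_add, inner_add_left, mul_add, map_sum,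
      sum_inner, map_smul, inner_smul_left, Complex.conj_ofReal, Finset.sum_add_distrib]
    have h3 : ∑ a, ((-∑ b, X b a * ξ s b : ℝ) : ℂ) *
        inner ℂ (toL2 (coordinate a h)) (op (U s) f) +
        ∑ a, ((ξ s a : ℝ) : ℂ) * ∑ b, ((X a b : ℝ) : ℂ) *
          inner ℂ (toL2 (coordinate b h)) (op (U s) f) = 0 := by
      rw [Finset.sum_congr rfl fun a _ => Finset.mul_sum _ _ _, Finset.sum_comm (γ := Fin n ⊕ Fin n),
        ← Finset.sum_add_distrib]
      refine Finset.sum_eq_zero fun a _ => ?_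
      push_cast
      rw [neg_mul, Finset.sum_mul, neg_add_eq_zero]
      exact Finset.sum_congr rfl fun b _ => by ring
    rw [add_left_comm, h3, add_zero]
  · simp only [hξ0, hU.map_zero, op_one]
    rw [← inner_linQuant_left, hfg h hh, sub_self]
  · refine (norm_sub_le _ _).trans ?_
    have h1 : ‖inner ℂ (toL2 h) (op (U s) g)‖ ≤ ‖toL2 h‖ * ‖g‖ := by
      have := norm_inner_le_norm (𝕜 := ℂ) (toL2 h) (op (U s) g)
      rwa [norm_op] at this
    have h2 : ∀ a ∈ Finset.univ, ‖((ξ s a : ℝ) : ℂ) *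
        inner ℂ (toL2 (coordinate a h)) (op (U s) f)‖ ≤
        |B| * ‖f‖ * ‖toL2 (coordinate a h)‖ := by
      intro a _
      have h3 := norm_inner_le_norm (𝕜 := ℂ) (toL2 (coordinate a h)) (op (U s) f)
      rw [norm_op] at h3
      rw [norm_mul, Complex.norm_real, Real.norm_eq_abs, mul_assoc, mul_comm ‖f‖]
      have := (hB s hs a).trans (le_abs_self B)
      gcongr
    have h4 := norm_sum_le_of_le _ h2
    rw [← Finset.mul_sum] at h4
    have h5 : 0 ≤ ∑ a, ‖toL2 (coordinate a h)‖ := by positivity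
    unfold graphNorm
    have h6 : 0 ≤ |B| * ‖f‖ * ‖toL2 h‖ := by positivity
    have h7 : 0 ≤ ‖g‖ * ∑ a, ‖toL2 (coordinate a h)‖ := by positivity
    linarith

theorem IsUnitaryGroup.implements {M : Matrix (Fin n ⊕ Fin n) (Fin n ⊕ Fin n) ℝ}
    (hM : M.IsSymm) {U : ℝ → UnitaryOps n} (hU : IsUnitaryGroup (weylQuantization M) U) (t : ℝ)
    (ht : 0 ≤ t) : Implements (U t) (NormedSpace.exp (t • (symp n * M))) := by
  obtain ⟨δ, hδ, h⟩ := hU.exists_implements hM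
  obtain ⟨k, hk⟩ := exists_nat_ge (t / δ)
  have hk1 : (0 : ℝ) < (k + 1 : ℕ) := by positivity
  have h1 := (h (t / (k + 1 : ℕ)) (by positivity) (by
    rw [div_le_iff₀ hk1]
    rw [div_le_iff₀ hδ] at hk
    push_cast
    linarith)).pow (k + 1)
  rw [← hU.map_nat_mul, ← Matrix.exp_nsmul] at h1
  convert h1 using 2
  · field_simp
  · rw [← Nat.cast_smul_eq_nsmul ℝ, smul_smul]
    congr 1
    field_simp

/-! ### Determinants -/

/-- Jacobi's formula. -/
theorem hasDerivAt_det {m : Type*} [Fintype m] [DecidableEq m] {N : ℝ → Matrix m m ℂ}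
    {N' : Matrix m m ℂ} {t : ℝ} (h : ∀ i j, HasDerivAt (fun t => N t i j) (N' i j) t) :
    HasDerivAt (fun t => (N t).det) (((N t).adjugate * N').trace) t := by
  have h1 : HasDerivAt (fun t => (N t).det) (∑ σ : Equiv.Perm m, ((Equiv.Perm.sign σ : ℤ) : ℂ) *
      ∑ i, (∏ j ∈ Finset.univ.erase i, N t (σ j) j) • N' (σ i) i) t := by
    simp only [Matrix.det_apply']
    exact HasDerivAt.fun_sum fun σ _ => (HasDerivAt.fun_finsetProd fun i _ => h (σ i) i).const_mul _
  refine h1.congr_deriv ?_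
  simp only [Finset.mul_sum]
  rw [Finset.sum_comm, Matrix.trace]
  refine Finset.sum_congr rfl fun i _ => ?_
  have h2 : ((N t).adjugate * N').diag i = (N t).cramer (fun k => N' k i) i := by
    rw [Matrix.cramer_eq_adjugate_mulVec]
    rfl
  rw [h2, Matrix.cramer_apply, Matrix.det_apply']
  refine Finset.sum_congr rfl fun σ _ => ?_
  rw [← Finset.mul_prod_erase _ _ (Finset.mem_univ i), smul_eq_mul, Matrix.updateCol_self]
  rw [Finset.prod_congr rfl fun j hj => Matrix.updateCol_ne (Finset.ne_of_mem_erase hj)]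
  ring

/-- By Jacobi's formula det(exp(tX)) exp(-t tr X) has derivative zero. -/
theorem det_matrix_exp {m : Type*} [Fintype m] [DecidableEq m] (X : Matrix m m ℂ) :
    (NormedSpace.exp X).det = Complex.exp X.trace := by
  have hd : ∀ t : ℝ, HasDerivAt (fun t : ℝ => (NormedSpace.exp (t • X)).det *
      Complex.exp (-(t * X.trace))) 0 t := by
    intro t
    have h1 := hasDerivAt_det fun i j => hasDerivAt_matrix_exp X t i j
    have h2 : HasDerivAt (fun t : ℝ => Complex.exp (-((t : ℂ) * X.trace))) _ t :=
      (((hasDerivAt_id t).ofReal_comp.mul_const X.trace).neg).cexp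
    refine (h1.mul h2).congr_deriv ?_
    have h3 : ((NormedSpace.exp (t • X)).adjugate * (X * NormedSpace.exp (t • X))).trace =
        (NormedSpace.exp (t • X)).det * X.trace := by
      rw [Matrix.trace_mul_comm, Matrix.mul_assoc, Matrix.mul_adjugate, Matrix.mul_smul,
        Matrix.mul_one, Matrix.trace_smul, smul_eq_mul]
    rw [h3]
    simp
    ring
  have h := is_const_of_deriv_eq_zero (fun t => (hd t).differentiableAt) (fun t => (hd t).deriv) 1 0
  simp only [one_smul, zero_smul, NormedSpace.exp_zero, Matrix.det_one, Complex.ofReal_one,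
    Complex.ofReal_zero, one_mul, zero_mul, neg_zero, Complex.exp_zero] at h
  rw [Complex.exp_neg] at h
  have := Complex.exp_ne_zero X.trace
  field_simp at h
  exact h

theorem symp_eq : symp n = -Matrix.J (Fin n) ℝ := by
  simp [symp, Matrix.J, Matrix.fromBlocks_neg]

/-- Symmetry of M gives X = J(-Xᵀ)J⁻¹ for the generator X, and exponentiating this conjugation gives
exp(X) J exp(X)ᵀ = J. -/
theorem exp_mem_symplecticGroup {M : Matrix (Fin n ⊕ Fin n) (Fin n ⊕ Fin n) ℝ}
    (hM : M.IsSymm) (t : ℝ) :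
    NormedSpace.exp (t • (symp n * M)) ∈ Matrix.symplecticGroup (Fin n) ℝ := by
  rw [SymplecticGroup.mem_iff]
  set J := Matrix.J (Fin n) ℝ with hJ
  set X := t • (symp n * M) with hX
  have hu : IsUnit J := (Matrix.isUnit_iff_isUnit_det _).2 (Matrix.isUnit_det_J _ _)
  have hinv : J * J⁻¹ = 1 := Matrix.mul_nonsing_inv _ (Matrix.isUnit_det_J _ _)
  have hinv' : J⁻¹ * J = 1 := Matrix.nonsing_inv_mul _ (Matrix.isUnit_det_J _ _)
  have h1 : X = J * (-Xᵀ) * J⁻¹ := by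
    have h2 : X * J = J * (-Xᵀ) := by
      rw [hX, symp_eq, Matrix.transpose_smul, Matrix.transpose_mul, hM.eq, Matrix.transpose_neg,
        Matrix.J_transpose]
      simp [Matrix.mul_assoc, hJ]
    rw [← h2, Matrix.mul_assoc, hinv, Matrix.mul_one]
  have h3 : NormedSpace.exp X = J * NormedSpace.exp (-Xᵀ) * J⁻¹ := by
    rw [← Matrix.exp_conj J _ hu, ← h1]
  have h4 : NormedSpace.exp (-Xᵀ) * NormedSpace.exp Xᵀ = 1 := by
    rw [← Matrix.exp_add_of_commute _ _ (Commute.neg_left (Commute.refl Xᵀ)), neg_add_cancel,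
      NormedSpace.exp_zero]
  rw [← Matrix.exp_transpose, h3, Matrix.mul_assoc _ J⁻¹ J, hinv', Matrix.mul_one,
    Matrix.mul_assoc, h4, Matrix.mul_one]

/-! ### The vacuum expectation value -/

/-- The matrix whose determinant is the inverse square of the vacuum expectation value of a
metaplectic operator, up to a constant. -/
def vacMatrix (S : Matrix (Fin n ⊕ Fin n) (Fin n ⊕ Fin n) ℝ) : Matrix (Fin n) (Fin n) ℂ :=
  Matrix.of fun j k => ((S (Sum.inl j) (Sum.inl k) : ℝ) : ℂ) + ((S (Sum.inr j) (Sum.inr k) : ℝ) : ℂ) +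
    Complex.I * (((S (Sum.inl j) (Sum.inr k) : ℝ) : ℂ) - ((S (Sum.inr j) (Sum.inl k) : ℝ) : ℂ))

/-- The vacuum expectation value. -/
def vacuum (V : UnitaryOps n) : ℂ :=
  inner ℂ (toL2 (coherent (0 : Fin n → ℂ))) (op V (toL2 (coherent 0)))

theorem linQuant_single (a : Fin n ⊕ Fin n) (h : 𝓢(E n, ℂ)) :
    linQuant (Pi.single a 1) h = coordinate a h := by
  rw [linQuant_apply, Finset.sum_eq_single a]
  · simp
  · intro b _ hb; simp [hb]
  · simp

theorem Implements.inner_coordinate {V : UnitaryOps n}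
    {S : Matrix (Fin n ⊕ Fin n) (Fin n ⊕ Fin n) ℝ} (hV : Implements V S) (a : Fin n ⊕ Fin n)
    {h : 𝓢(E n, ℂ)} (hh : IsAnalyticVector h) (f : 𝓢(E n, ℂ)) :
    inner ℂ (toL2 (coordinate a h)) (op V (toL2 f)) =
      ∑ b, ((S a b : ℝ) : ℂ) * inner ℂ (toL2 h) (op V (toL2 (coordinate b f))) := by
  rw [← linQuant_single, hV.inner_eq _ hh, linQuant_apply, map_sum, map_sum, inner_sum]
  refine Finset.sum_congr rfl fun b _ => ?_
  rw [map_smul, map_smul, inner_smul_right]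
  simp

theorem momentum_coherent_zero (j : Fin n) : momentum j (coherent 0) =
    Complex.I • position j (coherent (0 : Fin n → ℂ)) := by
  rw [momentum_coherent]; simp

theorem momentum_position_coherent_zero (j k : Fin n) :
    momentum j (position k (coherent 0)) = Complex.I • position k (position j (coherent 0)) +
      (if j = k then -Complex.I else 0) • coherent (0 : Fin n → ℂ) := by
  rw [momentum_position, momentum_coherent_zero, map_smul]

/-- The vacuum is annihilated by x_j + i p_j; pairing this with W ψ and transporting the coordinates
through W gives the relation. -/
theorem Implements.sum_vacuum {W : UnitaryOps n}
    {S : Matrix (Fin n ⊕ Fin n) (Fin n ⊕ Fin n) ℝ} (hW : Implements W S) (j : Fin n)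
    (ψ : 𝓢(E n, ℂ)) :
    ∑ b, (((S (Sum.inl j) b : ℝ) : ℂ) - Complex.I * ((S (Sum.inr j) b : ℝ) : ℂ)) *
      inner ℂ (toL2 (coherent 0)) (op W (toL2 (coordinate b ψ))) = 0 := by
  have h1 := hW.inner_coordinate (Sum.inl j) (isAnalyticVector_coherent 0) ψ
  have h2 := hW.inner_coordinate (Sum.inr j) (isAnalyticVector_coherent 0) ψ
  simp only [sub_mul, Finset.sum_sub_distrib, mul_assoc, ← Finset.mul_sum]
  rw [← h1, ← h2]
  simp only [coordinate, Sum.elim_inl, Sum.elim_inr, momentum_coherent_zero, map_smul,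
    inner_smul_left, Complex.conj_I]
  linear_combination (inner ℂ (toL2 (position j (coherent 0))) (op W (toL2 ψ))) * Complex.I_sq

/-- Second moments of the vacuum. -/
def vacMoment (W : UnitaryOps n) : Matrix (Fin n) (Fin n) ℂ := Matrix.of fun k l =>
  inner ℂ (toL2 (coherent (0 : Fin n → ℂ))) (op W (toL2 (position k (position l (coherent 0)))))

/-- The previous relation with ψ = x_l φ_0. Since p_k x_l φ_0 = i x_k x_l φ_0 - iδ_{kl} φ_0, it
becomes a linear system for the second moments, driven by the vacuum expectation. -/
theorem Implements.vacMatrix_mul {W : UnitaryOps n}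
    {S : Matrix (Fin n ⊕ Fin n) (Fin n ⊕ Fin n) ℝ} (hW : Implements W S) :
    vacMatrix S * vacMoment W = vacuum W • Matrix.of fun j k =>
      ((S (Sum.inr j) (Sum.inr k) : ℝ) : ℂ) +
        Complex.I * ((S (Sum.inl j) (Sum.inr k) : ℝ) : ℂ) := by
  ext j l
  have h := hW.sum_vacuum j (position l (coherent 0))
  rw [Fintype.sum_sum_type] at h
  simp only [coordinate, Sum.elim_inl, Sum.elim_inr, momentum_position_coherent_zero, map_smul,
    inner_smul_right, map_add, inner_add_right, mul_add, Finset.sum_add_distrib] at h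
  simp only [position_comm l] at h
  have h3 : ∑ k, (((S (Sum.inl j) (Sum.inr k) : ℝ) : ℂ) -
      Complex.I * ((S (Sum.inr j) (Sum.inr k) : ℝ) : ℂ)) * ((if k = l then -Complex.I else 0) *
      inner ℂ (toL2 (coherent 0)) (op W (toL2 (coherent 0)))) =
      (((S (Sum.inl j) (Sum.inr l) : ℝ) : ℂ) -
      Complex.I * ((S (Sum.inr j) (Sum.inr l) : ℝ) : ℂ)) * (-Complex.I * vacuum W) := by
    rw [Finset.sum_eq_single l]
    · simp [vacuum]
    · intro k _ hk; simp [hk]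
    · simp
  rw [h3, ← add_assoc, ← Finset.sum_add_distrib] at h
  rw [Matrix.mul_apply, Matrix.smul_apply, Matrix.of_apply, smul_eq_mul]
  have h4 : ∑ k, vacMatrix S j k * vacMoment W k l = ∑ k,
      ((((S (Sum.inl j) (Sum.inl k) : ℝ) : ℂ) - Complex.I * ((S (Sum.inr j) (Sum.inl k) : ℝ) : ℂ)) *
      inner ℂ (toL2 (coherent 0)) (op W (toL2 (position k (position l (coherent 0))))) +
      (((S (Sum.inl j) (Sum.inr k) : ℝ) : ℂ) - Complex.I * ((S (Sum.inr j) (Sum.inr k) : ℝ) : ℂ)) *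
      (Complex.I *
      inner ℂ (toL2 (coherent 0)) (op W (toL2 (position k (position l (coherent 0))))))) := by
    refine Finset.sum_congr rfl fun k _ => ?_
    simp only [vacMatrix, vacMoment, Matrix.of_apply]
    linear_combination ((S (Sum.inr j) (Sum.inr k) : ℝ) : ℂ) *
      inner ℂ (toL2 (coherent 0)) (op W (toL2 (position k (position l (coherent 0))))) *
      Complex.I_sq
  rw [h4]
  linear_combination h - ((S (Sum.inr j) (Sum.inr l) : ℝ) : ℂ) * vacuum W * Complex.I_sq

/-- The momentum-position and momentum-momentum blocks of a quadratic form. -/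
def lowerBlock (M : Matrix (Fin n ⊕ Fin n) (Fin n ⊕ Fin n) ℝ) : Matrix (Fin n) (Fin n) ℂ :=
  Matrix.of fun j k => ((M (Sum.inr j) (Sum.inl k) : ℝ) : ℂ) +
    Complex.I * ((M (Sum.inr j) (Sum.inr k) : ℝ) : ℂ)

/-- The part of a quadratic form that couples to second powers of creation operators. -/
def pairBlock (M : Matrix (Fin n ⊕ Fin n) (Fin n ⊕ Fin n) ℝ) : Matrix (Fin n) (Fin n) ℂ :=
  Matrix.of fun j k => ((M (Sum.inl j) (Sum.inl k) : ℝ) : ℂ) +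
    Complex.I * (((M (Sum.inl j) (Sum.inr k) : ℝ) : ℂ) + ((M (Sum.inr j) (Sum.inl k) : ℝ) : ℂ)) -
    ((M (Sum.inr j) (Sum.inr k) : ℝ) : ℂ)

theorem inner_weylQuantization_vacuum {M : Matrix (Fin n ⊕ Fin n) (Fin n ⊕ Fin n) ℝ}
    (hM : M.IsSymm) (W : UnitaryOps n) :
    2 * inner ℂ (toL2 (coherent (0 : Fin n → ℂ)))
        (op W (toL2 (weylQuantization M (coherent 0)))) =
      (pairBlock M * vacMoment W).trace - Complex.I * (lowerBlock M).trace * vacuum W := by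
  rw [weylQuantization_apply_of_isSymm hM]
  have hδ : ∀ g : Fin n → Fin n → ℂ, ∑ j, ∑ k, (if j = k then g j k else 0) = ∑ j, g j j := by
    intro g; simp
  have e1 : (pairBlock M * vacMoment W).trace =
      ∑ j, ∑ k, pairBlock M j k * vacMoment W k j := rfl
  have e2 : Complex.I * (lowerBlock M).trace * vacuum W =
      ∑ j, ∑ k, (if j = k then Complex.I * lowerBlock M j k * vacuum W else 0) := by
    rw [hδ, Matrix.trace, Finset.mul_sum, Finset.sum_mul]
    rfl
  rw [e1, e2, ← Finset.sum_sub_distrib]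
  simp only [map_smul, map_sum, inner_smul_right, inner_sum, Fintype.sum_sum_type,
    ← Finset.sum_add_distrib, ← Finset.sum_sub_distrib]
  rw [← mul_assoc, mul_one_div_cancel (two_ne_zero), one_mul]
  refine Finset.sum_congr rfl fun j _ => Finset.sum_congr rfl fun k _ => ?_
  simp only [coordinate, Sum.elim_inl, Sum.elim_inr, momentum_coherent_zero, map_smul,
    momentum_position_coherent_zero, inner_smul_right, map_add, inner_add_right, lowerBlock,
    pairBlock, vacMoment, Matrix.of_apply, position_comm j k]
  by_cases h : j = k
  · simp only [h, if_true, vacuum]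
    linear_combination (((M (Sum.inr k) (Sum.inr k) : ℝ) : ℂ) *
      (inner ℂ (toL2 (coherent 0)) (op W (toL2 (position k (position k (coherent 0))))))) *
      Complex.I_sq
  · simp only [h, if_false]
    linear_combination (((M (Sum.inr j) (Sum.inr k) : ℝ) : ℂ) *
      (inner ℂ (toL2 (coherent 0)) (op W (toL2 (position k (position j (coherent 0))))))) *
      Complex.I_sq

/-- The velocity of `vacMatrix` along the flow involves the same blocks of M as the vacuum
expectation of the Hamiltonian, and the same matrix of S as `Implements.vacMatrix_mul`; this lets
Jacobi's formula match the Schrödinger equation. -/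
theorem vacMatrix_mul_symp (S M : Matrix (Fin n ⊕ Fin n) (Fin n ⊕ Fin n) ℝ) :
    vacMatrix (S * (symp n * M)) = vacMatrix S * lowerBlock M +
      Complex.I • ((Matrix.of fun j k => ((S (Sum.inr j) (Sum.inr k) : ℝ) : ℂ) +
        Complex.I * ((S (Sum.inl j) (Sum.inr k) : ℝ) : ℂ)) * pairBlock M) := by
  have hx : ∀ k b, (symp n * M) (Sum.inl k) b = M (Sum.inr k) b := by
    intro k b
    simp [symp, Matrix.mul_apply, Fintype.sum_sum_type, Matrix.one_apply]
  have hp : ∀ k b, (symp n * M) (Sum.inr k) b = -M (Sum.inl k) b := by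
    intro k b
    simp [symp, Matrix.mul_apply, Fintype.sum_sum_type, Matrix.one_apply]
  generalize symp n * M = Z at hx hp ⊢
  ext j k
  simp only [vacMatrix, Matrix.of_apply, Matrix.mul_apply, Fintype.sum_sum_type, hx, hp,
    Matrix.add_apply, Matrix.smul_apply, smul_eq_mul, Complex.ofReal_add,
    Complex.ofReal_sum, Finset.mul_sum, ← Finset.sum_add_distrib, ← Finset.sum_sub_distrib]
  refine Finset.sum_congr rfl fun e _ => ?_
  simp only [lowerBlock, pairBlock, Matrix.of_apply, Complex.ofReal_mul, Complex.ofReal_neg]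
  generalize ((S (Sum.inl j) (Sum.inr e) : ℝ) : ℂ) = s₁, ((S (Sum.inr j) (Sum.inr e) : ℝ) : ℂ) = s₂,
    ((S (Sum.inr j) (Sum.inl e) : ℝ) : ℂ) = s₃, ((M (Sum.inr e) (Sum.inl k) : ℝ) : ℂ) = m₁,
    ((M (Sum.inr e) (Sum.inr k) : ℝ) : ℂ) = m₂, ((M (Sum.inl e) (Sum.inl k) : ℝ) : ℂ) = m₃,
    ((M (Sum.inl e) (Sum.inr k) : ℝ) : ℂ) = m₄
  linear_combination (s₃ * m₂ - s₂ * m₁ - s₂ * m₄ - s₁ * m₃ - Complex.I * s₁ * (m₁ + m₄)) *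
    Complex.I_sq

/-- The squared vacuum expectation value times the determinant of `vacMatrix` is preserved by
multiplication with exponentials of quadratic Hamiltonians. -/
theorem Implements.vacuum_mul {V : UnitaryOps n}
    {S : Matrix (Fin n ⊕ Fin n) (Fin n ⊕ Fin n) ℝ} (hV : Implements V S)
    {M : Matrix (Fin n ⊕ Fin n) (Fin n ⊕ Fin n) ℝ} (hM : M.IsSymm) {U : ℝ → UnitaryOps n}
    (hU : IsUnitaryGroup (weylQuantization M) U) :
    vacuum (V * U 1) ^ 2 * (vacMatrix (S * NormedSpace.exp (symp n * M))).det =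
      vacuum V ^ 2 * (vacMatrix S).det := by
  set X := symp n * M with hX
  let St : ℝ → Matrix (Fin n ⊕ Fin n) (Fin n ⊕ Fin n) ℝ := fun t => S * NormedSpace.exp (t • X)
  have hSt : ∀ t a b, HasDerivAt (fun t => St t a b) ((St t * X) a b) t := by
    intro t a b
    have hc : X * NormedSpace.exp (t • X) = NormedSpace.exp (t • X) * X :=
      (((Commute.refl X).smul_right t).exp_right).eq
    simp only [St, Matrix.mul_assoc S, ← hc]
    simp only [Matrix.mul_apply (M := S)]
    exact HasDerivAt.fun_sum fun e _ => (hasDerivAt_matrix_exp X t e b).const_mul _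
  have hN : ∀ t j k, HasDerivAt (fun t => vacMatrix (St t) j k) (vacMatrix (St t * X) j k) t := by
    intro t j k
    simp only [vacMatrix, Matrix.of_apply]
    exact ((hSt t _ _).ofReal_comp.add (hSt t _ _).ofReal_comp).add
      (((hSt t _ _).ofReal_comp.sub (hSt t _ _).ofReal_comp).const_mul _)
  have hv : ∀ t, HasDerivAt (fun t => vacuum (V * U t))
      (-Complex.I * inner ℂ (toL2 (coherent (0 : Fin n → ℂ)))
        (op (V * U t) (toL2 (weylQuantization M (coherent 0))))) t := by
    intro t
    have h1 := ((op V).restrictScalars ℝ).hasFDerivAt.comp_hasDerivAt t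
      (hU.hasDerivAt (coherent 0) t)
    have h2 := (hasDerivAt_const t (toL2 (coherent (0 : Fin n → ℂ)))).inner ℂ h1
    refine h2.congr_deriv ?_
    rw [inner_zero_left, add_zero, ← inner_smul_right]
    change inner ℂ _ (op V (op (U t) ((-Complex.I) • _))) = _
    rw [map_smul, map_smul]
    rfl
  -- The logarithmic derivative of the determinant is minus twice that of the vacuum expectation;
  -- the identity is written without division, as neither factor is known to be nonzero.
  have hd : ∀ t, 0 ≤ t → HasDerivAt (fun t => vacuum (V * U t) ^ 2 * (vacMatrix (St t)).det) 0 t := by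
    intro t ht
    refine (((hv t).pow 2).mul (hasDerivAt_det (hN t))).congr_deriv ?_
    have hW : Implements (V * U t) (St t) := hV.mul (hU.implements hM t ht)
    have h1 := inner_weylQuantization_vacuum hM (V * U t)
    have h2 := hW.vacMatrix_mul
    set c := vacuum (V * U t) with hc
    set N := vacMatrix (St t) with hN'
    set Y : Matrix (Fin n) (Fin n) ℂ := Matrix.of fun j k =>
      ((St t (Sum.inr j) (Sum.inr k) : ℝ) : ℂ) +
        Complex.I * ((St t (Sum.inl j) (Sum.inr k) : ℝ) : ℂ) with hY
    have h3 : vacMatrix (St t * X) = N * lowerBlock M + Complex.I • (Y * pairBlock M) :=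
      vacMatrix_mul_symp (St t) M
    have h4 : (N.adjugate * vacMatrix (St t * X)).trace = N.det * (lowerBlock M).trace +
        Complex.I * (N.adjugate * Y * pairBlock M).trace := by
      rw [h3, Matrix.mul_add, ← Matrix.mul_assoc, Matrix.adjugate_mul, Matrix.trace_add,
        Matrix.mul_smul, Matrix.trace_smul, Matrix.smul_mul, Matrix.one_mul, Matrix.trace_smul,
        ← Matrix.mul_assoc, smul_eq_mul, smul_eq_mul]
    have h5 : c * (N.adjugate * Y * pairBlock M).trace =
        N.det * (pairBlock M * vacMoment (V * U t)).trace := by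
      -- The linear system is solved with the adjugate, so no invertibility of N is needed.
      have h6 : c • (N.adjugate * Y) = N.det • vacMoment (V * U t) := by
        rw [← Matrix.mul_smul, ← h2, ← Matrix.mul_assoc, Matrix.adjugate_mul, Matrix.smul_mul,
          Matrix.one_mul]
      rw [← smul_eq_mul, ← Matrix.trace_smul, ← Matrix.smul_mul, h6, Matrix.smul_mul,
        Matrix.trace_smul, Matrix.trace_mul_comm, smul_eq_mul]
    rw [h4]
    simp only [Nat.cast_ofNat, Nat.add_one_sub_one, pow_one, Pi.pow_apply, ← hc]
    linear_combination (-Complex.I * c * N.det) * h1 + (Complex.I * c) * h5 +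
      (c ^ 2 * N.det * (lowerBlock M).trace) * Complex.I_sq
  have hconst := constant_of_has_deriv_right_zero (a := (0 : ℝ)) (b := 1)
    (f := fun t => vacuum (V * U t) ^ 2 * (vacMatrix (St t)).det)
    (fun t ht => (hd t ht.1).continuousAt.continuousWithinAt)
    (fun t ht => (hd t ht.1).hasDerivWithinAt) 1 (by simp)
  simpa [St, hU.map_zero] using hconst

theorem vacMatrix_one : (vacMatrix (1 : Matrix (Fin n ⊕ Fin n) (Fin n ⊕ Fin n) ℝ)).det = 2 ^ n := by
  have : vacMatrix (1 : Matrix (Fin n ⊕ Fin n) (Fin n ⊕ Fin n) ℝ) =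
      (2 : ℂ) • (1 : Matrix (Fin n) (Fin n) ℂ) := by
    ext j k
    by_cases h : j = k
    · subst h; simp [vacMatrix]; norm_num
    · simp [vacMatrix, Matrix.one_apply, h]
  rw [this, Matrix.det_smul]
  simp

/-! ### Construction of the projection -/

theorem isExpNegI_inv {M : Matrix (Fin n ⊕ Fin n) (Fin n ⊕ Fin n) ℝ} {V : UnitaryOps n}
    (hV : IsExpNegI (weylQuantization M) V) : IsExpNegI (weylQuantization (-M)) V⁻¹ := by
  obtain ⟨U, hU, rfl⟩ := isExpNegI_iff.1 hV
  rw [weylQuantization_neg]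
  exact isExpNegI_iff.2 ⟨_, hU.neg, by simpa using hU.map_neg 1⟩

/-- Every metaplectic operator implements a symplectic matrix, and determines its vacuum
expectation value up to sign. -/
theorem exists_implements_of_mem_Mp {V : UnitaryOps n} (hV : V ∈ Mp n) :
    ∃ S ∈ Matrix.symplecticGroup (Fin n) ℝ, Implements V S ∧
      vacuum V ^ 2 * (vacMatrix S).det = vacuum (1 : UnitaryOps n) ^ 2 * 2 ^ n := by
  have step : ∀ (V W : UnitaryOps n) (M : Matrix (Fin n ⊕ Fin n) (Fin n ⊕ Fin n) ℝ), M.IsSymm →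
      IsExpNegI (weylQuantization M) W →
      (∃ S ∈ Matrix.symplecticGroup (Fin n) ℝ, Implements V S ∧
        vacuum V ^ 2 * (vacMatrix S).det = vacuum (1 : UnitaryOps n) ^ 2 * 2 ^ n) →
      ∃ S ∈ Matrix.symplecticGroup (Fin n) ℝ, Implements (V * W) S ∧
        vacuum (V * W) ^ 2 * (vacMatrix S).det = vacuum (1 : UnitaryOps n) ^ 2 * 2 ^ n := by
    rintro V W M hM hW ⟨S, hS, hVS, hv⟩
    obtain ⟨U, hU, rfl⟩ := isExpNegI_iff.1 hW
    have h1 := exp_mem_symplecticGroup hM 1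
    have h2 := hU.implements hM 1 zero_le_one
    rw [one_smul] at h1 h2
    exact ⟨_, mul_mem hS h1, hVS.mul h2, (hVS.vacuum_mul hM hU).trans hv⟩
  -- Generators are appended on the right, as in `Implements.vacuum_mul`; inverses are again
  -- generators, for -M.
  induction hV using Subgroup.closure_induction_right with
  | one => exact ⟨1, one_mem _, implements_one, by rw [vacMatrix_one]⟩
  | mul_right x hx y hy ih =>
    obtain ⟨M, hM, hy⟩ := hy
    exact step x y M hM hy ih
  | mul_inv_cancel x hx y hy ih =>
    obtain ⟨M, hM, hy⟩ := hy
    exact step x y⁻¹ (-M) hM.neg (isExpNegI_inv hy) ih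

/-- The projection from the metaplectic to the symplectic group. -/
def proj (n : ℕ) : Mp n →* Matrix.symplecticGroup (Fin n) ℝ where
  toFun V := ⟨(exists_implements_of_mem_Mp V.2).choose,
    (exists_implements_of_mem_Mp V.2).choose_spec.1⟩
  map_one' := Subtype.ext
    ((exists_implements_of_mem_Mp (one_mem (Mp n))).choose_spec.2.1.unique implements_one)
  map_mul' V W := Subtype.ext
    ((exists_implements_of_mem_Mp (V * W).2).choose_spec.2.1.unique
      ((exists_implements_of_mem_Mp V.2).choose_spec.2.1.mul
        (exists_implements_of_mem_Mp W.2).choose_spec.2.1))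

theorem implements_proj (V : Mp n) : Implements (V : UnitaryOps n) ((proj n V : Matrix.symplecticGroup (Fin n) ℝ) :
      Matrix (Fin n ⊕ Fin n) (Fin n ⊕ Fin n) ℝ) :=
  (exists_implements_of_mem_Mp V.2).choose_spec.2.1

theorem vacuum_proj (V : Mp n) :
    vacuum (V : UnitaryOps n) ^ 2 * (vacMatrix ((proj n V : Matrix.symplecticGroup (Fin n) ℝ) :
      Matrix (Fin n ⊕ Fin n) (Fin n ⊕ Fin n) ℝ)).det =
      vacuum (1 : UnitaryOps n) ^ 2 * 2 ^ n :=
  (exists_implements_of_mem_Mp V.2).choose_spec.2.2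

theorem isProjection_proj (n : ℕ) : IsProjection (proj n) := by
  intro M hM V hV
  obtain ⟨U, hU, hU1⟩ := isExpNegI_iff.1 hV
  have h := hU.implements hM 1 zero_le_one
  rw [hU1, one_smul] at h
  exact (implements_proj V).unique h

/-! ### The kernel of the projection -/

/-- On coherent states √2 ∂/∂z_j is the creation operator x_j - i p_j, so commutation with
coordinates becomes a differential equation in z. -/
theorem coherent_cohDeriv (z h : Fin n → ℂ) :
    ((√2 : ℝ) : ℂ) • cohDeriv z h = ∑ j, h j •
      (position j (coherent z) - Complex.I • momentum j (coherent z)) := by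
  have h2 : ((√2 : ℝ) : ℂ) * ((√2 : ℝ) : ℂ) = 2 := by
    rw [← Complex.ofReal_mul, Real.mul_self_sqrt (by norm_num)]; simp
  rw [cohDeriv, Finset.smul_sum]
  refine Finset.sum_congr rfl fun j _ => ?_
  rw [momentum_coherent, smul_comm]
  congr 1
  ext x
  simp only [_root_.smul_apply, _root_.sub_apply, smul_eq_mul]
  linear_combination (position j (coherent z) x) * (h2 + Complex.I_sq) -
    (((√2 : ℝ) : ℂ) * z j * coherent z x) * Complex.I_sq

theorem vacuum_one_ne_zero (n : ℕ) : vacuum (1 : UnitaryOps n) ≠ 0 := by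
  rw [vacuum, op_one, inner_coherent]
  refine mul_ne_zero ?_ (Complex.exp_ne_zero _)
  rw [Complex.cpow_def_of_ne_zero (by exact_mod_cast Real.pi_ne_zero)]
  exact Complex.exp_ne_zero _

theorem dense_span_coherent (n : ℕ) :
    Dense (Submodule.span ℂ (Set.range fun z : Fin n → ℂ => toL2 (coherent z)) : Set (L2 n)) := by
  rw [Submodule.dense_iff_topologicalClosure_eq_top, Submodule.topologicalClosure_eq_top_iff,
    Submodule.eq_bot_iff]
  intro f hf
  exact eq_zero_of_inner_coherent fun z =>
    (Submodule.mem_orthogonal _ f).1 hf _ (Submodule.subset_span ⟨z, rfl⟩)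

theorem clm_ext_coherent {A B : L2 n →L[ℂ] L2 n}
    (h : ∀ z, A (toL2 (coherent z)) = B (toL2 (coherent z))) : A = B :=
  ContinuousLinearMap.ext_on (dense_span_coherent n) (by rintro _ ⟨z, rfl⟩; exact h z)

theorem Implements.inner_coordinate_coherent {V : UnitaryOps n} (hV : Implements V 1)
    (a : Fin n ⊕ Fin n) (z : Fin n → ℂ) (f : 𝓢(E n, ℂ)) :
    inner ℂ (toL2 (coordinate a (coherent z))) (op V (toL2 f)) =
      inner ℂ (toL2 (coherent z)) (op V (toL2 (coordinate a f))) := by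
  rw [hV.inner_coordinate a (isAnalyticVector_coherent z), Finset.sum_eq_single a]
  · simp
  · intro b _ hb; simp [Matrix.one_apply_ne hb.symm]
  · simp

theorem hasDerivAt_ofReal_smul (w : Fin n → ℂ) (t : ℝ) :
    HasDerivAt (fun t : ℝ => (t : ℂ) • w) w t := by
  simpa using ((hasDerivAt_id t).ofReal_comp).smul_const w

/-- The creation operator on the left passes through V as the annihilation operator, of which φ_z is
an eigenvector with eigenvalue √2 z_j. -/
theorem Implements.inner_cohDeriv {V : UnitaryOps n} (hV : Implements V 1) (u w z : Fin n → ℂ) :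
    inner ℂ (toL2 (cohDeriv u w)) (op V (toL2 (coherent z))) =
      (∑ j, (starRingEnd ℂ) (w j) * z j) *
        inner ℂ (toL2 (coherent u)) (op V (toL2 (coherent z))) := by
  have hs : ((√2 : ℝ) : ℂ) ≠ 0 := by simp
  refine mul_left_cancel₀ hs ?_
  rw [← Complex.conj_ofReal, ← inner_smul_left, ← map_smul, coherent_cohDeriv, map_sum,
    sum_inner, Finset.sum_mul, Finset.mul_sum]
  refine Finset.sum_congr rfl fun j _ => ?_
  have hx := hV.inner_coordinate_coherent (Sum.inl j) u (coherent z)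
  have hp := hV.inner_coordinate_coherent (Sum.inr j) u (coherent z)
  simp only [coordinate, Sum.elim_inl, Sum.elim_inr] at hx hp
  rw [map_smul, inner_smul_left, map_sub, inner_sub_left, map_smul, inner_smul_left, hx, hp,
    momentum_coherent]
  simp only [map_sub, map_smul, inner_sub_right, inner_smul_right, Complex.conj_I,
    Complex.conj_ofReal]
  generalize inner ℂ (toL2 (coherent u)) (op V (toL2 (position j (coherent z)))) = p
  generalize inner ℂ (toL2 (coherent u)) (op V (toL2 (coherent z))) = q
  linear_combination ((starRingEnd ℂ) (w j) * (p - ((√2 : ℝ) : ℂ) * z j * q)) * Complex.I_sq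

/-- Along the ray t ↦ t w the preceding formula is a linear equation with constant coefficient,
solved by an exponential. -/
theorem Implements.inner_coherent_eq {V : UnitaryOps n} (hV : Implements V 1) (w z : Fin n → ℂ) :
    inner ℂ (toL2 (coherent w)) (op V (toL2 (coherent z))) =
      Complex.exp (∑ j, (starRingEnd ℂ) (w j) * z j) *
        inner ℂ (toL2 (coherent 0)) (op V (toL2 (coherent z))) := by
  set κ := ∑ j, (starRingEnd ℂ) (w j) * z j with hκ
  have hd : ∀ t : ℝ, HasDerivAt (fun t : ℝ => inner ℂ (toL2 (coherent ((t : ℂ) • w)))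
      (op V (toL2 (coherent z))) * Complex.exp (-((t : ℂ) * κ))) 0 t := by
    intro t
    have h1 : HasDerivAt (fun t : ℝ => inner ℂ (toL2 (coherent ((t : ℂ) • w)))
        (op V (toL2 (coherent z)))) (inner ℂ (toL2 (cohDeriv ((t : ℂ) • w) w))
        (op V (toL2 (coherent z)))) t := by
      have h := (hasDerivAt_inner_coherent (op V (toL2 (coherent z)))
        (hasDerivAt_ofReal_smul w t)).star
      simpa only [inner_conj_symm, RCLike.star_def] using h
    have h2 : HasDerivAt (fun t : ℝ => Complex.exp (-((t : ℂ) * κ)))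
        (Complex.exp (-((t : ℂ) * κ)) * -(1 * κ)) t :=
      (((hasDerivAt_id t).ofReal_comp.mul_const κ).neg).cexp
    refine (h1.mul h2).congr_deriv ?_
    rw [hV.inner_cohDeriv]
    ring
  have h := is_const_of_deriv_eq_zero (fun t => (hd t).differentiableAt)
    (fun t => (hd t).deriv) 1 0
  simp only [Complex.ofReal_one, one_smul, one_mul, Complex.ofReal_zero, zero_smul, zero_mul,
    neg_zero, Complex.exp_zero, mul_one] at h
  rw [← h, mul_left_comm, ← Complex.exp_add, add_neg_cancel, Complex.exp_zero, mul_one]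

/-- The creation operator moves to the left as an annihilation operator, which kills φ_0. -/
theorem Implements.inner_zero_op_cohDeriv {V : UnitaryOps n} (hV : Implements V 1)
    (u z : Fin n → ℂ) : inner ℂ (toL2 (coherent 0)) (op V (toL2 (cohDeriv u z))) = 0 := by
  have hs : ((√2 : ℝ) : ℂ) ≠ 0 := by simp
  refine mul_left_cancel₀ hs ?_
  rw [← inner_smul_right, ← map_smul, ← map_smul, coherent_cohDeriv, mul_zero, map_sum,
    map_sum, inner_sum]
  refine Finset.sum_eq_zero fun j _ => ?_
  have hx := hV.inner_coordinate_coherent (Sum.inl j) 0 (coherent u)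
  have hp := hV.inner_coordinate_coherent (Sum.inr j) 0 (coherent u)
  simp only [coordinate, Sum.elim_inl, Sum.elim_inr] at hx hp
  simp only [map_smul, map_sub, inner_sub_right, inner_smul_right]
  rw [← hx, ← hp, momentum_coherent_zero, map_smul, inner_smul_left, Complex.conj_I]
  generalize inner ℂ (toL2 (position j (coherent 0))) (op V (toL2 (coherent u))) = p
  linear_combination (z j * p) * Complex.I_sq

theorem Implements.inner_zero_op_coherent {V : UnitaryOps n} (hV : Implements V 1)
    (z : Fin n → ℂ) : inner ℂ (toL2 (coherent 0)) (op V (toL2 (coherent z))) = vacuum V := by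
  have hd : ∀ t : ℝ, HasDerivAt (fun t : ℝ => inner ℂ (op V⁻¹ (toL2 (coherent 0)))
      (toL2 (coherent ((t : ℂ) • z)))) 0 t := by
    intro t
    refine (hasDerivAt_inner_coherent (op V⁻¹ (toL2 (coherent 0)))
      (hasDerivAt_ofReal_smul z t)).congr_deriv ?_
    rw [← inner_op_right, hV.inner_zero_op_cohDeriv]
  have h := is_const_of_deriv_eq_zero (fun t => (hd t).differentiableAt)
    (fun t => (hd t).deriv) 1 0
  simp only [Complex.ofReal_one, one_smul, Complex.ofReal_zero, zero_smul] at h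
  rw [inner_op_right, h, ← inner_op_right]
  rfl

/-- Schur's lemma for the canonical commutation relations. -/
theorem Implements.eq_smul {V : UnitaryOps n} (hV : Implements V 1) :
    ∃ c : ℂ, ∀ f, op V f = c • f := by
  have hc0 := vacuum_one_ne_zero n
  refine ⟨vacuum V / vacuum (1 : UnitaryOps n), fun f => ?_⟩
  have h := clm_ext_coherent (A := op V)
    (B := (vacuum V / vacuum (1 : UnitaryOps n)) • ContinuousLinearMap.id ℂ (L2 n)) fun z => ?_
  · rw [h]; rfl
  · refine eq_of_inner_coherent fun w => ?_
    have h0 : (Real.pi : ℂ) ^ (n / 2 : ℂ) = vacuum (1 : UnitaryOps n) := by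
      rw [vacuum, op_one, inner_coherent]; simp
    change _ = inner ℂ _ ((vacuum V / vacuum (1 : UnitaryOps n)) • toL2 (coherent z))
    rw [hV.inner_coherent_eq, hV.inner_zero_op_coherent, inner_smul_right, inner_coherent, h0]
    field_simp

/-- Schur's lemma gives V = c, and the quadratic vacuum invariant sees exactly c². -/
theorem eq_or_neg_of_proj_eq_one {V : Mp n} (hV : proj n V = 1) :
    (∀ f, op (V : UnitaryOps n) f = f) ∨ ∀ f, op (V : UnitaryOps n) f = -f := by
  have h1 := implements_proj V
  have h2 := vacuum_proj V
  rw [hV] at h1 h2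
  obtain ⟨c, hc⟩ := Implements.eq_smul h1
  rw [OneMemClass.coe_one, vacMatrix_one] at h2
  have h3 : vacuum (V : UnitaryOps n) = c * vacuum (1 : UnitaryOps n) := by
    rw [vacuum, hc, inner_smul_right]; rfl
  have h4 := vacuum_one_ne_zero n
  rw [h3] at h2
  have h5 : c ^ 2 = 1 := by
    have h6 : vacuum (1 : UnitaryOps n) ^ 2 * 2 ^ n ≠ 0 :=
      mul_ne_zero (pow_ne_zero _ h4) (pow_ne_zero _ two_ne_zero)
    have : (c ^ 2 - 1) * (vacuum (1 : UnitaryOps n) ^ 2 * 2 ^ n) = 0 := by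
      linear_combination h2
    exact sub_eq_zero.1 ((mul_eq_zero.1 this).resolve_right h6)
  have h6 : (c - 1) * (c + 1) = 0 := by linear_combination h5
  rcases mul_eq_zero.1 h6 with h | h
  · left
    intro f
    rw [hc, sub_eq_zero.1 h, one_smul]
  · right
    intro f
    rw [hc, eq_neg_of_add_eq_zero_left h, neg_smul, one_smul]

/-! ### The action of the unitary group on coherent states -/

/-- The action `z ↦ s̄ z` of the unitary group on the parameters of coherent states. -/
def conjAct (s : Matrix.unitaryGroup (Fin n) ℂ) (z : Fin n → ℂ) : Fin n → ℂ :=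
  (s : Matrix (Fin n) (Fin n) ℂ).map (starRingEnd ℂ) *ᵥ z

theorem conjAct_apply (s : Matrix.unitaryGroup (Fin n) ℂ) (z : Fin n → ℂ) (j : Fin n) :
    conjAct s z j = ∑ k, (starRingEnd ℂ) ((s : Matrix (Fin n) (Fin n) ℂ) j k) * z k := rfl

theorem conjAct_one (z : Fin n → ℂ) : conjAct 1 z = z := by
  simp [conjAct]

theorem conjAct_mul (s t : Matrix.unitaryGroup (Fin n) ℂ) (z : Fin n → ℂ) :
    conjAct (s * t) z = conjAct s (conjAct t z) := by
  simp [conjAct, Matrix.map_mul]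

theorem sum_conj_conjAct (s : Matrix.unitaryGroup (Fin n) ℂ) (w z : Fin n → ℂ) :
    ∑ j, (starRingEnd ℂ) (conjAct s w j) * conjAct s z j = ∑ j, (starRingEnd ℂ) (w j) * z j := by
  have h : ((s : Matrix (Fin n) (Fin n) ℂ).map (starRingEnd ℂ))ᴴ *
      (s : Matrix (Fin n) (Fin n) ℂ).map (starRingEnd ℂ) = 1 := by
    have h1 := Matrix.mem_unitaryGroup_iff'.1 s.2
    have h2 := congrArg (fun m => m.map (starRingEnd ℂ)) h1
    simp only [Matrix.map_mul, Matrix.star_eq_conjTranspose] at h2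
    have h3 : (s : Matrix (Fin n) (Fin n) ℂ)ᴴ.map (starRingEnd ℂ) *
        (s : Matrix (Fin n) (Fin n) ℂ).map (starRingEnd ℂ) = 1 := by simpa using h2
    exact h3
  change star (conjAct s w) ⬝ᵥ conjAct s z = star w ⬝ᵥ z
  rw [conjAct, conjAct, Matrix.star_mulVec, ← Matrix.dotProduct_mulVec, Matrix.mulVec_mulVec, h,
    Matrix.one_mulVec]

theorem inner_coherent_conjAct (s : Matrix.unitaryGroup (Fin n) ℂ) (w z : Fin n → ℂ) :
    inner ℂ (toL2 (coherent (conjAct s w))) (toL2 (coherent (conjAct s z))) =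
      inner ℂ (toL2 (coherent w)) (toL2 (coherent z)) := by
  rw [inner_coherent, inner_coherent, sum_conj_conjAct]

theorem denseRange_linearCombination_coherent (n : ℕ) :
    DenseRange (Finsupp.linearCombination ℂ fun z : Fin n → ℂ => toL2 (coherent z)) := by
  have h := dense_span_coherent n
  rwa [← Finsupp.range_linearCombination] at h

/-- The Gram matrices agree, so the norms are in fact equal; the form with constant 1 is the one
required by `LinearMap.extendOfNorm`. -/
theorem norm_linearCombination_conjAct (s : Matrix.unitaryGroup (Fin n) ℂ)
    (x : (Fin n → ℂ) →₀ ℂ) :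
    ‖Finsupp.linearCombination ℂ (fun z => toL2 (coherent (conjAct s z))) x‖ ≤
      1 * ‖Finsupp.linearCombination ℂ (fun z => toL2 (coherent z)) x‖ := by
  rw [one_mul, @norm_eq_sqrt_re_inner ℂ, @norm_eq_sqrt_re_inner ℂ]
  simp only [Finsupp.linearCombination_apply, Finsupp.sum, sum_inner, inner_sum, inner_smul_left,
    inner_smul_right, inner_coherent_conjAct, le_refl]

/-- The operator with `φ_z ↦ φ_{s̄z}` on coherent states. -/
def rotation (s : Matrix.unitaryGroup (Fin n) ℂ) : L2 n →L[ℂ] L2 n :=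
  (Finsupp.linearCombination ℂ fun z => toL2 (coherent (conjAct s z))).extendOfNorm
    (Finsupp.linearCombination ℂ fun z => toL2 (coherent z))

theorem rotation_coherent (s : Matrix.unitaryGroup (Fin n) ℂ) (z : Fin n → ℂ) :
    rotation s (toL2 (coherent z)) = toL2 (coherent (conjAct s z)) := by
  have h := LinearMap.extendOfNorm_eq (denseRange_linearCombination_coherent n)
    ⟨1, norm_linearCombination_conjAct s⟩ (Finsupp.single z 1)
  simpa [Finsupp.linearCombination_single, rotation] using h

theorem rotation_one : rotation (1 : Matrix.unitaryGroup (Fin n) ℂ) = 1 :=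
  clm_ext_coherent fun z => by rw [rotation_coherent, conjAct_one]; rfl

theorem rotation_mul (s t : Matrix.unitaryGroup (Fin n) ℂ) :
    rotation (s * t) = rotation s * rotation t :=
  clm_ext_coherent fun z => by
    change _ = rotation s (rotation t _)
    rw [rotation_coherent, rotation_coherent, rotation_coherent, conjAct_mul]

theorem star_rotation (s : Matrix.unitaryGroup (Fin n) ℂ) : star (rotation s) = rotation s⁻¹ := by
  refine clm_ext_coherent fun z => eq_of_inner_coherent fun w => ?_
  rw [ContinuousLinearMap.star_eq_adjoint, ContinuousLinearMap.adjoint_inner_right,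
    rotation_coherent, rotation_coherent, ← inner_coherent_conjAct s w, ← conjAct_mul,
    mul_inv_cancel, conjAct_one]

/-- The representation of `U(n)` on `L²(ℝⁿ)` with `φ_z ↦ φ_{s̄z}` on coherent states. -/
def rho (n : ℕ) : Matrix.unitaryGroup (Fin n) ℂ →* UnitaryOps n where
  toFun s := ⟨rotation s, by
    rw [Unitary.mem_iff, star_rotation, ← rotation_mul, ← rotation_mul, inv_mul_cancel,
      mul_inv_cancel, rotation_one]
    exact ⟨rfl, rfl⟩⟩
  map_one' := Subtype.ext rotation_one
  map_mul' s t := Subtype.ext (rotation_mul s t)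

theorem rho_coherent (s : Matrix.unitaryGroup (Fin n) ℂ) (z : Fin n → ℂ) :
    op (rho n s) (toL2 (coherent z)) = toL2 (coherent (conjAct s z)) := rotation_coherent s z

/-- The parameter is recovered from the eigenvalues of the annihilation operators. -/
theorem coherent_injective : Function.Injective (coherent : (Fin n → ℂ) → 𝓢(E n, ℂ)) := by
  intro z w h
  funext j
  have h1 := momentum_coherent z j
  rw [h, momentum_coherent w j, sub_right_inj] at h1
  have h2 := congrArg (fun f : 𝓢(E n, ℂ) => f 0) h1
  have h3 : coherent w (0 : E n) ≠ 0 := by rw [coherent_apply]; exact Complex.exp_ne_zero _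
  simp only [_root_.smul_apply, smul_eq_mul] at h2
  have h4 := mul_right_cancel₀ h3 h2
  have h5 : Complex.I * ((√2 : ℝ) : ℂ) ≠ 0 := by simp
  exact (mul_left_cancel₀ h5 h4).symm

theorem rho_injective (n : ℕ) : Function.Injective (rho n) := by
  rw [injective_iff_map_eq_one]
  intro s hs
  have h : ∀ z, conjAct s z = z := by
    intro z
    apply coherent_injective
    apply toL2_injective
    rw [← rho_coherent, hs, op_one]
  apply Subtype.ext
  ext j k
  have h1 := congrFun (h (Pi.single k 1)) j
  rw [conjAct, Matrix.mulVec_single_one] at h1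
  have h2 := congrArg (starRingEnd ℂ) h1
  by_cases hjk : j = k
  · subst hjk; simpa using h2
  · simpa [hjk, Matrix.one_apply] using h2

/-- Unitarity makes approximation of f by combinations of coherent states uniform in the parameter
of U. -/
theorem continuous_op_of_dense {X : Type*} [TopologicalSpace X] {U : X → UnitaryOps n}
    (h : ∀ z : Fin n → ℂ, Continuous fun s => op (U s) (toL2 (coherent z))) (f : L2 n) :
    Continuous fun s => op (U s) f := by
  refine continuous_of_uniform_approx_of_continuous fun u hu => ?_
  obtain ⟨ε, hε, hεu⟩ := Metric.mem_uniformity_dist.1 hu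
  obtain ⟨g, hg, hfg⟩ := Metric.dense_iff.1 (dense_span_coherent n) f ε hε
  refine ⟨fun s => op (U s) g, ?_, fun s => hεu ?_⟩
  · clear hg
    induction hfg using Submodule.span_induction with
    | mem x hx => obtain ⟨z, rfl⟩ := hx; exact h z
    | zero => simpa using continuous_const
    | add x y _ _ hx hy => simp only [map_add]; exact hx.add hy
    | smul a x _ hx => simp only [map_smul]; exact hx.const_smul a
  · rw [dist_eq_norm, ← map_sub, norm_op, ← dist_eq_norm, dist_comm]
    exact hg

theorem continuous_rho (f : L2 n) : Continuous fun s => op (rho n s) f := by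
  refine continuous_op_of_dense (fun z => ?_) f
  simp only [rho_coherent]
  refine continuous_toL2_coherent.comp ?_
  refine continuous_pi fun j => ?_
  simp only [conjAct_apply]
  refine continuous_finsetSum _ fun k _ => Continuous.mul (Complex.continuous_conj.comp ?_)
    continuous_const
  exact continuous_subtype_val.matrix_elem j k

/-! ### Generators -/

/-- The matrix of the Hamiltonian of `exp(B + iA)`. -/
abbrev hamMatrix (A B : Matrix (Fin n) (Fin n) ℝ) : Matrix (Fin n ⊕ Fin n) (Fin n ⊕ Fin n) ℝ :=
  Matrix.fromBlocks A (-B) B A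

theorem hamMatrix_isSymm {A B : Matrix (Fin n) (Fin n) ℝ} (hA : Aᵀ = A) (hB : Bᵀ = -B) :
    (hamMatrix A B).IsSymm := by
  rw [Matrix.IsSymm, Matrix.fromBlocks_transpose, hA, Matrix.transpose_neg, hB, neg_neg]

theorem sum_eq_zero_of_antisymm {D : Fin n → Fin n → ℂ} (h : ∀ j k, D j k = -D k j) :
    ∑ j, ∑ k, D j k = 0 := by
  have h1 : ∑ j, ∑ k, D j k = -∑ j, ∑ k, D j k := by
    conv_rhs => rw [Finset.sum_comm]
    simp only [← Finset.sum_neg_distrib]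
    exact Finset.sum_congr rfl fun j _ => Finset.sum_congr rfl fun k _ => h j k
  exact self_eq_neg.1 h1

/-- With creation operators a_j* to the left of annihilation operators a_k, this Hamiltonian has
only terms a_j* a_k and the constant tr A/2. On φ_z the a_k are numbers and the a_j* are derivatives
in z. The constant is the source of √det. -/
theorem weylQuantization_hamMatrix_coherent {A B : Matrix (Fin n) (Fin n) ℝ} (hA : Aᵀ = A)
    (hB : Bᵀ = -B) (z : Fin n → ℂ) :
    weylQuantization (hamMatrix A B) (coherent z) =
      cohDeriv z (fun j => ∑ k, ((A j k : ℂ) + Complex.I * (B j k : ℂ)) * z k) +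
        ((A.trace / 2 : ℝ) : ℂ) • coherent z := by
  rw [weylQuantization_apply_of_isSymm (hamMatrix_isSymm hA hB)]
  have h2 : ((√2 : ℝ) : ℂ) * ((√2 : ℝ) : ℂ) = 2 := by
    rw [← Complex.ofReal_mul, Real.mul_self_sqrt (by norm_num)]; simp
  have hA' : ∀ j k, (A j k : ℂ) = A k j := fun j k => by
    conv_lhs => rw [← hA, Matrix.transpose_apply]
  have hB' : ∀ j k, (B j k : ℂ) = -B k j := fun j k => by
    rw [← Complex.ofReal_neg, ← Matrix.neg_apply, ← hB, Matrix.transpose_apply]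
  have htr : ((A.trace : ℝ) : ℂ) = ∑ j, ∑ k, if j = k then (A j k : ℂ) else 0 := by
    simp [Matrix.trace]
  ext x
  rw [_root_.add_apply, cohDeriv_apply, _root_.smul_apply, _root_.smul_apply]
  simp only [Fintype.sum_sum_type, Matrix.fromBlocks_apply₁₁, Matrix.fromBlocks_apply₁₂,
    Matrix.fromBlocks_apply₂₁, Matrix.fromBlocks_apply₂₂, coordinate, Sum.elim_inl, Sum.elim_inr,
    momentum_coherent, map_sub, map_smul, momentum_position, smul_eq_mul]
  simp only [_root_.sum_apply, _root_.smul_apply, _root_.sub_apply, _root_.add_apply,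
    position_apply_eq, smul_eq_mul, ← Finset.sum_add_distrib]
  rw [Complex.ofReal_div, htr, Complex.ofReal_ofNat]
  set q := ((√2 : ℝ) : ℂ)
  set φ := coherent z x
  rw [← sub_eq_zero]
  -- The two sides do not agree term by term in (j, k); their difference is this antisymmetric
  -- expression, which sums to zero.
  have hD := sum_eq_zero_of_antisymm (n := n) (D := fun j k =>
    ((A j k : ℂ) * (q * ((x k : ℝ) : ℂ) * z j - q * ((x j : ℝ) : ℂ) * z k) +
      Complex.I * (B j k : ℂ) * (2 * z j * z k - q * ((x j : ℝ) : ℂ) * z k -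
        q * ((x k : ℝ) : ℂ) * z j)) * (φ / 2))
    (fun j k => by rw [hA' j k, hB' j k]; ring)
  refine Eq.trans ?_ hD
  simp only [Finset.mul_sum, Finset.sum_mul, Finset.sum_div, ← Finset.sum_add_distrib,
    ← Finset.sum_sub_distrib]
  refine Finset.sum_congr rfl fun j _ => Finset.sum_congr rfl fun k _ => ?_
  by_cases h : j = k
  · subst h
    simp only [if_true]
    push_cast [Matrix.neg_apply]
    linear_combination (A j j * φ * (-((x j : ℝ) : ℂ) * q * z j + ((x j : ℝ) : ℂ) ^ 2 / 2 - 1 / 2 +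
      z j ^ 2)) * Complex.I_sq + (A j j * φ * z j ^ 2 * Complex.I ^ 2 / 2) * h2 -
      (φ * Complex.I / 4) * hB' j j
  · simp only [h, if_false]
    push_cast [Matrix.neg_apply]
    linear_combination (A j k * φ * (((x j : ℝ) : ℂ) * ((x k : ℝ) : ℂ) / 2 -
      ((x j : ℝ) : ℂ) * q * z k / 2 - ((x k : ℝ) : ℂ) * q * z j / 2 + z j * z k)) * Complex.I_sq +
      (A j k * φ * z j * z k * Complex.I ^ 2 / 2) * h2

theorem cohDeriv_smul (z h : Fin n → ℂ) (c : ℂ) : cohDeriv z (c • h) = c • cohDeriv z h := by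
  simp only [cohDeriv, Finset.smul_sum, smul_smul, Pi.smul_apply, smul_eq_mul]

theorem skew_smul (t : ℝ) (A B : Matrix (Fin n) (Fin n) ℝ) :
    skew (t • A) (t • B) = t • skew A B := by
  ext j k
  simp [skew]
  ring

/-- The conjugate of B + iA is -i(A + iB), so parameters move along the vector field of the
preceding formula, times -i. -/
theorem hasDerivAt_conjAct {A B : Matrix (Fin n) (Fin n) ℝ} {u : ℝ → Matrix.unitaryGroup (Fin n) ℂ}
    (hu : ∀ t, (u t : Matrix (Fin n) (Fin n) ℂ) = NormedSpace.exp (t • skew A B))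
    (z : Fin n → ℂ) (t : ℝ) :
    HasDerivAt (fun t => conjAct (u t) z) ((-Complex.I) • fun j =>
      ∑ k, ((A j k : ℂ) + Complex.I * (B j k : ℂ)) * conjAct (u t) z k) t := by
  refine hasDerivAt_pi.2 fun j => ?_
  simp only [conjAct_apply, hu]
  refine (HasDerivAt.fun_sum fun k _ =>
    ((hasDerivAt_matrix_exp (skew A B) t j k).star).mul_const (z k)).congr_deriv ?_
  simp only [RCLike.star_def, Matrix.mul_apply, map_sum, map_mul, Pi.smul_apply, smul_eq_mul,
    Finset.sum_mul, Finset.mul_sum]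
  rw [Finset.sum_comm]
  refine Finset.sum_congr rfl fun l _ => Finset.sum_congr rfl fun k _ => ?_
  generalize (NormedSpace.exp (t • skew A B) : Matrix (Fin n) (Fin n) ℂ) = Y
  simp only [skew, Matrix.add_apply, Matrix.map_apply, Matrix.smul_apply, smul_eq_mul, map_add,
    map_mul, Complex.conj_ofReal, Complex.conj_I]
  linear_combination (B j l * (starRingEnd ℂ) (Y l k) * z k) * Complex.I_sq

/-- The weak form of the Schrödinger equation determines the generator on Schwartz functions. -/
theorem isUnitaryGroup_of_inner {T : 𝓢(E n, ℂ) →L[ℂ] 𝓢(E n, ℂ)} {U : ℝ → UnitaryOps n}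
    (hadd : ∀ s t, U (s + t) = U s * U t) (hcont : ∀ f, Continuous fun t => op (U t) f)
    (hd : ∀ (z : Fin n → ℂ) (f : 𝓢(E n, ℂ)) (t : ℝ),
      HasDerivAt (fun t => inner ℂ (toL2 (coherent z)) (op (U t) (toL2 f)))
        (inner ℂ (toL2 (coherent z)) (op (U t) ((-Complex.I) • toL2 (T f)))) t) :
    IsUnitaryGroup T U where
  add := hadd
  cont := hcont
  deriv f := by
    have h0 : U 0 = 1 := by
      have := hadd 0 0
      rw [add_zero] at this
      exact left_eq_mul.1 this
    set g : L2 n := (-Complex.I) • toL2 (T f) with hg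
    have hI : ∀ t, HasDerivAt (fun t => ∫ s in (0 : ℝ)..t, op (U s) g) (op (U t) g) t := fun t =>
      intervalIntegral.integral_hasDerivAt_right ((hcont g).intervalIntegrable _ _)
        ((hcont g).stronglyMeasurableAtFilter _ _) (hcont g).continuousAt
    -- Integrating the weak equation makes it strong: the integrand is norm continuous, so the right
    -- side is differentiable in L².
    have key : ∀ t, op (U t) (toL2 f) = toL2 f + ∫ s in (0 : ℝ)..t, op (U s) g := by
      intro t
      refine eq_of_inner_coherent fun z => ?_
      have hz : ∀ t, HasDerivAt (fun t => inner ℂ (toL2 (coherent z)) (op (U t) (toL2 f)) -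
          inner ℂ (toL2 (coherent z)) (toL2 f + ∫ s in (0 : ℝ)..t, op (U s) g)) 0 t := by
        intro t
        have h1 := (hasDerivAt_const t (toL2 (coherent z))).inner ℂ ((hI t).const_add (toL2 f))
        refine ((hd z f t).sub h1).congr_deriv ?_
        rw [inner_zero_left, add_zero, sub_self]
      have h := is_const_of_deriv_eq_zero (fun t => (hz t).differentiableAt)
        (fun t => (hz t).deriv) t 0
      simp only [h0, op_one, intervalIntegral.integral_same, add_zero, sub_self] at h
      exact sub_eq_zero.1 h
    have h1 : HasDerivAt (fun t => op (U t) (toL2 f)) (op (U 0) g) 0 :=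
      ((hI 0).const_add (toL2 f)).congr_of_eventuallyEq (Filter.Eventually.of_forall key)
    rwa [h0, op_one] at h1

theorem isUnitaryGroup_rho {A B : Matrix (Fin n) (Fin n) ℝ} (hA : Aᵀ = A) (hB : Bᵀ = -B)
    {u : ℝ → Matrix.unitaryGroup (Fin n) ℂ}
    (hu : ∀ t, (u t : Matrix (Fin n) (Fin n) ℂ) = NormedSpace.exp (t • skew A B)) :
    IsUnitaryGroup (weylQuantization (hamMatrix A B) +
      ((-(A.trace / 2) : ℝ) : ℂ) • ContinuousLinearMap.id ℂ 𝓢(E n, ℂ)) fun t => rho n (u t) := by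
  have hadd : ∀ s t, u (s + t) = u s * u t := by
    intro s t
    apply Subtype.ext
    rw [hu, Submonoid.coe_mul, hu, hu, matrix_exp_add_smul]
  have h0 : u 0 = 1 := by
    apply Subtype.ext
    rw [hu, zero_smul, NormedSpace.exp_zero, OneMemClass.coe_one]
  have hneg : ∀ t, (u t)⁻¹ = u (-t) := by
    intro t
    rw [inv_eq_iff_mul_eq_one, ← hadd, add_neg_cancel, h0]
  have hu' : Continuous u := by
    refine continuous_induced_rng.2 ?_
    refine continuous_matrix fun i j => ?_
    simp only [Function.comp_apply, hu]
    exact continuous_iff_continuousAt.2 fun t => (hasDerivAt_matrix_exp _ t i j).continuousAt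
  refine isUnitaryGroup_of_inner (fun s t => by rw [hadd, map_mul])
    (fun f => (continuous_rho f).comp hu') fun z f t => ?_
  have hT : ∀ w, cohDeriv w (fun j => ∑ k, ((A j k : ℂ) + Complex.I * (B j k : ℂ)) * w k) =
      weylQuantization (hamMatrix A B) (coherent w) -
        ((A.trace / 2 : ℝ) : ℂ) • coherent w := fun w => by
    rw [weylQuantization_hamMatrix_coherent hA hB, add_sub_cancel_right]
  have e : ∀ (t : ℝ) (g : L2 n), inner ℂ (toL2 (coherent z)) (op (rho n (u t)) g) =
      inner ℂ (toL2 (coherent (conjAct (u (-t)) z))) g := by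
    intro t g
    rw [inner_op_right, ← map_inv, rho_coherent, hneg]
  have h1 := (hasDerivAt_conjAct hu z (-t)).scomp t (hasDerivAt_neg t)
  have h2 := (hasDerivAt_inner_coherent (toL2 f) h1).star
  simp only [RCLike.star_def, inner_conj_symm] at h2
  refine (h2.congr_of_eventuallyEq (Filter.Eventually.of_forall fun s => e s _)).congr_deriv ?_
  rw [e]
  set w := conjAct (u (-t)) z
  change inner ℂ (toL2 (cohDeriv w _)) _ = _
  rw [neg_smul, one_smul, neg_smul, neg_neg, cohDeriv_smul, hT, map_smul, map_sub, map_smul,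
    inner_smul_left, inner_sub_left, inner_smul_left, inner_weylQuantization, inner_smul_right]
  simp only [_root_.add_apply, _root_.smul_apply, ContinuousLinearMap.id_apply, map_add, map_smul,
    inner_add_right, inner_smul_right, Complex.conj_ofReal, Complex.conj_I, Complex.ofReal_neg]
  ring

/-! ### Phases -/

/-- Multiplication by `e^{iθ}`. -/
def phase (n : ℕ) (θ : ℝ) : UnitaryOps n :=
  ⟨Complex.exp (Complex.I * θ) • 1, by
    have h : star (Complex.exp (Complex.I * θ)) * Complex.exp (Complex.I * θ) = 1 := by
      rw [RCLike.star_def, ← Complex.exp_conj, ← Complex.exp_add]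
      simp
    rw [Unitary.mem_iff, star_smul, star_one]
    simp only [smul_mul_smul_comm, mul_one, h, mul_comm _ (star _), one_smul, and_self]⟩

theorem op_phase (θ : ℝ) (f : L2 n) : op (phase n θ) f = Complex.exp (Complex.I * θ) • f := rfl

theorem phase_add (θ η : ℝ) : phase n (θ + η) = phase n θ * phase n η := by
  refine unitaryOps_ext fun f => ?_
  rw [op_mul, op_phase, op_phase, op_phase, smul_smul, ← Complex.exp_add]
  push_cast
  ring_nf

theorem phase_mul_comm (θ : ℝ) (V : UnitaryOps n) : phase n θ * V = V * phase n θ := by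
  refine unitaryOps_ext fun f => ?_
  rw [op_mul, op_mul, op_phase, op_phase, map_smul]

theorem IsUnitaryGroup.phase_mul {T : 𝓢(E n, ℂ) →L[ℂ] 𝓢(E n, ℂ)} {U : ℝ → UnitaryOps n}
    (hU : IsUnitaryGroup T U) (c : ℝ) :
    IsUnitaryGroup (T + (c : ℂ) • ContinuousLinearMap.id ℂ 𝓢(E n, ℂ))
      fun t => phase n (-(c * t)) * U t where
  add s t := by
    rw [hU.add, mul_add, neg_add, phase_add, mul_assoc, ← mul_assoc (phase n (-(c * t))),
      phase_mul_comm _ (U s)]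
    simp only [mul_assoc]
  cont f := by
    simp only [op_mul, op_phase]
    have h : Continuous fun t : ℝ => Complex.exp (Complex.I * ((-(c * t) : ℝ) : ℂ)) := by fun_prop
    exact h.smul (hU.cont f)
  deriv f := by
    simp only [op_mul, op_phase]
    have h1 : HasDerivAt (fun t : ℝ => Complex.exp (Complex.I * ((-(c * t) : ℝ) : ℂ)))
        (-Complex.I * c) 0 := by
      have h : HasDerivAt (fun t : ℝ => Complex.I * ((-(c * t) : ℝ) : ℂ)) (-Complex.I * c) 0 := by
        have := (((hasDerivAt_id (0 : ℝ)).const_mul c).neg.ofReal_comp).const_mul Complex.I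
        simpa using this
      simpa using h.cexp
    refine (h1.smul (hU.deriv f)).congr_deriv ?_
    rw [hU.map_zero, op_one]
    simp only [mul_zero, neg_zero, Complex.ofReal_zero, Complex.exp_zero,
      _root_.add_apply, _root_.smul_apply, ContinuousLinearMap.id_apply, map_add, map_smul,
      smul_add, smul_smul, one_mul]

/-! ### Logarithms of unitary matrices -/

section Log

open scoped Matrix.Norms.L2Operator

/-- A finite spectrum makes the discontinuous argument continuous on it, so the functional calculus
applies even when -1 is an eigenvalue. -/
theorem exp_argSelfAdjoint {𝒜 : Type*} [CStarAlgebra 𝒜] {u : unitary 𝒜}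
    (hu : (spectrum ℂ (u : 𝒜)).Finite) :
    NormedSpace.exp (Complex.I • (Unitary.argSelfAdjoint u : 𝒜)) = u := by
  have h1 : ContinuousOn (fun z : ℂ => (Complex.arg z : ℂ)) (spectrum ℂ (u : 𝒜)) :=
    hu.continuousOn _
  rw [Unitary.argSelfAdjoint_coe, ← CFC.exp_eq_normedSpace_exp (𝕜 := ℂ),
    ← cfc_comp_smul .., ← cfc_comp' ..]
  conv_rhs => rw [← cfc_id' ℂ (u : 𝒜)]
  refine cfc_congr fun y hy => ?_
  have hy₁ : ‖y‖ = 1 := spectrum.norm_eq_one_of_unitary u.2 hy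
  have h2 : Complex.I * y.arg = Complex.log y :=
    Complex.ext (by simp [Complex.log_re, hy₁]) (by simp [Complex.log_im])
  have h3 : y ≠ 0 := norm_ne_zero_iff.1 (by rw [hy₁]; exact one_ne_zero)
  simpa [← Complex.exp_eq_exp_ℂ, h2] using Complex.exp_log h3

/-- Hermitian logarithms of unitary matrices. -/
theorem exists_log (n : ℕ) : ∃ H : Matrix.unitaryGroup (Fin n) ℂ → Matrix (Fin n) (Fin n) ℂ,
    (∀ s, (H s)ᴴ = H s) ∧ (∀ s, NormedSpace.exp (Complex.I • H s) = s) ∧ H 1 = 0 ∧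
      ContinuousAt H 1 := by
  refine ⟨fun s => (Unitary.argSelfAdjoint s : Matrix (Fin n) (Fin n) ℂ), fun s => ?_, fun s => ?_,
    ?_, ?_⟩
  · exact (Unitary.argSelfAdjoint s).2
  · exact exp_argSelfAdjoint (Matrix.finite_spectrum _)
  · change cfc _ ((1 : Matrix.unitaryGroup (Fin n) ℂ) : Matrix (Fin n) (Fin n) ℂ) = 0
    rw [OneMemClass.coe_one, cfc_apply_one]
    simp
  -- Within distance 2 of the identity the eigenvalue -1, where the argument jumps, cannot occur.
  · exact continuous_subtype_val.continuousAt.comp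
      (Unitary.continuousOn_argSelfAdjoint.continuousAt (Metric.ball_mem_nhds _ two_pos))

end Log

theorem exists_expSkew_eq {H : Matrix (Fin n) (Fin n) ℂ} (hH : Hᴴ = H)
    {s : Matrix.unitaryGroup (Fin n) ℂ} (hs : NormedSpace.exp (Complex.I • H) = s) :
    ∃ (A B : Matrix (Fin n) (Fin n) ℝ) (hA : Aᵀ = A) (hB : Bᵀ = -B),
      expSkew A B hA hB = s ∧ A.trace = H.trace.re := by
  have h : ∀ i j, (starRingEnd ℂ) (H j i) = H i j := fun i j => congrFun (congrFun hH i) j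
  refine ⟨H.map Complex.re, -(H.map Complex.im), ?_, ?_, ?_, ?_⟩
  · ext i j
    simp [← h i j]
  · ext i j
    simp [← h i j]
  · apply Subtype.ext
    rw [← hs]
    change NormedSpace.exp (skew _ _) = _
    congr 1
    ext i j
    apply Complex.ext <;> simp [skew]
  · simp [Matrix.trace, Complex.re_sum]

theorem exists_eq_expSkew (s : Matrix.unitaryGroup (Fin n) ℂ) :
    ∃ (A B : Matrix (Fin n) (Fin n) ℝ) (hA : Aᵀ = A) (hB : Bᵀ = -B), expSkew A B hA hB = s := by
  obtain ⟨H, h1, h2, -⟩ := exists_log n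
  obtain ⟨A, B, hA, hB, h, -⟩ := exists_expSkew_eq (h1 s) (h2 s)
  exact ⟨A, B, hA, hB, h⟩

/-- The logarithm is continuous at 1 and vanishes there. The bound π on the trace makes exp(i tr
A/2) the principal root of the determinant. -/
theorem eventually_eq_expSkew (n : ℕ) : ∀ᶠ s : Matrix.unitaryGroup (Fin n) ℂ in 𝓝 1,
    ∃ (A B : Matrix (Fin n) (Fin n) ℝ) (hA : Aᵀ = A) (hB : Bᵀ = -B),
      expSkew A B hA hB = s ∧ |A.trace| < Real.pi := by
  obtain ⟨H, h1, h2, h3, h4⟩ := exists_log n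
  have h5 : ContinuousAt (fun s => |(H s).trace.re|) 1 := by
    have : Continuous fun M : Matrix (Fin n) (Fin n) ℂ => |M.trace.re| :=
      (Complex.continuous_re.comp continuous_id.matrix_trace).abs
    exact this.continuousAt.comp h4
  have h6 := h5.eventually_lt_const (u := Real.pi) (by simp [h3, Real.pi_pos])
  filter_upwards [h6] with s hs
  obtain ⟨A, B, hA, hB, h, ht⟩ := exists_expSkew_eq (h1 s) (h2 s)
  exact ⟨A, B, hA, hB, h, by rwa [ht]⟩

theorem det_expSkew {A B : Matrix (Fin n) (Fin n) ℝ} (hA : Aᵀ = A) (hB : Bᵀ = -B) :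
    (expSkew A B hA hB : Matrix (Fin n) (Fin n) ℂ).det =
      Complex.exp (Complex.I * (A.trace : ℂ)) := by
  have hB0 : B.trace = 0 := by
    have h := congrArg Matrix.trace hB
    rw [Matrix.trace_transpose, Matrix.trace_neg] at h
    exact self_eq_neg.1 h
  change (NormedSpace.exp (skew A B)).det = _
  rw [det_matrix_exp]
  congr 1
  have h1 : (B.map fun r : ℝ => (r : ℂ)).trace = ((B.trace : ℝ) : ℂ) := by simp [Matrix.trace]
  have h2 : (A.map fun r : ℝ => (r : ℂ)).trace = ((A.trace : ℝ) : ℂ) := by simp [Matrix.trace]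
  rw [skew, Matrix.trace_add, Matrix.trace_smul, h1, h2, hB0]
  simp

theorem sqrt_det_expSkew {A B : Matrix (Fin n) (Fin n) ℝ} (hA : Aᵀ = A) (hB : Bᵀ = -B)
    (h : |A.trace| < Real.pi) :
    (expSkew A B hA hB : Matrix (Fin n) (Fin n) ℂ).det ^ (1 / 2 : ℂ) =
      Complex.exp (Complex.I * (A.trace : ℂ) / 2) := by
  rw [det_expSkew, Complex.cpow_def_of_ne_zero (Complex.exp_ne_zero _), Complex.log_exp]
  · ring_nf
  · simpa using (abs_lt.1 h).1
  · simpa using (abs_lt.1 h).2.le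

/-! ### The unitary group inside the symplectic group -/

theorem realification_mul (s t : Matrix (Fin n) (Fin n) ℂ) :
    realification (s * t) = realification s * realification t := by
  have h1 : (s * t).map Complex.re = s.map Complex.re * t.map Complex.re -
      s.map Complex.im * t.map Complex.im := by
    ext i j; simp [Matrix.mul_apply, Complex.re_sum, Finset.sum_sub_distrib]
  have h2 : (s * t).map Complex.im = s.map Complex.re * t.map Complex.im +
      s.map Complex.im * t.map Complex.re := by
    ext i j; simp [Matrix.mul_apply, Complex.im_sum, Finset.sum_add_distrib]
  rw [realification, realification, realification, Matrix.fromBlocks_multiply, h1, h2,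
    Matrix.fromBlocks_inj]
  refine ⟨?_, ?_, ?_, ?_⟩ <;> noncomm_ring

theorem realification_one : realification (1 : Matrix (Fin n) (Fin n) ℂ) = 1 := by
  rw [← Matrix.fromBlocks_one, realification, Matrix.fromBlocks_inj]
  refine ⟨?_, ?_, ?_, ?_⟩ <;> ext i j <;> by_cases h : i = j <;> simp [Matrix.one_apply, h]

/-- `realification` as a ring homomorphism. -/
def realificationHom (n : ℕ) :
    Matrix (Fin n) (Fin n) ℂ →+* Matrix (Fin n ⊕ Fin n) (Fin n ⊕ Fin n) ℝ where
  toFun := realification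
  map_one' := realification_one
  map_mul' := realification_mul
  map_zero' := by
    rw [realification, ← Matrix.fromBlocks_zero]
    simp
  map_add' s t := by
    rw [realification, realification, realification, Matrix.fromBlocks_add, Matrix.fromBlocks_inj]
    refine ⟨?_, ?_, ?_, ?_⟩ <;> ext i j <;> simp [add_comm]

theorem continuous_realification :
    Continuous (realification : Matrix (Fin n) (Fin n) ℂ → _) :=
  Continuous.matrix_fromBlocks (continuous_id.matrix_map Complex.continuous_re)
    (continuous_id.matrix_map Complex.continuous_im)
    (continuous_id.matrix_map Complex.continuous_im).neg
    (continuous_id.matrix_map Complex.continuous_re)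

theorem realification_exp (X : Matrix (Fin n) (Fin n) ℂ) :
    realification (NormedSpace.exp X) = NormedSpace.exp (realification X) := by
  let _ : NormedRing (Matrix (Fin n) (Fin n) ℂ) := Matrix.linftyOpNormedRing
  let _ : NormedAlgebra ℝ (Matrix (Fin n) (Fin n) ℂ) := Matrix.linftyOpNormedAlgebra
  let _ : NormedRing (Matrix (Fin n ⊕ Fin n) (Fin n ⊕ Fin n) ℝ) := Matrix.linftyOpNormedRing
  let _ : NormedAlgebra ℝ (Matrix (Fin n ⊕ Fin n) (Fin n ⊕ Fin n) ℝ) := Matrix.linftyOpNormedAlgebra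
  let _ : NormedAlgebra ℚ (Matrix (Fin n) (Fin n) ℂ) := NormedAlgebra.restrictScalars ℚ ℝ _
  exact NormedSpace.map_exp (realificationHom n) continuous_realification X

theorem realification_expSkew {A B : Matrix (Fin n) (Fin n) ℝ} (hA : Aᵀ = A) (hB : Bᵀ = -B) :
    realification (expSkew A B hA hB : Matrix (Fin n) (Fin n) ℂ) =
      hamiltonianFlow (hamMatrix A B) := by
  change realification (NormedSpace.exp (skew A B)) = _
  rw [realification_exp, hamiltonianFlow, Matrix.fromBlocks_multiply, realification]
  congr 2
  all_goals
    ext i j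
    simp [skew]

/-! ### The representation of the unitary group -/

section Generators

variable {A B : Matrix (Fin n) (Fin n) ℝ}

theorem exists_isUnitaryGroup_expSkew (hA : Aᵀ = A) (hB : Bᵀ = -B) : ∃ u : ℝ → Matrix.unitaryGroup (Fin n) ℂ,
    u 1 = expSkew A B hA hB ∧
    IsUnitaryGroup (weylQuantization (hamMatrix A B) +
      ((-(A.trace / 2) : ℝ) : ℂ) • ContinuousLinearMap.id ℂ 𝓢(E n, ℂ)) fun t => rho n (u t) := by
  have hu : ∀ t : ℝ, (expSkew (t • A) (t • B) (by rw [Matrix.transpose_smul, hA])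
      (by rw [Matrix.transpose_smul, hB, smul_neg]) : Matrix (Fin n) (Fin n) ℂ) =
      NormedSpace.exp (t • skew A B) := fun t => by rw [← skew_smul]; rfl
  refine ⟨_, ?_, isUnitaryGroup_rho hA hB hu⟩
  apply Subtype.ext
  rw [hu, one_smul]
  rfl

theorem rho_expSkew_mem_Mpc (hA : Aᵀ = A) (hB : Bᵀ = -B) : rho n (expSkew A B hA hB) ∈ Mpc n := by
  obtain ⟨u, hu, hU⟩ := exists_isUnitaryGroup_expSkew hA hB
  exact Subgroup.subset_closure ⟨_, _, hamMatrix_isSymm hA hB,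
    isExpNegI_iff.2 ⟨_, hU, congrArg (rho n) hu⟩⟩

/-- The phase exp(-i tr A/2) removes the constant -tr A/2 from the generator, which brings the
operator from Mpᶜ(n) into Mp(n). -/
theorem isExpNegI_phase_mul_rho (hA : Aᵀ = A) (hB : Bᵀ = -B) :
    IsExpNegI (weylQuantization (hamMatrix A B))
    (phase n (-(A.trace / 2)) * rho n (expSkew A B hA hB)) := by
  obtain ⟨u, hu, hU⟩ := exists_isUnitaryGroup_expSkew hA hB
  have h := hU.phase_mul (A.trace / 2)
  rw [add_assoc, ← add_smul, ← Complex.ofReal_add, neg_add_cancel, Complex.ofReal_zero, zero_smul,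
    add_zero] at h
  exact isExpNegI_iff.2 ⟨_, h, by rw [mul_one, hu]⟩

theorem phase_mul_rho_mem_Mp (hA : Aᵀ = A) (hB : Bᵀ = -B) :
    phase n (-(A.trace / 2)) * rho n (expSkew A B hA hB) ∈ Mp n :=
  Subgroup.subset_closure ⟨_, hamMatrix_isSymm hA hB, isExpNegI_phase_mul_rho hA hB⟩

end Generators

/-- The representation of `U(n)` in the complex metaplectic group. -/
def rep (n : ℕ) : Matrix.unitaryGroup (Fin n) ℂ →* Mpc n :=
  (rho n).codRestrict (Mpc n) fun s => by
    obtain ⟨A, B, hA, hB, rfl⟩ := exists_eq_expSkew s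
    exact rho_expSkew_mem_Mpc hA hB

theorem rep_injective (n : ℕ) : Function.Injective (rep n) := fun _ _ h =>
  rho_injective n (congrArg Subtype.val h)

theorem op_phase_mul_rho (θ : ℝ) (s : Matrix.unitaryGroup (Fin n) ℂ) :
    op (rho n s) = Complex.exp (Complex.I * θ) • op (phase n (-θ) * rho n s) := by
  ext1 f
  change _ = Complex.exp (Complex.I * θ) • op (phase n (-θ) * rho n s) f
  rw [op_mul, op_phase, smul_smul, ← Complex.exp_add]
  simp

/-! ### Local sections -/

/-- The operator `(det s)^{-1/2} R(s)`. -/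
def rootRho (s : Matrix.unitaryGroup (Fin n) ℂ) : UnitaryOps n :=
  phase n (-((s : Matrix (Fin n) (Fin n) ℂ).det.arg / 2)) * rho n s

theorem arg_det_expSkew {A B : Matrix (Fin n) (Fin n) ℝ} (hA : Aᵀ = A) (hB : Bᵀ = -B)
    (h : |A.trace| < Real.pi) :
    (expSkew A B hA hB : Matrix (Fin n) (Fin n) ℂ).det.arg = A.trace := by
  rw [det_expSkew, mul_comm, Complex.arg_exp_mul_I, toIocMod_eq_self]
  constructor <;> linarith [abs_lt.1 h]

open Classical in
/-- A local section of the projection over the unitary group. -/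
def localSection (n : ℕ) (s : Matrix.unitaryGroup (Fin n) ℂ) : Mp n :=
  if h : rootRho s ∈ Mp n then ⟨rootRho s, h⟩ else 1

theorem eventually_localSection (n : ℕ) : ∀ᶠ s : Matrix.unitaryGroup (Fin n) ℂ in 𝓝 1,
    (localSection n s : UnitaryOps n) = rootRho s ∧
      ((proj n (localSection n s) : Matrix.symplecticGroup (Fin n) ℝ) :
        Matrix (Fin n ⊕ Fin n) (Fin n ⊕ Fin n) ℝ) =
        realification (s : Matrix (Fin n) (Fin n) ℂ) ∧
      op (rho n s) = ((s : Matrix (Fin n) (Fin n) ℂ).det ^ (1 / 2 : ℂ)) • op (rootRho s) ∧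
      (s : Matrix (Fin n) (Fin n) ℂ).det ∈ Complex.slitPlane := by
  have h1 : ∀ᶠ s : Matrix.unitaryGroup (Fin n) ℂ in 𝓝 1,
      (s : Matrix (Fin n) (Fin n) ℂ).det ∈ Complex.slitPlane := by
    have hc : Continuous fun s : Matrix.unitaryGroup (Fin n) ℂ =>
        (s : Matrix (Fin n) (Fin n) ℂ).det := continuous_subtype_val.matrix_det
    refine hc.continuousAt.eventually_mem (Complex.isOpen_slitPlane.mem_nhds ?_)
    simp
  filter_upwards [eventually_eq_expSkew n, h1] with s hs hs1
  obtain ⟨A, B, hA, hB, rfl, ht⟩ := hs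
  have h2 : rootRho (expSkew A B hA hB) =
      phase n (-(A.trace / 2)) * rho n (expSkew A B hA hB) := by
    rw [rootRho, arg_det_expSkew hA hB ht]
  have h3 : (localSection n (expSkew A B hA hB) : UnitaryOps n) = rootRho (expSkew A B hA hB) := by
    rw [localSection, dif_pos (h2 ▸ phase_mul_rho_mem_Mp hA hB)]
  refine ⟨h3, ?_, ?_, hs1⟩
  · rw [realification_expSkew]
    refine isProjection_proj n _ (hamMatrix_isSymm hA hB) _ ?_
    rw [h3, h2]
    exact isExpNegI_phase_mul_rho hA hB
  · rw [sqrt_det_expSkew hA hB ht, h2, op_phase_mul_rho (A.trace / 2)]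
    congr 2
    push_cast
    ring

theorem isLocalSection_localSection (n : ℕ) : IsLocalSection (proj n) (localSection n) := by
  refine ⟨?_, _, eventually_localSection n, fun s hs => hs.2.1, fun f s hs => ?_⟩
  · have h : rootRho (1 : Matrix.unitaryGroup (Fin n) ℂ) = 1 := by
      refine unitaryOps_ext fun f => ?_
      rw [rootRho, op_mul, op_phase, map_one]
      simp
    apply Subtype.ext
    rw [localSection, dif_pos (h ▸ one_mem _)]
    exact h
  · refine ContinuousWithinAt.congr (f := fun s => op (rootRho s) f) ?_
      (fun t ht => by rw [ht.1]) (by rw [hs.1])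
    refine ContinuousAt.continuousWithinAt ?_
    simp only [rootRho, op_mul, op_phase]
    have hc : Continuous fun s : Matrix.unitaryGroup (Fin n) ℂ =>
        (s : Matrix (Fin n) (Fin n) ℂ).det := continuous_subtype_val.matrix_det
    have h1 : ContinuousAt (fun s : Matrix.unitaryGroup (Fin n) ℂ =>
        (s : Matrix (Fin n) (Fin n) ℂ).det.arg) s :=
      (Complex.continuousAt_arg hs.2.2.2).comp (f := fun s : Matrix.unitaryGroup (Fin n) ℂ =>
        (s : Matrix (Fin n) (Fin n) ℂ).det) hc.continuousAt
    have h2 : Continuous fun θ : ℝ => Complex.exp (Complex.I * ((-(θ / 2) : ℝ) : ℂ)) := by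
      fun_prop
    exact ContinuousAt.smul (h2.continuousAt.comp h1) (continuous_rho f).continuousAt

/-- Local sections of the projection agree near the identity. -/
theorem IsLocalSection.eventuallyEq {σ τ : Matrix.unitaryGroup (Fin n) ℂ → Mp n}
    (hσ : IsLocalSection (proj n) σ) (hτ : IsLocalSection (proj n) τ) :
    ∀ᶠ s in 𝓝 1, σ s = τ s := by
  obtain ⟨hσ1, N, hN, hσN, hσc⟩ := hσ
  obtain ⟨hτ1, N', hN', hτN, hτc⟩ := hτ
  set g : L2 n := toL2 (coherent 0) with hg
  have hg0 : 0 < ‖g‖ := by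
    refine norm_pos_iff.2 fun h => vacuum_one_ne_zero n ?_
    rw [vacuum, op_one, ← hg, h, inner_zero_left]
  have hc : ContinuousAt (fun s => ‖op (σ s : UnitaryOps n) g - op (τ s : UnitaryOps n) g‖) 1 :=
    (((hσc g).continuousAt hN).sub ((hτc g).continuousAt hN')).norm
  -- If the sections differed by the sign -1, this norm would be 2‖g‖; it vanishes at 1, so near 1
  -- it is below ‖g‖.
  have hlt := hc.eventually_lt_const (u := ‖g‖) (by simpa [hσ1, hτ1] using hg0)
  filter_upwards [hN, hN', hlt] with s hs hs' hs1
  have hp : proj n (σ s * (τ s)⁻¹) = 1 := by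
    rw [map_mul, map_inv, mul_inv_eq_one]
    exact Subtype.ext ((hσN s hs).trans (hτN s hs').symm)
  have hm : ∀ f, op ((σ s * (τ s)⁻¹ : Mp n) : UnitaryOps n) (op (τ s : UnitaryOps n) f) =
      op (σ s : UnitaryOps n) f := by
    intro f
    rw [← op_mul, ← Subgroup.coe_mul, inv_mul_cancel_right]
  rcases eq_or_neg_of_proj_eq_one hp with h | h
  · refine Subtype.ext (unitaryOps_ext fun f => ?_)
    rw [← hm, h]
  · exfalso
    have h1 := hm g
    rw [h] at h1
    rw [← h1, ← neg_add', norm_neg, ← two_smul ℝ, norm_smul, norm_op] at hs1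
    norm_num at hs1
    linarith

end Metaplectic

end

/-! ### The main theorem -/

theorem mainTheorem3 (n : ℕ) :
    ∃ (π : Metaplectic.Mp n →* Matrix.symplecticGroup (Fin n) ℝ)
      (R : Matrix.unitaryGroup (Fin n) ℂ →* Metaplectic.Mpc n),
      Metaplectic.IsProjection π ∧
      -- `R` is the global extension of the local map `s ↦ π⁻¹(s) √(det s)`
      (∃ σ, Metaplectic.IsLocalSection π σ) ∧
      (∀ σ, Metaplectic.IsLocalSection π σ →
        ∀ᶠ s : Matrix.unitaryGroup (Fin n) ℂ in nhds 1,
          Metaplectic.op (R s : Metaplectic.UnitaryOps n) = ((s : Matrix (Fin n) (Fin n) ℂ).det ^ (1 / 2 : ℂ)) • Metaplectic.op (σ s : Metaplectic.UnitaryOps n)) ∧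
      -- `R` is a monomorphism and a strongly continuous unitary representation
      Function.Injective R ∧
      (∀ f : Metaplectic.L2 n, Continuous fun s => Metaplectic.op (R s : Metaplectic.UnitaryOps n) f) ∧
      -- the explicit formula for `R` in terms of Hamiltonians
      (∀ (A B : Matrix (Fin n) (Fin n) ℝ) (hA : Aᵀ = A) (hB : Bᵀ = -B),
        ∃ V : Metaplectic.Mp n,
          (∀ W : Metaplectic.UnitaryOps n,
            Metaplectic.IsExpNegI
              (Metaplectic.weylQuantization (Matrix.fromBlocks A (-B) B A)) W ↔ W = V) ∧
          Metaplectic.op (R (Metaplectic.expSkew A B hA hB) : Metaplectic.UnitaryOps n) =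
            Complex.exp (Complex.I * (A.trace : ℂ) / 2) • Metaplectic.op (V : Metaplectic.UnitaryOps n) ∧
          Complex.exp (Complex.I * (A.trace : ℂ) / 2) ^ 2 =
            (Metaplectic.expSkew A B hA hB : Matrix (Fin n) (Fin n) ℂ).det) := by
  refine ⟨Metaplectic.proj n, Metaplectic.rep n, Metaplectic.isProjection_proj n,
    ⟨_, Metaplectic.isLocalSection_localSection n⟩, fun σ hσ => ?_, Metaplectic.rep_injective n,
    Metaplectic.continuous_rho, fun A B hA hB => ?_⟩
  · filter_upwards [hσ.eventuallyEq (Metaplectic.isLocalSection_localSection n),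
      Metaplectic.eventually_localSection n] with s h1 h2
    rw [h1, h2.1]
    exact h2.2.2.1
  · refine ⟨⟨_, Metaplectic.phase_mul_rho_mem_Mp hA hB⟩, fun W => ⟨fun hW =>
      Metaplectic.isExpNegI_unique hW (Metaplectic.isExpNegI_phase_mul_rho hA hB), ?_⟩, ?_, ?_⟩
    · rintro rfl
      exact Metaplectic.isExpNegI_phase_mul_rho hA hB
    · refine (Metaplectic.op_phase_mul_rho (A.trace / 2) _).trans ?_
      congr 2
      push_cast
      ring
    · rw [Metaplectic.det_expSkew, ← Complex.exp_nat_mul]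
      congr 1
      push_cast
      ring
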